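/- **Setting.** Fix a countably infinite set of variables and infinitely many predicates of each finite arity. An *instance* is a (possibly infinite) set of atoms $R(v_1,\dots,v_n)$ over variables. For instances, $I\models J$ means that $J[\theta]\subseteq I$ for some map $\theta$ from variables to variables; for a set $\mathcal J$ of instances, $I\models\mathcal J$ means $I\models J$ for some $J\in\mathcal J$. $V(I)$ is the set of variables occurring in $I$. A *tgd* is a rule $B\to H$ with $B,H$ finite instances, written $B(X,Y)\to H(X,Z)$ with $X=V(B)\cap V(H)$, $Y=V(B)\setminus X$, $Z=V(H)\setminus X$; an *egd* is a rule $B\to x=y$ with $B$ a finite instance and $x,y\in V(B)$. $I$ satisfies the tgd if for every map $\theta$ of the variables with $B[\theta]\subseteq I$ there is $\theta'$ that agrees with $\theta$ on $X$ with $H[\theta']\subseteq I$; $I$ satisfies the egd if $B[\theta]\subseteq I$ implies $\theta(x)=\theta(y)$. For a set $\Sigma$ of tgds and egds, $D\wedge\Sigma\models\mathcal Q$ means that every instance $M$ with $M\models D$ that satisfies $\Sigma$ has $M\models\mathcal Q$. **Datalog rewriting.** A Datalog rewriting for $(\Sigma,\mathcal Q)$ is a triple $(\mathcal A,\Gamma,G)$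 where $\mathcal A$ is a set of predicates not occurring in $\Sigma$ or $\mathcal Q$; $\Gamma$ is a finite set of tgds $B\to H$ with $V(H)\subseteq V(B)$; $G=\{\mathsf G()\}$ for a $0$-ary predicate $\mathsf G\in\mathcal A$; and for every instance $D$ (finite or not) in which no predicate of $\mathcal A$ occurs, $D\wedge\Sigma\models\mathcal Q$ if and only if $D\wedge\Gamma\models G$. **Substitution-free simulation.** Let $\Sigma$ be a set of tgds and egds and let $\mathsf E$ be a binary predicate not occurring in $\Sigma$. A set $\Sigma'$ of tgds belongs to $\mathsf{Sim}_{\mathsf E}(\Sigma)$ if it consists of $\mathsf E(x,y)\to\mathsf E(y,x)$; $\mathsf E(x,y),\mathsf E(y,z)\to\mathsf E(x,z)$; for every predicate $R$ occurring in $\Sigma$, the tgd $R(x_1,\dots,x_n)\to\mathsf E(x_1,x_1),\dots,\mathsf E(x_n,x_n)$; and, for every rule of $\Sigma$, one tgd obtained from it as follows: as long as some variable $x$ has more than one occurrence in the non-$\mathsf E$ atoms of the body, choose one such occurrence, replace it by a fresh variable $x'$, and add $\mathsf E(x,x')$ to the body; finally, if the rule is an egd with conclusion $x=y$, replace this conclusion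 by $\mathsf E(x,y)$. **Oblivious termination.** For a set $\Sigma'$ of tgds, let $P_{\Sigma'}$ be the logic program obtained by replacing, in each $r=B(X,Y)\to H(X,Z)$ of $\Sigma'$, every $z\in Z$ in the head by the Skolem term $f_{r,z}(X)$, with a distinct function symbol $f_{r,z}$ for each $r$ and $z$; let $P_{\Sigma'}(I)$ be its minimal Herbrand model containing the instance $I$. The set $\Sigma'$ of tgds ensures oblivious termination if $P_{\Sigma'}(I)$ is finite for every finite instance $I$. A set $\Sigma$ of tgds and egds ensures oblivious termination if some $\Sigma'\in\mathsf{Sim}_{\mathsf E}(\Sigma)$, for some such $\mathsf E$, does. **Corollary 4.** There is an algorithm (a single partial recursive function on finite codes) that, given a finite set $\Sigma$ of tgds and egds ensuring oblivious termination and a finite set $\mathcal Q$ of finite instances, halts and outputs a Datalog rewriting $(\mathcal A,\Gamma,G)$ for $(\Sigma,\mathcal Q)$, with $\mathcal A$ finite. -/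

import Mathlib

namespace DatalogRew

/-! ## Variables, predicates, atoms, instances -/

/-- The countably infinite supply of variables. -/
abbrev Var : Type := ℕ

/-- A predicate is a name together with its arity; there are infinitely many predicates of
each arity. -/
abbrev Pred : Type := ℕ × ℕ

/-- An atom `R(t₁, …, tₙ)` over terms in `τ`: the name of `R` and the tuple `t₁, …, tₙ`. The
predicate of the atom is the pair of that name and the length `n` of the tuple (see `pred`),
so that every atom respects the arity of its predicate. -/
abbrev Atom (τ : Type) : Type := ℕ × List τ

/-- The predicate of an atom. -/
def pred {τ : Type} (a : Atom τ) : Pred := (a.1, a.2.length)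

/-- Apply a map to every term of an atom. -/
def mapAtom {τ τ' : Type} (θ : τ → τ') (a : Atom τ) : Atom τ' := (a.1, a.2.map θ)

/-- An instance is a (possibly infinite) set of atoms over variables. -/
abbrev Instance : Type := Set (Atom Var)

/-- The predicates that occur in a set of atoms. -/
def predsOf (I : Instance) : Set Pred := pred '' I

/-- The variables that occur in a finite instance. -/
def vars (B : Finset (Atom Var)) : Finset Var := B.biUnion (fun a => a.2.toFinset)

/-- `I[θ]` for a renaming `θ`. -/
def rename (θ : Var → Var) (I : Instance) : Instance := mapAtom θ '' I

/-- `I ⊨ J` for instances: `J[θ] ⊆ I` for some renaming `θ`. -/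
def Entails (I J : Instance) : Prop := ∃ θ : Var → Var, rename θ J ⊆ I

/-- `I ⊨ 𝒥` for an instance `I` and a set `𝒥` of instances (read as a disjunction). -/
def EntailsSet (I : Instance) (𝒥 : Set Instance) : Prop := ∃ J ∈ 𝒥, Entails I J

/-! ## Dependencies -/

/-- A tgd `B → H`, where `B` and `H` are finite instances. -/
@[ext]
structure Tgd where
  body : Finset (Atom Var)
  head : Finset (Atom Var)

/-- An egd `B → x = y`. The requirement `x, y ∈ V(B)` is `Dependency.WellFormed` below. -/
@[ext]
structure Egd where
  body : Finset (Atom Var)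
  lhs : Var
  rhs : Var

/-- The variables `X = V(B) ∩ V(H)` of a tgd `B(X,Y) → H(X,Z)`. -/
def Tgd.frontier (r : Tgd) : Finset Var := vars r.body ∩ vars r.head

/-- A Datalog rule is a tgd `B → H` with `V(H) ⊆ V(B)`. -/
def Tgd.IsDatalog (r : Tgd) : Prop := vars r.head ⊆ vars r.body

/-- A dependency is a tgd or an egd. -/
inductive Dependency where
  | tgd (r : Tgd)
  | egd (r : Egd)

/-- In an egd `B → x = y`, both `x` and `y` occur in `B`. Nothing is required of a tgd. -/
def Dependency.WellFormed : Dependency → Prop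
  | .tgd _ => True
  | .egd r => r.lhs ∈ vars r.body ∧ r.rhs ∈ vars r.body

/-- The predicates that occur in a dependency. -/
def Dependency.preds : Dependency → Set Pred
  | .tgd r => predsOf ↑r.body ∪ predsOf ↑r.head
  | .egd r => predsOf ↑r.body

/-- The predicates that occur in a set of dependencies. -/
def predsOfDeps (S : Set Dependency) : Set Pred := ⋃ d ∈ S, d.preds

/-- Satisfaction of a dependency in an instance. -/
def Sat (I : Instance) : Dependency → Prop
  | .tgd r => ∀ θ : Var → Var, rename θ ↑r.body ⊆ I →
      ∃ θ' : Var → Var, (∀ x ∈ r.frontier, θ' x = θ x) ∧ rename θ' ↑r.head ⊆ I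
  | .egd r => ∀ θ : Var → Var, rename θ ↑r.body ⊆ I → θ r.lhs = θ r.rhs

/-- `𝒬` is certain in `𝒟` under `S`: every instance `M` with `M ⊨ 𝒟` and `M ⊨ S` satisfies
`M ⊨ 𝒬`. -/
def Certain (𝒟 : Set Instance) (S : Set Dependency) (𝒬 : Set Instance) : Prop :=
  ∀ M : Instance, EntailsSet M 𝒟 → (∀ d ∈ S, Sat M d) → EntailsSet M 𝒬

/-! ## Datalog rewritings -/

/-- `(A, Γ, G)` is a Datalog rewriting for `(S, 𝒬)`. -/
structure IsDatalogRewriting (S : Set Dependency) (𝒬 : Set Instance)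
    (A : Set Pred) (Γ : Set Tgd) (G : Instance) : Prop where
  /-- the auxiliary predicates do not occur in `S` -/
  fresh_deps : ∀ p ∈ A, p ∉ predsOfDeps S
  /-- the auxiliary predicates do not occur in `𝒬` -/
  fresh_query : ∀ p ∈ A, ∀ Q ∈ 𝒬, p ∉ predsOf Q
  /-- `Γ` is finite -/
  finite : Γ.Finite
  /-- `Γ` consists of Datalog rules -/
  datalog : ∀ r ∈ Γ, r.IsDatalog
  /-- `G = {g()}` for an auxiliary predicate `g` of arity `0` -/
  goal : ∃ g : ℕ, ((g, 0) : Pred) ∈ A ∧ G = {((g, []) : Atom Var)}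
  /-- equivalence on all `A`-free instances -/
  equiv : ∀ D : Instance, (∀ p ∈ A, p ∉ predsOf D) →
    (Certain {D} S 𝒬 ↔ Certain {D} (Dependency.tgd '' Γ) {G})

/-! ## Skolemization and oblivious termination of tgds -/

/-- Skolem terms. The Skolem functions are `f_{r,z}`, one for each tgd `r` and each
variable `z`; the arguments of `f_{r,z}` form a tuple indexed by the variables
`X = V(B) ∩ V(H)` of `r`. -/
inductive SkTerm : Type where
  | var (v : Var) : SkTerm
  | fn (r : Tgd) (z : Var) (args : {x : Var // x ∈ r.frontier} → SkTerm) : SkTerm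

/-- Application of a valuation of the variables to a Skolem term. -/
def SkTerm.subst (θ : Var → SkTerm) : SkTerm → SkTerm
  | .var v => θ v
  | .fn r z args => .fn r z (fun x => (args x).subst θ)

/-- A rule of a logic program: the body has variables only, the head may have Skolem terms. -/
structure LPRule where
  body : Set (Atom Var)
  head : Set (Atom SkTerm)

/-- In the head of `r : B(X,Y) → H(X,Z)`, each `z ∈ Z` is replaced by the term `f_{r,z}(X)`. -/
def Tgd.skolemVar (r : Tgd) (v : Var) : SkTerm :=
  if v ∈ vars r.body then .var v else .fn r v (fun x => .var x.1)

/-- The skolemized rule `B(X,Y) → H'(X)` of a tgd. -/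
def Tgd.skolemize (r : Tgd) : LPRule where
  body := ↑r.body
  head := mapAtom r.skolemVar '' ↑r.head

/-- The logic program obtained by skolemizing a set of tgds. -/
def skolemProgram (T : Set Tgd) : Set LPRule := Tgd.skolemize '' T

/-- The minimal Herbrand model of the instance `I` and the logic program `P`. -/
inductive Herbrand (P : Set LPRule) (I : Instance) : Atom SkTerm → Prop
  | base (a : Atom Var) (ha : a ∈ I) : Herbrand P I (mapAtom SkTerm.var a)
  | step (ρ : LPRule) (hρ : ρ ∈ P) (θ : Var → SkTerm)
      (hbody : ∀ b ∈ ρ.body, Herbrand P I (mapAtom θ b))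
      (h : Atom SkTerm) (hh : h ∈ ρ.head) : Herbrand P I (mapAtom (SkTerm.subst θ) h)

/-- A set of tgds ensures oblivious termination when its skolemization has a finite minimal
Herbrand model on every finite instance. -/
def TgdsTerminate (T : Set Tgd) : Prop :=
  ∀ I : Instance, I.Finite → {a | Herbrand (skolemProgram T) I a}.Finite

/-! ## Substitution-free simulation of egds -/

/-- `(a, i)` is an occurrence of `x` in an atom of `B` other than an `E`-atom, where `E` is
the binary predicate named `e`. -/
def OccursAt (e : ℕ) (B : Finset (Atom Var)) (x : Var) (o : Atom Var × ℕ) : Prop :=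
  o.1 ∈ B ∧ pred o.1 ≠ (e, 2) ∧ o.1.2[o.2]? = some x

/-- One splitting step on the body of a rule: some variable `x` occurs more than once in `B`
(the `E`-atoms, which record earlier splittings, are not counted); one of these occurrences,
at position `i` of the atom `a`, is replaced by a fresh variable `x'`, and `E(x, x')` is
added. `V` is the set of variables of the conclusion of the rule, which `x'` has to avoid. -/
def SplitStep (e : ℕ) (V : Finset Var) (B B' : Finset (Atom Var)) : Prop :=
  ∃ (x x' : Var) (a : Atom Var) (i : ℕ),
    OccursAt e B x (a, i) ∧ (∃ o, o ≠ (a, i) ∧ OccursAt e B x o) ∧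
    x' ∉ vars B ∧ x' ∉ V ∧
    B' = insert (e, [x, x']) (insert (a.1, a.2.set i x') (B.erase a))

/-- `B'` is obtained from `B` by splitting until a fixed point is reached. -/
def SplitsTo (e : ℕ) (V : Finset Var) (B B' : Finset (Atom Var)) : Prop :=
  Relation.ReflTransGen (SplitStep e V) B B' ∧ ¬ ∃ B'', SplitStep e V B' B''

/-- `r'` is a possible result of the simulation of the dependency `d`: the body is split, the
head of a tgd is kept, and the conclusion `x = y` of an egd becomes `E(x, y)`. -/
def Simulates (e : ℕ) : Dependency → Tgd → Prop
  | .tgd r, r' => SplitsTo e (vars r.head) r.body r'.body ∧ r'.head = r.head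
  | .egd r, r' => SplitsTo e {r.lhs, r.rhs} r.body r'.body ∧ r'.head = {(e, [r.lhs, r.rhs])}

/-- `E(x,y) → E(y,x)` -/
def symmRule (e : ℕ) : Tgd := ⟨{(e, [0, 1])}, {(e, [1, 0])}⟩

/-- `E(x,y), E(y,z) → E(x,z)` -/
def transRule (e : ℕ) : Tgd := ⟨{(e, [0, 1]), (e, [1, 2])}, {(e, [0, 2])}⟩

/-- `R(x₁,…,xₙ) → E(x₁,x₁), …, E(xₙ,xₙ)` for the predicate `R = p` of arity `n = p.2` -/
def reflRule (e : ℕ) (p : Pred) : Tgd :=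
  ⟨{(p.1, List.range p.2)}, (Finset.range p.2).image (fun i => (e, [i, i]))⟩

/-- `T` is a substitution-free simulation of `S`, for the binary predicate `E` named `e`: it
consists of the equality rules and of one simulation of each dependency in `S`. -/
def IsSim (e : ℕ) (S : Set Dependency) (T : Set Tgd) : Prop :=
  ((e, 2) : Pred) ∉ predsOfDeps S ∧
  ∃ g : Dependency → Tgd, (∀ d ∈ S, Simulates e d (g d)) ∧
    T = {symmRule e, transRule e} ∪ reflRule e '' predsOfDeps S ∪ g '' S

/-- A set of tgds and egds ensures oblivious termination when some substitution-free
simulation of it does. -/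
def EnsuresObliviousTermination (S : Set Dependency) : Prop :=
  ∃ (e : ℕ) (T : Set Tgd), IsSim e S T ∧ TgdsTerminate T

/-! ## Codes: the finite objects that an algorithm reads and writes

Finite sets are presented by lists. All the types of codes are built from `ℕ` by `List`, `×`
and `⊕`, and carry Mathlib's `Primcodable` instances. -/

/-- Code of a tgd: the lists of atoms of its body and of its head. -/
abbrev TgdCode : Type := List (Atom Var) × List (Atom Var)

/-- Code of an egd `B → x = y`: a list of the atoms of `B`, and the pair `(x, y)`. -/
abbrev EgdCode : Type := List (Atom Var) × (Var × Var)

/-- Code of a tgd or egd. -/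
abbrev DepCode : Type := TgdCode ⊕ EgdCode

/-- Code of a triple `(A, Γ, {g()})`: a list of `A`, a list of codes of `Γ`, the name `g`. -/
abbrev RewritingCode : Type := List Pred × List TgdCode × ℕ

/-- The tgd with a given code. -/
def TgdCode.decode (c : TgdCode) : Tgd := ⟨c.1.toFinset, c.2.toFinset⟩

/-- The dependency with a given code. -/
def DepCode.decode : DepCode → Dependency
  | .inl c => .tgd (TgdCode.decode c)
  | .inr c => .egd ⟨c.1.toFinset, c.2.1, c.2.2⟩

/-- The finite set of dependencies presented by a list of codes. -/
def depsOf (s : List DepCode) : Set Dependency := {d | ∃ c ∈ s, DepCode.decode c = d}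

/-- The finite set of finite instances presented by a list of lists of atoms. -/
def instancesOf (q : List (List (Atom Var))) : Set Instance := {Q | ∃ l ∈ q, {a | a ∈ l} = Q}

/-- The triple with the given code is a Datalog rewriting for `(S, 𝒬)`. -/
def RewritingCode.IsRewritingFor (o : RewritingCode) (S : Set Dependency)
    (𝒬 : Set Instance) : Prop :=
  IsDatalogRewriting S 𝒬 {p | p ∈ o.1} {r | ∃ c ∈ o.2.1, TgdCode.decode c = r}
    {((o.2.2, []) : Atom Var)}

end DatalogRew

/-!
# Computing Datalog rewritings under oblivious termination

The algorithm is an unbounded search (`search`) for a certificate that passes a primitive recursive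
check (`chk`); the output (`out`) is read off from the certificate. So the proof has two halves:
a certificate that passes the check yields a rewriting (`isRewritingFor_out`), and under oblivious
termination there is such a certificate (`exists_chk`).

A certificate contains a singularized form of the rules: every rule, and every rule `Q → goal()` for
a disjunct `Q` of the query, is split so that its relational body atoms are linear, with equality as
an ordinary predicate. It further contains a finite set `C` of atoms over *shapes* of Skolem terms
that contains the critical facts and is closed under the singularized rules. A shape is a Skolem
term with its leaves blanked out; a term over arbitrary data is a shape together with the tuple of
its leaves. The Datalog program has one predicate for each tuple of shapes, whose arguments are the
leaves, and one rule for every instance of a rule in `C`.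

Soundness of the program: in a model of the dependencies, typed tuples are evaluated by Skolem
functions chosen in the model (`IsInst.holds_typedRule`), equality being the identity
(`IsSplit.holds`). Completeness: the auxiliary facts of a model of the program, restricted to shapes
in `C`, form an instance over coded terms that satisfies the singularized rules because `C` is
closed (`holds_untypedInstance`); its quotient by equality satisfies the dependencies, since the
linear bodies of the singularized rules match up to equality (`IsSplit.holds_quotient`). In
particular the check refers to no chase, and it is sound for all inputs.

For the second half, a simulation of the dependencies that ensures oblivious termination has a
finite Herbrand model on the critical instance, the one with a single element. Its terms are the
shapes, and its atoms give `C` (`exists_isTermModel`, `IsTermModel.extends_ruleOf`). Only here is the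
syntactic splitting process analysed, through its invariants (`SplitInv`).
-/

namespace DatalogRew

/-! ### Rules as lists, and the singularized rule set -/

/-- The list of all term occurrences in a list of atoms. -/
def termsOf {τ : Type} (as : List (Atom τ)) : List τ := as.flatMap (·.2)

/-- An internal rule `(B, H, X)`: body, head, and a list `X` of body variables that contains the
frontier. Internal predicate names are shifted: `0` is the equality predicate, `1` the goal, and
`R + 2` stands for the relation named `R`. -/
abbrev Rule : Type := List (Atom ℕ) × List (Atom ℕ) × List ℕ

/-- Satisfaction of the tgd `B → H`, with body and head given by lists. -/
def Holds (I : Instance) (B H : List (Atom Var)) : Prop :=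
  ∀ θ : Var → Var, (∀ b ∈ B, mapAtom θ b ∈ I) →
    ∃ θ' : Var → Var, (∀ x ∈ termsOf B, x ∈ termsOf H → θ' x = θ x) ∧ ∀ h ∈ H, mapAtom θ' h ∈ I

/-- An assignment of numbers to variables, given by a list. -/
def ap (θ : List ℕ) (x : ℕ) : ℕ := θ.getD x 0

/-- Shift the predicate names of atoms to internal names. -/
def tag (as : List (Atom ℕ)) : List (Atom ℕ) := as.map fun a => (a.1 + 2, a.2)

/-- The internal form of a dependency: the conclusion `x = y` of an egd becomes an equality
atom. -/
def preDep (c : DepCode) : List (Atom ℕ) × List (Atom ℕ) :=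
  Sum.elim (fun t => (tag t.1, tag t.2)) (fun t => (tag t.1, [(0, [t.2.1, t.2.2])])) c

/-- All rules before singularization: the dependencies, and one rule `Q → goal()` for each query
disjunct. -/
def pre (s : List DepCode) (q : List (List (Atom ℕ))) : List (List (Atom ℕ) × List (Atom ℕ)) :=
  s.map preDep ++ q.map fun Q => (tag Q, [(1, [])])

/-- Data of a split rule `(R, eqs, H, X, σ)`: `R` are the relational atoms of the split body, a pair
`(x, x')` of `eqs` is an equality atom `E(x, x')`, `H` is the head, `X` contains the frontier, and
`σ` maps every variable of `R` to the original variable of which it is an occurrence. -/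
abbrev Split : Type :=
  List (Atom ℕ) × List (ℕ × ℕ) × List (Atom ℕ) × List ℕ × List ℕ

/-- The rule described by splitting data. -/
def toRule (w : Split) : Rule :=
  (w.1 ++ w.2.1.map (fun p => (0, [p.1, p.2])), w.2.2.1, w.2.2.2.1)

/-- `w` is a splitting of the rule `p.1 → p.2`. -/
def splitOk (p : List (Atom ℕ) × List (Atom ℕ)) (w : Split) : Bool :=
  w.1.all (fun r => decide (mapAtom (ap w.2.2.2.2) r ∈ p.1)) &&
  p.1.all (fun b => w.1.any fun r => decide (mapAtom (ap w.2.2.2.2) r = b)) &&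
  decide ((termsOf w.1).map (fun x => (termsOf w.1).idxOf x) =
    List.range (termsOf w.1).length) &&
  (termsOf w.1).all (fun y => decide (ap w.2.2.2.2 y = y) ||
    decide ((ap w.2.2.2.2 y, y) ∈ w.2.1)) &&
  w.2.1.all (fun e => decide (e.1 ∈ termsOf w.1) && decide (e.2 ∈ termsOf w.1) &&
    decide (ap w.2.2.2.2 e.1 = e.1) && decide (ap w.2.2.2.2 e.2 = e.1)) &&
  (termsOf p.2).all (fun v => !decide (v ∈ termsOf w.1) || decide (ap w.2.2.2.2 v = v)) &&
  p.2.all (fun h => decide (h ∈ w.2.2.1)) &&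
  w.2.2.1.all (fun h => decide (h ∈ p.2)) &&
  w.2.2.2.1.all (fun x => decide (x ∈ termsOf w.1)) &&
  (termsOf w.2.2.1).all (fun v => !decide (v ∈ termsOf w.1) || decide (v ∈ w.2.2.2.1))

/-- `E(x, y) → E(y, x)` -/
def symmR : Rule := ([(0, [0, 1])], [(0, [1, 0])], [0, 1])

/-- `E(x, y), E(y, z) → E(x, z)` -/
def transR : Rule := ([(0, [0, 1]), (0, [1, 2])], [(0, [0, 2])], [0, 2])

/-- `R(x₁, …, xₙ) → E(x₁, x₁), …, E(xₙ, xₙ)` -/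
def reflR (p : Pred) : Rule :=
  ([(p.1 + 2, List.range p.2)], (List.range p.2).map (fun i => (0, [i, i])), List.range p.2)

/-- The internal rule set: equality rules for the predicates `ps`, and the split rules. -/
def rules (ps : List Pred) (W : List Split) : List Rule :=
  symmR :: transR :: (ps.map reflR ++ W.map toRule)

/-! ### Shapes and the typed Datalog program -/

/-- A shape of terms `(rank, width, r, z, args)`: the terms `f_{r,z}(t₁, …, tₖ)` in which `tᵢ` has
the shape with index `argsᵢ`; `width` is the number of leaves. Index `0` of a table of shapes
is reserved for the shape of a single leaf. -/
abbrev Shape : Type := ℕ × ℕ × Rule × ℕ × List ℕ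

/-- The shape with index `c`. -/
def shape (Tab : List Shape) (c : ℕ) : Shape := Tab.getD c (0, 0, ([], [], []), 0, [])

/-- The number of leaves of a term of shape `c`. -/
def width (Tab : List Shape) (c : ℕ) : ℕ := (shape Tab c).2.1

/-- The name of the auxiliary predicate that stands for the atoms `n(t₁, …, tₖ)` in which `tᵢ` has
shape `csᵢ`. Its arguments are the leaves of these terms. -/
def name (m n : ℕ) (cs : List ℕ) : ℕ := m + Encodable.encode (n, cs)

/-- The block of variables that holds the leaves of the value of `x`. -/
def block (Tab : List Shape) (θ : List ℕ) (x : ℕ) : List ℕ :=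
  (List.range (width Tab (ap θ x))).map (fun i => Nat.pair x i)

/-- The leaves of the value of a head variable `x`: an existential variable takes the Skolem
term over the frontier `X`. -/
def headBlock (Tab : List Shape) (θ X : List ℕ) (x : ℕ) : List ℕ :=
  if x ∈ X then block Tab θ x else X.flatMap fun y => block Tab θ y

/-- The Datalog rule that describes the rule `i.1` on terms of the shapes `i.2`. -/
def typedRule (m : ℕ) (Tab : List Shape) (i : Rule × List ℕ) : TgdCode :=
  (i.1.1.map (fun b => (name m b.1 (b.2.map fun x => ap i.2 x),
      b.2.flatMap fun x => block Tab i.2 x)),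
   i.1.2.1.map (fun b => (name m b.1 (b.2.map fun x => ap i.2 x),
      b.2.flatMap fun x => headBlock Tab i.2 i.1.2.2 x)))

/-- The rule that copies a relation of the data to the auxiliary predicate for leaf terms. -/
def copyRule (m : ℕ) (p : Pred) : TgdCode :=
  ([(p.1, List.range p.2)],
    [(name m (p.1 + 2) ((List.range p.2).map fun _ => 0), List.range p.2)])

/-! ### The certificate check -/

/-- `(r, θ)` is an instance of a rule of `T` in which the shapes of existential variables are
those of the Skolem terms, and all predicates of its typed rule belong to `A`. -/
def instOk (T : List Rule) (m : ℕ) (Tab : List Shape) (A : List Pred) (i : Rule × List ℕ) :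
    Bool :=
  decide (i.1 ∈ T) &&
  i.1.2.2.all (fun x => decide (x ∈ termsOf i.1.1)) &&
  (termsOf i.1.2.1).all (fun z => decide (z ∈ i.1.2.2) ||
    (!decide (z ∈ termsOf i.1.1) && !decide (ap i.2 z = 0) &&
      decide ((shape Tab (ap i.2 z)).2.2 = (i.1, z, i.1.2.2.map fun x => ap i.2 x)) &&
      i.1.2.2.all (fun x => decide ((shape Tab (ap i.2 x)).1 < (shape Tab (ap i.2 z)).1)) &&
      decide (width Tab (ap i.2 z) = (i.1.2.2.flatMap fun y => block Tab i.2 y).length))) &&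
  (typedRule m Tab i).1.all (fun a => decide (pred a ∈ A)) &&
  (typedRule m Tab i).2.all (fun a => decide (pred a ∈ A))

/-- `L` contains all lists of length `V` over `{0, …, N - 1}`. -/
def listsOk (N V : ℕ) (L : List (List ℕ)) : Bool :=
  decide ([] ∈ L) &&
  L.all (fun l => decide (V ≤ l.length) || (List.range N).all fun d => decide (l ++ [d] ∈ L))

/-- Every match of a rule of `T` in `C` is covered by an instance whose head is in `C`. -/
def closedOk (T : List Rule) (V : ℕ) (C : List (Atom ℕ)) (L : List (List ℕ))
    (inst : List (Rule × List ℕ)) : Bool :=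
  T.all (fun r => (termsOf r.1).all fun x => decide (x < V)) &&
  T.all (fun r => L.all fun l =>
    !(decide (l.length = V) && r.1.all fun b => decide (mapAtom (ap l) b ∈ C)) ||
    inst.any fun i => decide (i.1 = r) &&
      (termsOf r.1).all (fun x => decide (ap i.2 x = ap l x)) &&
      r.2.1.all (fun h => decide (mapAtom (ap i.2) h ∈ C)))

/-- The predicates `ps` contain all relations of the rules `P`, have names below `m`, and the
critical facts over the leaf shape belong to `C`. -/
def predsOk (P : List (List (Atom ℕ) × List (Atom ℕ))) (ps : List Pred) (m : ℕ)
    (C : List (Atom ℕ)) (A : List Pred) : Bool :=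
  P.all (fun p => (p.1 ++ p.2).all fun a =>
    decide (a.1 < 2) || decide ((a.1 - 2, a.2.length) ∈ ps)) &&
  ps.all (fun p => decide (p.1 < m) &&
    decide ((p.1 + 2, (List.range p.2).map fun _ => 0) ∈ C) &&
    decide ((name m (p.1 + 2) ((List.range p.2).map fun _ => 0), p.2) ∈ A)) &&
  A.all (fun p => decide (m ≤ p.1)) &&
  decide ((name m 1 [], 0) ∈ A)

/-- A certificate `(ps, m, W, V, Tab, C, L, inst, A)`: the predicates `ps`, a bound `m` for names,
splittings `W`, a bound `V` for variables, a table `Tab` of shapes, a set `C` of atoms over shapes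
that is closed under the rules, the list `L` of all assignments, the rule instances `inst`, and
the auxiliary predicates `A`. -/
abbrev Cert : Type :=
  List Pred × ℕ × List Split × ℕ × List Shape × List (Atom ℕ) × List (List ℕ) ×
    List (Rule × List ℕ) × List Pred

/-- The check of a certificate, with the components of the certificate as arguments. -/
def chkAux (P : List (List (Atom ℕ) × List (Atom ℕ))) (ps : List Pred) (m : ℕ) (W : List Split)
    (V : ℕ) (Tab : List Shape) (C : List (Atom ℕ)) (L : List (List ℕ))
    (inst : List (Rule × List ℕ)) (A : List Pred) : Bool :=
  P.all (fun p => W.any fun w => splitOk p w) &&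
  W.all (fun w => P.any fun p => splitOk p w) &&
  inst.all (fun i => instOk (rules ps W) m Tab A i) &&
  C.all (fun a => a.2.all fun c => decide (c < Tab.length)) &&
  listsOk Tab.length V L &&
  closedOk (rules ps W) V C L inst &&
  predsOk P ps m C A &&
  decide (width Tab 0 = 1)

/-- The check of a certificate. -/
def chk (x : List DepCode × List (List (Atom ℕ))) (k : Cert) : Bool :=
  chkAux (pre x.1 x.2) k.1 k.2.1 k.2.2.1 k.2.2.2.1 k.2.2.2.2.1 k.2.2.2.2.2.1 k.2.2.2.2.2.2.1
    k.2.2.2.2.2.2.2.1 k.2.2.2.2.2.2.2.2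

/-- The rewriting described by a certificate. -/
def out (k : Cert) : RewritingCode :=
  (k.2.2.2.2.2.2.2.2,
    k.2.2.2.2.2.2.2.1.map (fun i => typedRule k.2.1 k.2.2.2.2.1 i) ++
      k.1.map (fun p => copyRule k.2.1 p),
    name k.2.1 1 [])

/-! ### Computability of the check -/

attribute [fun_prop] Primrec

section Primrec

variable {α β γ : Type} [Primcodable α] [Primcodable β] [Primcodable γ]

@[fun_prop]
theorem primrec_id' : Primrec (fun x : α => x) := Primrec.id

@[fun_prop]
theorem primrec_const' (c : β) : Primrec (fun _ : α => c) := Primrec.const c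

@[fun_prop]
theorem primrec_comp' {f : β → γ} {g : α → β} (hf : Primrec f) (hg : Primrec g) :
    Primrec (fun x => f (g x)) := hf.comp hg

@[fun_prop]
theorem primrec_fst' {f : α → β × γ} (hf : Primrec f) : Primrec (fun x => (f x).1) :=
  Primrec.fst.comp hf

@[fun_prop]
theorem primrec_snd' {f : α → β × γ} (hf : Primrec f) : Primrec (fun x => (f x).2) :=
  Primrec.snd.comp hf

@[fun_prop]
theorem primrec_pair' {f : α → β} {g : α → γ} (hf : Primrec f) (hg : Primrec g) :
    Primrec (fun x => (f x, g x)) := hf.pair hg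

@[fun_prop]
theorem primrec_append {f g : α → List β} (hf : Primrec f) (hg : Primrec g) :
    Primrec (fun x => f x ++ g x) := Primrec.list_append.comp hf hg

@[fun_prop]
theorem primrec_cons {f : α → β} {g : α → List β} (hf : Primrec f) (hg : Primrec g) :
    Primrec (fun x => f x :: g x) := Primrec.list_cons.comp hf hg

@[fun_prop]
theorem primrec_length {f : α → List β} (hf : Primrec f) : Primrec (fun x => (f x).length) :=
  Primrec.list_length.comp hf

@[fun_prop]
theorem primrec_range {f : α → ℕ} (hf : Primrec f) : Primrec (fun x => List.range (f x)) :=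
  Primrec.list_range.comp hf

@[fun_prop]
theorem primrec_add {f g : α → ℕ} (hf : Primrec f) (hg : Primrec g) :
    Primrec (fun x => f x + g x) := Primrec.nat_add.comp hf hg

@[fun_prop]
theorem primrec_sub {f g : α → ℕ} (hf : Primrec f) (hg : Primrec g) :
    Primrec (fun x => f x - g x) := Primrec.nat_sub.comp hf hg

@[fun_prop]
theorem primrec_natPair {f g : α → ℕ} (hf : Primrec f) (hg : Primrec g) :
    Primrec (fun x => Nat.pair (f x) (g x)) := Primrec₂.natPair.comp hf hg

@[fun_prop]
theorem primrec_encode {f : α → β} (hf : Primrec f) :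
    Primrec (fun x => Encodable.encode (f x)) := Primrec.encode.comp hf

@[fun_prop]
theorem primrec_map {f : α → List β} {g : α → β → γ} (hf : Primrec f)
    (hg : Primrec (fun p : α × β => g p.1 p.2)) : Primrec (fun x => (f x).map (g x)) :=
  Primrec.list_map hf hg

@[fun_prop]
theorem primrec_flatMap {f : α → List β} {g : α → β → List γ} (hf : Primrec f)
    (hg : Primrec (fun p : α × β => g p.1 p.2)) : Primrec (fun x => (f x).flatMap (g x)) :=
  Primrec.list_flatMap hf hg

@[fun_prop]
theorem primrec_getD (d : β) {f : α → List β} {g : α → ℕ} (hf : Primrec f) (hg : Primrec g) :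
    Primrec (fun x => (f x).getD (g x) d) := (Primrec.list_getD d).comp hf hg

@[fun_prop]
theorem primrec_idxOf [DecidableEq β] {f : α → List β} {g : α → β} (hf : Primrec f)
    (hg : Primrec g) : Primrec (fun x => (f x).idxOf (g x)) :=
  Primrec.list_idxOf.comp hg hf

@[fun_prop]
theorem primrec_and' {f g : α → Bool} (hf : Primrec f) (hg : Primrec g) :
    Primrec (fun x => f x && g x) := Primrec.and.comp hf hg

@[fun_prop]
theorem primrec_or' {f g : α → Bool} (hf : Primrec f) (hg : Primrec g) :
    Primrec (fun x => f x || g x) := Primrec.or.comp hf hg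

@[fun_prop]
theorem primrec_not' {f : α → Bool} (hf : Primrec f) : Primrec (fun x => !f x) :=
  Primrec.not.comp hf

@[fun_prop]
theorem primrec_eq [DecidableEq β] {f g : α → β} (hf : Primrec f) (hg : Primrec g) :
    Primrec (fun x => decide (f x = g x)) :=
  primrecPred_iff_primrec_decide.1 (Primrec.eq.comp hf hg)

@[fun_prop]
theorem primrec_lt {f g : α → ℕ} (hf : Primrec f) (hg : Primrec g) :
    Primrec (fun x => decide (f x < g x)) :=
  primrecPred_iff_primrec_decide.1 (Primrec.nat_lt.comp hf hg)

@[fun_prop]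
theorem primrec_le {f g : α → ℕ} (hf : Primrec f) (hg : Primrec g) :
    Primrec (fun x => decide (f x ≤ g x)) :=
  primrecPred_iff_primrec_decide.1 (Primrec.nat_le.comp hf hg)

@[fun_prop]
theorem primrec_all {f : α → List β} {g : α → β → Bool} (hf : Primrec f)
    (hg : Primrec (fun p : α × β => g p.1 p.2)) : Primrec (fun x => (f x).all (g x)) := by
  have h : Primrec fun x => (f x).foldr (fun b s => g x b && s) true :=
    Primrec.list_foldr (h := fun x p => g x p.1 && p.2) hf (Primrec.const true)
      (Primrec.and.comp (hg.comp (Primrec.fst.pair (Primrec.fst.comp Primrec.snd)))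
        (Primrec.snd.comp Primrec.snd))
  refine h.of_eq fun x => ?_
  induction f x with
  | nil => rfl
  | cons b l ih => simp [ih]

@[fun_prop]
theorem primrec_any {f : α → List β} {g : α → β → Bool} (hf : Primrec f)
    (hg : Primrec (fun p : α × β => g p.1 p.2)) : Primrec (fun x => (f x).any (g x)) := by
  have h : Primrec fun x => !((f x).all fun b => !g x b) := by fun_prop
  refine h.of_eq fun x => ?_
  induction f x with
  | nil => rfl
  | cons b l ih => simp [← ih]

@[fun_prop]
theorem primrec_mem [BEq β] [LawfulBEq β] {f : α → β} {g : α → List β} (hf : Primrec f)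
    (hg : Primrec g) : Primrec (fun x => decide (f x ∈ g x)) := by
  classical
  have h : Primrec fun x => (g x).any fun b => decide (b = f x) := by fun_prop
  refine h.of_eq fun x => ?_
  rw [Bool.eq_iff_iff, List.any_eq_true, decide_eq_true_iff]
  simp

theorem primrec_if {f : α → Bool} {g h : α → β} (hf : Primrec f) (hg : Primrec g)
    (hh : Primrec h) : Primrec (fun x => if f x = true then g x else h x) :=
  (Primrec.cond hf hg hh).of_eq fun x => by cases f x <;> rfl

@[fun_prop]
theorem primrec_ap {f : α → List ℕ} {g : α → ℕ} (hf : Primrec f) (hg : Primrec g) :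
    Primrec (fun x => ap (f x) (g x)) := by unfold ap; fun_prop

@[fun_prop]
theorem primrec_mapAtom_ap {f : α → List ℕ} {g : α → Atom ℕ} (hf : Primrec f) (hg : Primrec g) :
    Primrec (fun x => mapAtom (ap (f x)) (g x)) := by
  have h : Primrec fun x => ((g x).1, (g x).2.map fun y => ap (f x) y) := by fun_prop
  exact h

@[fun_prop]
theorem primrec_termsOf {f : α → List (Atom ℕ)} (hf : Primrec f) :
    Primrec (fun x => termsOf (f x)) := by unfold termsOf; fun_prop

@[fun_prop]
theorem primrec_pred {f : α → Atom ℕ} (hf : Primrec f) :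
    Primrec (fun x => pred (f x)) := by unfold pred; fun_prop

@[fun_prop]
theorem primrec_tag {f : α → List (Atom ℕ)} (hf : Primrec f) :
    Primrec (fun x => tag (f x)) := by unfold tag; fun_prop

theorem primrec_preDep : Primrec preDep := by
  refine (Primrec.sumCasesOn (f := fun c : DepCode => c)
    (g := fun _ t => (tag t.1, tag t.2))
    (h := fun _ t => (tag t.1, [((0 : ℕ), [t.2.1, t.2.2])])) Primrec.id ?_ ?_).of_eq ?_
  · have : Primrec fun p : DepCode × TgdCode => (tag p.2.1, tag p.2.2) := by fun_prop
    exact this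
  · have : Primrec fun p : DepCode × EgdCode =>
      (tag p.2.1, [((0 : ℕ), [p.2.2.1, p.2.2.2])]) := by fun_prop
    exact this
  · rintro (c | c) <;> rfl

@[fun_prop]
theorem primrec_preDep' {f : α → DepCode} (hf : Primrec f) :
    Primrec (fun x => preDep (f x)) := primrec_preDep.comp hf

@[fun_prop]
theorem primrec_pre {f : α → List DepCode} {g : α → List (List (Atom ℕ))} (hf : Primrec f)
    (hg : Primrec g) : Primrec (fun x => pre (f x) (g x)) := by
  have h : Primrec fun x =>
      (f x).map (fun c => preDep c) ++ (g x).map fun Q => (tag Q, [((1 : ℕ), ([] : List ℕ))]) := by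
    fun_prop
  exact h

@[fun_prop]
theorem primrec_toRule {f : α → Split} (hf : Primrec f) : Primrec (fun x => toRule (f x)) := by
  unfold toRule; fun_prop

@[fun_prop]
theorem primrec_splitOk {f : α → List (Atom ℕ) × List (Atom ℕ)} {g : α → Split}
    (hf : Primrec f) (hg : Primrec g) : Primrec (fun x => splitOk (f x) (g x)) := by
  unfold splitOk; fun_prop

@[fun_prop]
theorem primrec_rules {f : α → List Pred} {g : α → List Split} (hf : Primrec f)
    (hg : Primrec g) : Primrec (fun x => rules (f x) (g x)) := by
  have h1 : Primrec fun p : Pred => reflR p := by unfold reflR; fun_prop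
  have h : Primrec fun x => symmR :: transR ::
      ((f x).map (fun p => reflR p) ++ (g x).map fun w => toRule w) := by fun_prop
  exact h

@[fun_prop]
theorem primrec_shape {f : α → List Shape} {g : α → ℕ} (hf : Primrec f) (hg : Primrec g) :
    Primrec (fun x => shape (f x) (g x)) := by unfold shape; fun_prop

@[fun_prop]
theorem primrec_width {f : α → List Shape} {g : α → ℕ} (hf : Primrec f) (hg : Primrec g) :
    Primrec (fun x => width (f x) (g x)) := by unfold width; fun_prop

@[fun_prop]
theorem primrec_name {f g : α → ℕ} {h : α → List ℕ} (hf : Primrec f) (hg : Primrec g)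
    (hh : Primrec h) : Primrec (fun x => name (f x) (g x) (h x)) := by
  unfold name; fun_prop

@[fun_prop]
theorem primrec_block {f : α → List Shape} {g : α → List ℕ} {h : α → ℕ} (hf : Primrec f)
    (hg : Primrec g) (hh : Primrec h) : Primrec (fun x => block (f x) (g x) (h x)) := by
  unfold block; fun_prop

@[fun_prop]
theorem primrec_headBlock {f : α → List Shape} {g k : α → List ℕ} {h : α → ℕ} (hf : Primrec f)
    (hg : Primrec g) (hk : Primrec k) (hh : Primrec h) :
    Primrec (fun x => headBlock (f x) (g x) (k x) (h x)) := by
  have := primrec_if (f := fun x => decide (h x ∈ k x))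
    (g := fun x => block (f x) (g x) (h x))
    (h := fun x => (k x).flatMap fun y => block (f x) (g x) y)
    (by fun_prop) (by fun_prop) (by fun_prop)
  exact this.of_eq fun x => by simp [headBlock]

@[fun_prop]
theorem primrec_typedRule {f : α → ℕ} {g : α → List Shape} {h : α → Rule × List ℕ}
    (hf : Primrec f) (hg : Primrec g) (hh : Primrec h) :
    Primrec (fun x => typedRule (f x) (g x) (h x)) := by
  unfold typedRule; fun_prop

@[fun_prop]
theorem primrec_copyRule {f : α → ℕ} {g : α → Pred} (hf : Primrec f) (hg : Primrec g) :
    Primrec (fun x => copyRule (f x) (g x)) := by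
  unfold copyRule; fun_prop

@[fun_prop]
theorem primrec_instOk {f : α → List Rule} {g : α → ℕ} {h : α → List Shape} {k : α → List Pred}
    {l : α → Rule × List ℕ} (hf : Primrec f) (hg : Primrec g) (hh : Primrec h) (hk : Primrec k)
    (hl : Primrec l) : Primrec (fun x => instOk (f x) (g x) (h x) (k x) (l x)) := by
  unfold instOk; fun_prop

@[fun_prop]
theorem primrec_listsOk {f g : α → ℕ} {h : α → List (List ℕ)} (hf : Primrec f) (hg : Primrec g)
    (hh : Primrec h) : Primrec (fun x => listsOk (f x) (g x) (h x)) := by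
  unfold listsOk; fun_prop

@[fun_prop]
theorem primrec_closedOk {f : α → List Rule} {g : α → ℕ} {h : α → List (Atom ℕ)}
    {k : α → List (List ℕ)} {l : α → List (Rule × List ℕ)} (hf : Primrec f) (hg : Primrec g)
    (hh : Primrec h) (hk : Primrec k) (hl : Primrec l) :
    Primrec (fun x => closedOk (f x) (g x) (h x) (k x) (l x)) := by
  unfold closedOk; fun_prop

@[fun_prop]
theorem primrec_predsOk {f : α → List (List (Atom ℕ) × List (Atom ℕ))} {g : α → List Pred}
    {h : α → ℕ} {k : α → List (Atom ℕ)} {l : α → List Pred} (hf : Primrec f) (hg : Primrec g)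
    (hh : Primrec h) (hk : Primrec k) (hl : Primrec l) :
    Primrec (fun x => predsOk (f x) (g x) (h x) (k x) (l x)) := by
  unfold predsOk; fun_prop

theorem primrec_chkAux {P : α → List (List (Atom ℕ) × List (Atom ℕ))} {ps : α → List Pred}
    {m : α → ℕ} {W : α → List Split} {V : α → ℕ} {Tab : α → List Shape} {C : α → List (Atom ℕ)}
    {L : α → List (List ℕ)} {inst : α → List (Rule × List ℕ)} {A : α → List Pred}
    (hP : Primrec P) (hps : Primrec ps) (hm : Primrec m) (hW : Primrec W) (hV : Primrec V)
    (hTab : Primrec Tab) (hC : Primrec C) (hL : Primrec L) (hinst : Primrec inst)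
    (hA : Primrec A) : Primrec fun x =>
      chkAux (P x) (ps x) (m x) (W x) (V x) (Tab x) (C x) (L x) (inst x) (A x) := by
  unfold chkAux; fun_prop

theorem primrec_chk : Primrec₂ chk := by
  have h1 : Primrec fun p : (List DepCode × List (List (Atom ℕ))) × Cert => p.2 := Primrec.snd
  have h2 := Primrec.snd.comp h1
  have h3 := Primrec.snd.comp h2
  have h4 := Primrec.snd.comp h3
  have h5 := Primrec.snd.comp h4
  have h6 := Primrec.snd.comp h5
  have h7 := Primrec.snd.comp h6
  have h8 := Primrec.snd.comp h7
  exact primrec_chkAux (by fun_prop) (Primrec.fst.comp h1) (Primrec.fst.comp h2)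
    (Primrec.fst.comp h3) (Primrec.fst.comp h4) (Primrec.fst.comp h5) (Primrec.fst.comp h6)
    (Primrec.fst.comp h7) (Primrec.fst.comp h8) (Primrec.snd.comp h8)

theorem primrec_out : Primrec out := by
  have h1 : Primrec fun p : Cert => p := Primrec.id
  have h2 := Primrec.snd.comp h1
  have h3 := Primrec.snd.comp h2
  have h4 := Primrec.snd.comp h3
  have h5 := Primrec.snd.comp h4
  have h6 := Primrec.snd.comp h5
  have h7 := Primrec.snd.comp h6
  have h8 := Primrec.snd.comp h7
  have hm := Primrec.fst.comp h2
  have hT := Primrec.fst.comp h5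
  refine (Primrec.snd.comp h8).pair (Primrec.pair (primrec_append
    (primrec_map (Primrec.fst.comp h8) ?_) (primrec_map (Primrec.fst.comp h1) ?_)) ?_)
  · exact primrec_typedRule (hm.comp Primrec.fst) (hT.comp Primrec.fst) Primrec.snd
  · exact primrec_copyRule (hm.comp Primrec.fst) Primrec.snd
  · exact primrec_name hm (Primrec.const 1) (Primrec.const [])

end Primrec

/-- Search for a `k` that passes the check `c x k`, and output `o k`. -/
def search {α κ ω : Type} [Primcodable κ] (c : α → κ → Bool) (o : κ → ω) (x : α) : Part ω :=
  Nat.rfindOpt fun n => (Encodable.decode (α := κ) n).bind fun k =>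
    if c x k = true then some (o k) else none

theorem partrec_search {α κ ω : Type} [Primcodable α] [Primcodable κ] [Primcodable ω]
    {c : α → κ → Bool} {o : κ → ω} (hc : Primrec₂ c) (ho : Primrec o) :
    Partrec (search c o) := by
  have h1 : Primrec₂ fun (p : α × ℕ) (k : κ) => if c p.1 k = true then some (o k) else none :=
    primrec_if (hc.comp (Primrec.fst.comp Primrec.fst) Primrec.snd)
      (Primrec.option_some.comp (ho.comp Primrec.snd)) (Primrec.const none)
  have h2 : Primrec fun p : α × ℕ => Encodable.decode (α := κ) p.2 :=
    Primrec.decode.comp Primrec.snd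
  have h3 : Primrec₂ fun (x : α) (n : ℕ) => (Encodable.decode (α := κ) n).bind fun k =>
      if c x k = true then some (o k) else none := Primrec.option_bind h2 h1
  exact Partrec.rfindOpt h3.to_comp

theorem mem_search {α κ ω : Type} [Primcodable κ] {c : α → κ → Bool} {o : κ → ω} {x : α} {y : ω}
    (h : y ∈ search c o x) : ∃ k, c x k = true ∧ y = o k := by
  obtain ⟨n, hn⟩ := Nat.rfindOpt_spec h
  rw [Option.mem_def, Option.bind_eq_some_iff] at hn
  obtain ⟨k, -, hk⟩ := hn
  split_ifs at hk with hc
  exact ⟨k, hc, (Option.some.inj hk).symm⟩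

theorem exists_mem_search {α κ ω : Type} [Primcodable κ] {c : α → κ → Bool} {o : κ → ω} {x : α}
    {k : κ} (h : c x k = true) : ∃ y, y ∈ search c o x :=
  ⟨_, Part.get_mem (Nat.rfindOpt_dom.2 ⟨Encodable.encode k, o k, by
    rw [Encodable.encodek, Option.bind_some, if_pos h, Option.mem_def]⟩)⟩

/-! ### Dependencies and internal rules -/

theorem mem_termsOf {τ : Type} {as : List (Atom τ)} {x : τ} :
    x ∈ termsOf as ↔ ∃ a ∈ as, x ∈ a.2 := by
  simp [termsOf]

theorem mem_vars {B : Finset (Atom Var)} {x : Var} : x ∈ vars B ↔ ∃ a ∈ B, x ∈ a.2 := by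
  simp only [vars, Finset.mem_biUnion, List.mem_toFinset]

theorem mem_vars_toFinset {B : List (Atom Var)} {x : Var} :
    x ∈ vars B.toFinset ↔ x ∈ termsOf B := by
  simp only [mem_vars, List.mem_toFinset, mem_termsOf]

theorem rename_subset_iff {θ : Var → Var} {J I : Instance} :
    rename θ J ⊆ I ↔ ∀ b ∈ J, mapAtom θ b ∈ I :=
  Set.image_subset_iff

theorem mapAtom_mapAtom {τ τ' τ'' : Type} (f : τ → τ') (g : τ' → τ'') (a : Atom τ) :
    mapAtom g (mapAtom f a) = mapAtom (fun x => g (f x)) a := by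
  simp [mapAtom]

theorem mapAtom_congr {τ τ' : Type} {f g : τ → τ'} {a : Atom τ} (h : ∀ x ∈ a.2, f x = g x) :
    mapAtom f a = mapAtom g a := by
  simp only [mapAtom, Prod.mk.injEq, true_and]
  exact List.map_congr_left h

theorem eq_of_mapAtom_eq {τ τ' : Type} {f g : τ → τ'} {a : Atom τ}
    (h : mapAtom f a = mapAtom g a) : ∀ x ∈ a.2, f x = g x := by
  simp only [mapAtom, Prod.mk.injEq, true_and] at h
  exact List.map_inj_left.1 h

theorem pred_mapAtom {τ τ' : Type} (f : τ → τ') (a : Atom τ) : pred (mapAtom f a) = pred a := by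
  simp [pred, mapAtom]

theorem sat_tgd_iff {I : Instance} {c : TgdCode} :
    Sat I (.tgd (TgdCode.decode c)) ↔ Holds I c.1 c.2 := by
  simp only [Sat, Holds, TgdCode.decode, Tgd.frontier, rename_subset_iff, List.coe_toFinset,
    Set.mem_ofPred_eq, Finset.mem_inter, mem_vars_toFinset, and_imp]

theorem termsOf_tag (as : List (Atom ℕ)) : termsOf (tag as) = termsOf as := by
  simp [termsOf, tag, List.flatMap_map]

theorem mem_tag {as : List (Atom ℕ)} {a : Atom ℕ} :
    a ∈ tag as ↔ ∃ b ∈ as, (b.1 + 2, b.2) = a := by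
  simp [tag]

/-- The internal instance of a model: equality is the identity, and the goal holds when the query
does. -/
def internalize (M : Instance) (𝒬 : Set Instance) : Instance :=
  {a | (∃ b ∈ M, (b.1 + 2, b.2) = a) ∨ (∃ x, a = (0, [x, x])) ∨ a = (1, []) ∧ EntailsSet M 𝒬}

theorem mem_internalize_rel {M : Instance} {𝒬 : Set Instance} {n : ℕ} {ts : List ℕ} :
    (n + 2, ts) ∈ internalize M 𝒬 ↔ (n, ts) ∈ M := by
  constructor
  · rintro (⟨b, hb, h⟩ | ⟨x, h⟩ | ⟨h, -⟩)
    · have : b = (n, ts) := by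
        ext1
        · simpa using congrArg Prod.fst h
        · simpa using congrArg Prod.snd h
      exact this ▸ hb
    · simpa using congrArg Prod.fst h
    · simpa using congrArg Prod.fst h
  · exact fun h => Or.inl ⟨_, h, rfl⟩

theorem eq_of_mem_internalize {M : Instance} {𝒬 : Set Instance} {x y : ℕ}
    (h : (0, [x, y]) ∈ internalize M 𝒬) : x = y := by
  rcases h with ⟨b, hb, h⟩ | ⟨z, h⟩ | ⟨h, -⟩
  · simpa using congrArg Prod.fst h
  · have := congrArg Prod.snd h
    simp only [List.cons.injEq, and_true] at this
    rw [this.1, this.2]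
  · simpa using congrArg Prod.fst h

theorem goal_mem_internalize {M : Instance} {𝒬 : Set Instance}
    (h : (1, []) ∈ internalize M 𝒬) : EntailsSet M 𝒬 := by
  rcases h with ⟨b, hb, h⟩ | ⟨z, h⟩ | ⟨-, h⟩
  · simpa using congrArg Prod.fst h
  · simpa using congrArg Prod.fst h
  · exact h

theorem forall_tag {P : Atom ℕ → Prop} {as : List (Atom ℕ)} :
    (∀ b ∈ tag as, P b) ↔ ∀ b ∈ as, P (b.1 + 2, b.2) :=
  List.forall_mem_map

theorem mapAtom_tag_mem_internalize {M : Instance} {𝒬 : Set Instance} {θ : ℕ → ℕ}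
    {as : List (Atom ℕ)} :
    (∀ b ∈ tag as, mapAtom θ b ∈ internalize M 𝒬) ↔ ∀ b ∈ as, mapAtom θ b ∈ M :=
  forall_tag.trans (forall₂_congr fun _ _ => mem_internalize_rel)

/-- A model of the dependencies satisfies the internal rules, equality being the identity. -/
theorem holds_pre_internalize {M : Instance} {s : List DepCode} {q : List (List (Atom ℕ))}
    (hM : ∀ d ∈ depsOf s, Sat M d) :
    ∀ p ∈ pre s q, Holds (internalize M (instancesOf q)) p.1 p.2 := by
  intro p hp
  rcases List.mem_append.1 hp with hp | hp
  · obtain ⟨c, hc, rfl⟩ := List.mem_map.1 hp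
    have hsat := hM (DepCode.decode c) ⟨c, hc, rfl⟩
    rcases c with c | c
    · intro θ hθ
      obtain ⟨θ', h1, h2⟩ := sat_tgd_iff.1 hsat θ (mapAtom_tag_mem_internalize.1 hθ)
      refine ⟨θ', fun x hx hx' => h1 x ?_ ?_, mapAtom_tag_mem_internalize.2 h2⟩
      · simpa [preDep, termsOf_tag] using hx
      · simpa [preDep, termsOf_tag] using hx'
    · intro θ hθ
      refine ⟨θ, fun _ _ _ => rfl, ?_⟩
      have h : θ c.2.1 = θ c.2.2 := hsat θ (rename_subset_iff.2 fun b hb =>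
        mapAtom_tag_mem_internalize.1 hθ b (by simpa using hb))
      intro a ha
      have ha : a = (0, [c.2.1, c.2.2]) := by simpa [preDep] using ha
      subst ha
      exact Or.inr (Or.inl ⟨θ c.2.2, by simp [mapAtom, h]⟩)
  · obtain ⟨Q, hQ, rfl⟩ := List.mem_map.1 hp
    intro θ hθ
    refine ⟨θ, fun _ _ _ => rfl, ?_⟩
    intro a ha
    have ha : a = (1, []) := by simpa using ha
    subst ha
    exact Or.inr (Or.inr ⟨rfl, _, ⟨Q, hQ, rfl⟩, θ,
      rename_subset_iff.2 fun b hb => mapAtom_tag_mem_internalize.1 hθ b hb⟩)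

/-- The external instance of an internal one: relations outside of `ps` are taken to be full. -/
def externalize (ps : List Pred) (K : Instance) : Instance :=
  {a | (a.1 + 2, a.2) ∈ K ∨ pred a ∉ ps}

theorem mapAtom_tag_mem_of_externalize {ps : List Pred} {K : Instance} {θ : ℕ → ℕ}
    {as : List (Atom ℕ)} (hps : ∀ a ∈ as, pred a ∈ ps)
    (h : ∀ b ∈ as, mapAtom θ b ∈ externalize ps K) : ∀ b ∈ tag as, mapAtom θ b ∈ K :=
  forall_tag.2 fun b hb => (h b hb).resolve_right fun hn => hn (by
    rw [pred_mapAtom]; exact hps b hb)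

/-- Every relation of the rules belongs to `ps`. -/
def CoversPreds (P : List (List (Atom ℕ) × List (Atom ℕ))) (ps : List Pred) : Prop :=
  ∀ p ∈ P, ∀ a ∈ p.1 ++ p.2, a.1 < 2 ∨ (a.1 - 2, a.2.length) ∈ ps

theorem CoversPreds.of_mem {P : List (List (Atom ℕ) × List (Atom ℕ))} {ps : List Pred}
    (h : CoversPreds P ps) {p : List (Atom ℕ) × List (Atom ℕ)} (hp : p ∈ P) {a : Atom ℕ}
    (ha : (a.1 + 2, a.2) ∈ p.1 ++ p.2) : pred a ∈ ps := by
  simpa [pred] using h p hp _ ha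

theorem preDep_mem_pre {s : List DepCode} {q : List (List (Atom ℕ))} {c : DepCode} (hc : c ∈ s) :
    preDep c ∈ pre s q :=
  List.mem_append_left _ (List.mem_map_of_mem hc)

theorem preQuery_mem_pre {s : List DepCode} {q : List (List (Atom ℕ))} {Q : List (Atom ℕ)}
    (hQ : Q ∈ q) : (tag Q, [(1, [])]) ∈ pre s q :=
  List.mem_append_right _ (List.mem_map.2 ⟨Q, hQ, rfl⟩)

/-- If equality is the identity in `K`, and `K` satisfies the internal rules, then its external
instance satisfies the dependencies. -/
theorem sat_externalize {s : List DepCode} {q : List (List (Atom ℕ))} {ps : List Pred}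
    {K : Instance} (hwf : ∀ d ∈ depsOf s, d.WellFormed) (hps : CoversPreds (pre s q) ps)
    (hE : ∀ x y, (0, [x, y]) ∈ K → x = y) (hK : ∀ p ∈ pre s q, Holds K p.1 p.2) :
    ∀ d ∈ depsOf s, Sat (externalize ps K) d := by
  rintro _ ⟨c, hc, rfl⟩
  have hc' := preDep_mem_pre (q := q) hc
  have hcov : ∀ {as : List (Atom ℕ)}, (∀ a ∈ tag as, a ∈ (preDep c).1 ++ (preDep c).2) →
      ∀ a ∈ as, pred a ∈ ps := fun h a ha => hps.of_mem hc' (h _ (List.mem_map_of_mem ha))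
  have hh := hK _ hc'
  have hw := hwf _ ⟨c, hc, rfl⟩
  rcases c with c | c
  · refine sat_tgd_iff.2 fun θ hθ => ?_
    obtain ⟨θ', h1, h2⟩ := hh θ (mapAtom_tag_mem_of_externalize
      (hcov fun a ha => List.mem_append_left _ ha) hθ)
    refine ⟨θ', fun x hx hx' => h1 x ?_ ?_, fun a ha => Or.inl (forall_tag.1 h2 a ha)⟩
    · simpa [preDep, termsOf_tag] using hx
    · simpa [preDep, termsOf_tag] using hx'
  · intro θ hθ
    obtain ⟨θ', h1, h2⟩ := hh θ (mapAtom_tag_mem_of_externalize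
      (hcov fun a ha => List.mem_append_left _ ha)
      fun b hb => rename_subset_iff.1 hθ b (by simpa using hb))
    have h3 : θ' c.2.1 = θ' c.2.2 := hE _ _ (h2 (0, [c.2.1, c.2.2]) (by simp [preDep]))
    have h4 : ∀ x, x = c.2.1 ∨ x = c.2.2 → θ' x = θ x := fun x hx => by
      refine h1 x ?_ (by simpa [preDep, termsOf] using hx)
      have : x ∈ vars c.1.toFinset := by
        rcases hx with rfl | rfl
        · exact hw.1
        · exact hw.2
      simpa [preDep, termsOf_tag] using mem_vars_toFinset.1 this
    rw [h4 _ (Or.inl rfl), h4 _ (Or.inr rfl)] at h3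
    exact h3

theorem goal_of_externalize {s : List DepCode} {q : List (List (Atom ℕ))} {ps : List Pred}
    {K : Instance} (hps : CoversPreds (pre s q) ps) (hK : ∀ p ∈ pre s q, Holds K p.1 p.2)
    (h : EntailsSet (externalize ps K) (instancesOf q)) : (1, []) ∈ K := by
  obtain ⟨_, ⟨Q, hQ, rfl⟩, θ, hθ⟩ := h
  have hQ' := preQuery_mem_pre (s := s) hQ
  obtain ⟨θ', -, h2⟩ := hK _ hQ' θ (mapAtom_tag_mem_of_externalize (fun a ha => hps.of_mem hQ'
    (List.mem_append_left _ (List.mem_map_of_mem (f := fun a : Atom ℕ => (a.1 + 2, a.2)) ha)))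
    fun b hb => rename_subset_iff.1 hθ b hb)
  exact h2 (1, []) (by simp)

/-! ### Singularization -/

/-- `w` is a splitting of the rule `p.1 → p.2`: the relational atoms of the new body are linear,
`σ` maps them onto the old body, and a variable `y` with `σ y ≠ y` is linked to `σ y` by an
equality atom. -/
structure IsSplit (p : List (Atom ℕ) × List (Atom ℕ)) (w : Split) : Prop where
  mapsTo : ∀ r ∈ w.1, mapAtom (ap w.2.2.2.2) r ∈ p.1
  surj : ∀ b ∈ p.1, ∃ r ∈ w.1, mapAtom (ap w.2.2.2.2) r = b
  linear : (termsOf w.1).Nodup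
  linked : ∀ y ∈ termsOf w.1, ap w.2.2.2.2 y = y ∨ (ap w.2.2.2.2 y, y) ∈ w.2.1
  eqs : ∀ e ∈ w.2.1, e.1 ∈ termsOf w.1 ∧ e.2 ∈ termsOf w.1 ∧
    ap w.2.2.2.2 e.1 = e.1 ∧ ap w.2.2.2.2 e.2 = e.1
  head_fixed : ∀ v ∈ termsOf p.2, v ∈ termsOf w.1 → ap w.2.2.2.2 v = v
  head_iff : ∀ h, h ∈ w.2.2.1 ↔ h ∈ p.2
  frontier_sub : ∀ x ∈ w.2.2.2.1, x ∈ termsOf w.1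
  sub_frontier : ∀ v ∈ termsOf w.2.2.1, v ∈ termsOf w.1 → v ∈ w.2.2.2.1

theorem map_idxOf_eq_range_iff (l : List ℕ) :
    l.map (fun x => l.idxOf x) = List.range l.length ↔ l.Nodup := by
  constructor
  · intro h
    exact List.Nodup.of_map _ (h ▸ List.nodup_range)
  · intro h
    refine List.ext_getElem (by simp) fun i h1 h2 => ?_
    simp [h.idxOf_getElem]

theorem splitOk_iff {p : List (Atom ℕ) × List (Atom ℕ)} {w : Split} :
    splitOk p w = true ↔ IsSplit p w := by
  simp only [splitOk, Bool.and_eq_true, List.all_eq_true, List.any_eq_true, decide_eq_true_eq,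
    Bool.or_eq_true, Bool.not_eq_true', decide_eq_false_iff_not, map_idxOf_eq_range_iff]
  constructor
  · rintro ⟨⟨⟨⟨⟨⟨⟨⟨⟨h1, h2⟩, h3⟩, h4⟩, h5⟩, h6⟩, h7⟩, h8⟩, h9⟩, h10⟩
    exact ⟨h1, h2, h3, h4, fun e he => ⟨(h5 e he).1.1.1, (h5 e he).1.1.2, (h5 e he).1.2,
      (h5 e he).2⟩, fun v hv hv' => (h6 v hv).resolve_left fun h => h hv',
      fun h => ⟨h8 h, h7 h⟩, h9, fun v hv hv' => (h10 v hv).resolve_left fun h => h hv'⟩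
  · rintro ⟨h1, h2, h3, h4, h5, h6, h7, h8, h9⟩
    refine ⟨⟨⟨⟨⟨⟨⟨⟨⟨h1, h2⟩, h3⟩, h4⟩, fun e he => ?_⟩, fun v hv => ?_⟩, fun h => (h7 h).2⟩,
      fun h => (h7 h).1⟩, h8⟩, fun v hv => ?_⟩
    · obtain ⟨a, b, c, d⟩ := h5 e he
      exact ⟨⟨⟨a, b⟩, c⟩, d⟩
    · exact or_iff_not_imp_left.2 fun h => h6 v hv (not_not.1 h)
    · exact or_iff_not_imp_left.2 fun h => h9 v hv (not_not.1 h)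

theorem IsSplit.termsOf_body {p : List (Atom ℕ) × List (Atom ℕ)} {w : Split} (h : IsSplit p w)
    {x : ℕ} (hx : x ∈ termsOf (toRule w).1) : x ∈ termsOf w.1 := by
  obtain ⟨a, ha, hxa⟩ := mem_termsOf.1 hx
  rcases List.mem_append.1 ha with ha | ha
  · exact mem_termsOf.2 ⟨a, ha, hxa⟩
  · obtain ⟨e, he, rfl⟩ := List.mem_map.1 ha
    obtain ⟨h1, h2, -⟩ := h.eqs e he
    have : x = e.1 ∨ x = e.2 := by simpa using hxa
    rcases this with rfl | rfl
    · exact h1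
    · exact h2

theorem IsSplit.termsOf_head {p : List (Atom ℕ) × List (Atom ℕ)} {w : Split} (h : IsSplit p w)
    {x : ℕ} : x ∈ termsOf (toRule w).2.1 ↔ x ∈ termsOf p.2 := by
  simp only [mem_termsOf, toRule, h.head_iff]

/-- When equality is the identity, a rule implies its splittings. -/
theorem IsSplit.holds {p : List (Atom ℕ) × List (Atom ℕ)} {w : Split} (h : IsSplit p w)
    {K : Instance} (hE : ∀ x y, (0, [x, y]) ∈ K → x = y) (hK : Holds K p.1 p.2) :
    Holds K (toRule w).1 (toRule w).2.1 := by
  intro θ hθ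
  have hσ : ∀ y ∈ termsOf w.1, θ (ap w.2.2.2.2 y) = θ y := by
    intro y hy
    rcases h.linked y hy with h1 | h1
    · rw [h1]
    · exact hE _ _ (hθ (0, [ap w.2.2.2.2 y, y])
        (List.mem_append_right _ (List.mem_map.2 ⟨_, h1, rfl⟩)))
  obtain ⟨θ', h1, h2⟩ := hK θ fun b hb => by
    obtain ⟨r, hr, rfl⟩ := h.surj b hb
    have h3 := hθ r (List.mem_append_left _ hr)
    rwa [mapAtom_mapAtom, mapAtom_congr fun y hy => hσ y (mem_termsOf.2 ⟨r, hr, hy⟩)]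
  refine ⟨θ', fun x hx hx' => ?_, fun a ha => h2 a ((h.head_iff a).1 ha)⟩
  have hx2 := h.termsOf_head.1 hx'
  have hx1 := h.termsOf_body hx
  refine h1 x ?_ hx2
  obtain ⟨r, hr, hxr⟩ := mem_termsOf.1 hx1
  refine mem_termsOf.2 ⟨_, h.mapsTo r hr, ?_⟩
  have := List.mem_map_of_mem (f := ap w.2.2.2.2) hxr
  rwa [h.head_fixed x hx2 hx1] at this

/-- Linear atoms can be matched position by position. -/
theorem exists_match_of_linear (R : List (Atom ℕ)) (hR : (termsOf R).Nodup)
    (h : Atom ℕ → Atom ℕ) (hh : ∀ r ∈ R, (h r).1 = r.1 ∧ (h r).2.length = r.2.length) :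
    ∃ θ : ℕ → ℕ, ∀ r ∈ R, mapAtom θ r = h r := by
  induction R with
  | nil => exact ⟨id, by simp⟩
  | cons a R ih =>
    have hR' : (a.2 ++ termsOf R).Nodup := by simpa [termsOf] using hR
    rw [List.nodup_append'] at hR'
    obtain ⟨h1, h2, h3⟩ := hR'
    obtain ⟨θ, hθ⟩ := ih h2 fun r hr => hh r (List.mem_cons_of_mem _ hr)
    refine ⟨fun x => if x ∈ a.2 then (h a).2.getD (a.2.idxOf x) 0 else θ x, fun r hr => ?_⟩
    rcases List.mem_cons.1 hr with rfl | hr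
    · obtain ⟨h4, h5⟩ := hh r List.mem_cons_self
      refine Prod.ext h4.symm (List.ext_getElem (by simp [mapAtom, h5]) fun i hi hi' => ?_)
      have hi2 : i < r.2.length := by simpa [mapAtom] using hi
      simp [mapAtom, h1.idxOf_getElem, List.getElem?_eq_getElem hi']
    · rw [← hθ r hr]
      exact mapAtom_congr fun x hx => if_neg fun hxa =>
        h3 hxa (mem_termsOf.2 ⟨r, hr, hx⟩)

/-- A splitting of a rule implies the rule in the quotient by equality. Here `rep` chooses a
representative of each class. -/
theorem IsSplit.holds_quotient {p : List (Atom ℕ) × List (Atom ℕ)} {w : Split}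
    (h : IsSplit p w) {H : Instance} {rep : ℕ → ℕ}
    (hrep : ∀ a b, rep a = rep b → a = b ∨ (0, [a, b]) ∈ H)
    (hrefl : ∀ b ∈ p.1, ∀ a ∈ H, pred a = pred b → ∀ t ∈ a.2, (0, [t, t]) ∈ H)
    (hH : Holds H (toRule w).1 (toRule w).2.1) : Holds (rename rep H) p.1 p.2 := by
  intro ϑ hϑ
  choose! g hg1 hg2 using fun (r : Atom ℕ) (hr : r ∈ w.1) => hϑ _ (h.mapsTo r hr)
  have hpred : ∀ r ∈ w.1, pred (g r) = pred r := fun r hr => by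
    rw [← pred_mapAtom rep, hg2 r hr, pred_mapAtom, pred_mapAtom]
  obtain ⟨θ, hθ⟩ := exists_match_of_linear w.1 h.linear g fun r hr =>
    Prod.ext_iff.1 (hpred r hr)
  have hval : ∀ y ∈ termsOf w.1, rep (θ y) = ϑ (ap w.2.2.2.2 y) := by
    intro y hy
    obtain ⟨r, hr, hyr⟩ := mem_termsOf.1 hy
    have h1 := hg2 r hr
    rw [← hθ r hr, mapAtom_mapAtom, mapAtom_mapAtom] at h1
    exact eq_of_mapAtom_eq h1 y hyr
  have hself : ∀ y ∈ termsOf w.1, (0, [θ y, θ y]) ∈ H := by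
    intro y hy
    obtain ⟨r, hr, hyr⟩ := mem_termsOf.1 hy
    refine hrefl _ (h.mapsTo r hr) _ (hg1 r hr) (by rw [hpred r hr, pred_mapAtom]) _ ?_
    rw [← hθ r hr]
    exact List.mem_map_of_mem hyr
  obtain ⟨θ', h1, h2⟩ := hH θ fun b hb => by
    rcases List.mem_append.1 hb with hb | hb
    · rw [hθ b hb]
      exact hg1 b hb
    · obtain ⟨e, he, rfl⟩ := List.mem_map.1 hb
      obtain ⟨h3, h4, h5, h6⟩ := h.eqs e he
      rcases hrep (θ e.1) (θ e.2) (by rw [hval _ h3, hval _ h4, h5, h6]) with h7 | h7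
      · have := hself _ h3
        nth_rewrite 2 [h7] at this
        exact this
      · exact h7
  refine ⟨fun x => rep (θ' x), fun x hx hx' => ?_, fun a ha => ?_⟩
  · obtain ⟨b, hb, hxb⟩ := mem_termsOf.1 hx
    obtain ⟨r, hr, rfl⟩ := h.surj b hb
    obtain ⟨y, hy, hyx⟩ := List.mem_map.1 hxb
    have hy' : y ∈ termsOf w.1 := mem_termsOf.2 ⟨r, hr, hy⟩
    have hx1 : x ∈ termsOf w.1 := by
      rcases h.linked y hy' with h3 | h3
      · rw [← hyx, h3]; exact hy'
      · rw [← hyx]; exact (h.eqs _ h3).1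
    have hx2 : x ∈ termsOf (toRule w).1 := by
      obtain ⟨a, ha, hxa⟩ := mem_termsOf.1 hx1
      exact mem_termsOf.2 ⟨a, List.mem_append_left _ ha, hxa⟩
    change rep (θ' x) = ϑ x
    rw [h1 x hx2 (h.termsOf_head.2 hx'), hval x hx1, h.head_fixed x hx' hx1]
  · exact ⟨_, h2 a ((h.head_iff a).2 ha), by rw [mapAtom_mapAtom]⟩

/-- A symmetric and transitive relation has a function that chooses representatives. -/
theorem exists_rep {E : ℕ → ℕ → Prop} (hs : ∀ a b, E a b → E b a)
    (ht : ∀ a b c, E a b → E b c → E a c) :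
    ∃ rep : ℕ → ℕ, ∀ a b, rep a = rep b ↔ a = b ∨ E a b := by
  let S : Setoid ℕ := ⟨fun a b => a = b ∨ E a b, fun _ => Or.inl rfl,
    fun h => h.imp Eq.symm (hs _ _), fun {a b c} h1 h2 => by
      rcases h1 with rfl | h1
      · exact h2
      · rcases h2 with rfl | h2
        · exact Or.inr h1
        · exact Or.inr (ht _ _ _ h1 h2)⟩
  refine ⟨fun a => (Quotient.mk S a).out, fun a b => ?_⟩
  rw [Quotient.out_inj]
  exact Quotient.eq

theorem eq_symm_of_holds {H : Instance} (h : Holds H symmR.1 symmR.2.1) {a b : ℕ}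
    (hab : (0, [a, b]) ∈ H) : (0, [b, a]) ∈ H := by
  obtain ⟨θ', h1, h2⟩ := h (fun x => if x = 0 then a else b) (by simpa [symmR, mapAtom] using hab)
  have e0 := h1 0 (by simp [symmR, termsOf]) (by simp [symmR, termsOf])
  have e1 := h1 1 (by simp [symmR, termsOf]) (by simp [symmR, termsOf])
  simpa [symmR, mapAtom, e0, e1] using h2

theorem eq_trans_of_holds {H : Instance} (h : Holds H transR.1 transR.2.1) {a b c : ℕ}
    (hab : (0, [a, b]) ∈ H) (hbc : (0, [b, c]) ∈ H) : (0, [a, c]) ∈ H := by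
  obtain ⟨θ', h1, h2⟩ := h (fun x => if x = 0 then a else if x = 1 then b else c)
    (by simpa [transR, mapAtom] using ⟨hab, hbc⟩)
  have e0 := h1 0 (by simp [transR, termsOf]) (by simp [transR, termsOf])
  have e1 := h1 2 (by simp [transR, termsOf]) (by simp [transR, termsOf])
  simpa [transR, mapAtom, e0, e1] using h2

theorem eq_refl_of_holds {H : Instance} {p : Pred} (h : Holds H (reflR p).1 (reflR p).2.1)
    {a : Atom ℕ} (ha : a ∈ H) (hp : a.1 = p.1 + 2 ∧ a.2.length = p.2) {t : ℕ} (ht : t ∈ a.2) :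
    (0, [t, t]) ∈ H := by
  obtain ⟨i, hi, rfl⟩ := List.mem_iff_getElem.1 ht
  obtain ⟨θ', h1, h2⟩ := h (fun x => a.2.getD x 0) (by
    have : mapAtom (fun x => a.2.getD x 0) (p.1 + 2, List.range p.2) = a := by
      refine Prod.ext hp.1.symm (List.ext_getElem (by simp [mapAtom, hp.2]) fun j hj hj' => ?_)
      simp [mapAtom, List.getElem?_eq_getElem hj']
    intro b hb
    rw [List.mem_singleton.1 hb, this]
    exact ha)
  have hi' : i < p.2 := hp.2 ▸ hi
  have e := h1 i (by simpa [reflR, termsOf] using hi')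
    (by simpa [reflR, termsOf] using hi')
  have h3 := h2 (0, [i, i]) (by simpa [reflR] using hi')
  simpa [mapAtom, e, List.getElem?_eq_getElem hi] using h3

/-- When equality is the identity, the equality rules hold, and the rules of `P` imply all
singularized rules. -/
theorem holds_rules {P : List (List (Atom ℕ) × List (Atom ℕ))} {ps : List Pred} {W : List Split}
    (hW : ∀ w ∈ W, ∃ p ∈ P, IsSplit p w) {K : Instance}
    (hE : ∀ x y, (0, [x, y]) ∈ K ↔ x = y) (hK : ∀ p ∈ P, Holds K p.1 p.2) :
    ∀ r ∈ rules ps W, Holds K r.1 r.2.1 := by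
  intro r hr
  simp only [rules, List.mem_cons, List.mem_append, List.mem_map] at hr
  rcases hr with rfl | rfl | ⟨p, -, rfl⟩ | ⟨w, hw, rfl⟩
  · intro θ hθ
    have h1 : θ 0 = θ 1 := (hE _ _).1 (hθ (0, [0, 1]) (by simp [symmR]))
    exact ⟨θ, fun _ _ _ => rfl, by simpa [symmR, mapAtom, hE] using h1.symm⟩
  · intro θ hθ
    have h1 : θ 0 = θ 1 := (hE _ _).1 (hθ (0, [0, 1]) (by simp [transR]))
    have h2 : θ 1 = θ 2 := (hE _ _).1 (hθ (0, [1, 2]) (by simp [transR]))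
    exact ⟨θ, fun _ _ _ => rfl, by simpa [transR, mapAtom, hE] using h1.trans h2⟩
  · exact fun θ _ => ⟨θ, fun _ _ _ => rfl, by simp [reflR, mapAtom, hE]⟩
  · obtain ⟨p, hp, h⟩ := hW w hw
    exact h.holds (fun x y => (hE x y).1) (hK p hp)

/-- An internal instance that satisfies the singularized rules gives, as its quotient by equality,
an instance that satisfies the original rules. -/
theorem exists_quotient {P : List (List (Atom ℕ) × List (Atom ℕ))} {ps : List Pred}
    {W : List Split} (hW : ∀ p ∈ P, ∃ w ∈ W, IsSplit p w) (hps : CoversPreds P ps)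
    (hrel : ∀ p ∈ P, ∀ a ∈ p.1, 2 ≤ a.1) {H : Instance}
    (hH : ∀ r ∈ rules ps W, Holds H r.1 r.2.1) :
    ∃ rep : ℕ → ℕ, (∀ x y, (0, [x, y]) ∈ rename rep H → x = y) ∧
      ∀ p ∈ P, Holds (rename rep H) p.1 p.2 := by
  have hsymm : ∀ a b, (0, [a, b]) ∈ H → (0, [b, a]) ∈ H := fun a b =>
    eq_symm_of_holds (hH symmR (by simp [rules]))
  have htrans : ∀ a b c, (0, [a, b]) ∈ H → (0, [b, c]) ∈ H → (0, [a, c]) ∈ H := fun a b c =>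
    eq_trans_of_holds (hH transR (by simp [rules]))
  obtain ⟨rep, hrep⟩ := exists_rep (E := fun a b => (0, [a, b]) ∈ H) hsymm htrans
  refine ⟨rep, ?_, fun p hp => ?_⟩
  · rintro x y ⟨⟨n, ts⟩, ha, h⟩
    simp only [mapAtom, Prod.mk.injEq] at h
    obtain ⟨rfl, h⟩ := h
    rcases ts with _ | ⟨a, _ | ⟨b, _ | ⟨c, ts⟩⟩⟩ <;> simp at h
    rw [← h.1, ← h.2]
    exact (hrep a b).2 (Or.inr ha)
  · obtain ⟨w, hw, hs⟩ := hW p hp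
    refine hs.holds_quotient (fun a b => (hrep a b).1) (fun b hb a ha hab t ht => ?_)
      (hH _ (by simp only [rules, List.mem_cons, List.mem_append, List.mem_map]
                exact Or.inr (Or.inr (Or.inr ⟨w, hw, rfl⟩))))
    have h2 := hrel p hp b hb
    have hmem : (b.1 - 2, b.2.length) ∈ ps :=
      (hps p hp b (List.mem_append_left _ hb)).resolve_left (by omega)
    obtain ⟨h3, h4⟩ : a.1 = b.1 ∧ a.2.length = b.2.length := Prod.ext_iff.1 hab
    exact eq_refl_of_holds (hH (reflR (b.1 - 2, b.2.length))
      (by simp only [rules, List.mem_cons, List.mem_append, List.mem_map]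
          exact Or.inr (Or.inr (Or.inl ⟨_, hmem, rfl⟩)))) ha ⟨by simp only; omega, h4⟩ ht

/-! ### Rule instances over shapes -/

/-- `i = (r, θ)` is an instance of a rule of `T` over shapes: an existential variable `z` has the
shape of the Skolem term `f_{r,z}` over the frontier. -/
structure IsInst (T : List Rule) (m : ℕ) (Tab : List Shape) (A : List Pred) (i : Rule × List ℕ) :
    Prop where
  mem : i.1 ∈ T
  frontier_sub : ∀ x ∈ i.1.2.2, x ∈ termsOf i.1.1
  head : ∀ z ∈ termsOf i.1.2.1, z ∉ i.1.2.2 → z ∉ termsOf i.1.1 ∧ ap i.2 z ≠ 0 ∧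
    (shape Tab (ap i.2 z)).2.2 = (i.1, z, i.1.2.2.map fun x => ap i.2 x) ∧
    (∀ x ∈ i.1.2.2, (shape Tab (ap i.2 x)).1 < (shape Tab (ap i.2 z)).1) ∧
    width Tab (ap i.2 z) = (i.1.2.2.flatMap fun y => block Tab i.2 y).length
  preds_body : ∀ a ∈ (typedRule m Tab i).1, pred a ∈ A
  preds_head : ∀ a ∈ (typedRule m Tab i).2, pred a ∈ A

theorem instOk_iff {T : List Rule} {m : ℕ} {Tab : List Shape} {A : List Pred}
    {i : Rule × List ℕ} : instOk T m Tab A i = true ↔ IsInst T m Tab A i := by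
  simp only [instOk, Bool.and_eq_true, List.all_eq_true, decide_eq_true_eq,
    Bool.or_eq_true, Bool.not_eq_true', decide_eq_false_iff_not]
  constructor
  · rintro ⟨⟨⟨⟨h1, h2⟩, h3⟩, h4⟩, h5⟩
    refine ⟨h1, h2, fun z hz hz' => ?_, h4, h5⟩
    obtain ⟨⟨⟨⟨a, b⟩, c⟩, d⟩, e⟩ := (h3 z hz).resolve_left hz'
    exact ⟨a, b, c, d, e⟩
  · rintro ⟨h1, h2, h3, h4, h5⟩
    refine ⟨⟨⟨⟨h1, h2⟩, fun z hz => or_iff_not_imp_left.2 fun hz' => ?_⟩, h4⟩, h5⟩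
    obtain ⟨a, b, c, d, e⟩ := h3 z hz hz'
    exact ⟨⟨⟨⟨a, b⟩, c⟩, d⟩, e⟩

theorem length_block (Tab : List Shape) (θ : List ℕ) (x : ℕ) :
    (block Tab θ x).length = width Tab (ap θ x) := by
  simp [block]

theorem IsInst.length_headBlock {T : List Rule} {m : ℕ} {Tab : List Shape} {A : List Pred}
    {i : Rule × List ℕ} (h : IsInst T m Tab A i) {x : ℕ} (hx : x ∈ termsOf i.1.2.1) :
    (headBlock Tab i.2 i.1.2.2 x).length = width Tab (ap i.2 x) := by
  unfold headBlock
  split_ifs with hX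
  · exact length_block _ _ _
  · exact (h.head x hx hX).2.2.2.2.symm

theorem IsInst.datalog {T : List Rule} {m : ℕ} {Tab : List Shape} {A : List Pred}
    {i : Rule × List ℕ} (h : IsInst T m Tab A i) {v : ℕ}
    (hv : v ∈ termsOf (typedRule m Tab i).2) : v ∈ termsOf (typedRule m Tab i).1 := by
  have key : ∀ y ∈ i.1.2.2, v ∈ block Tab i.2 y → v ∈ termsOf (typedRule m Tab i).1 := by
    intro y hy hvy
    obtain ⟨b, hb, hyb⟩ := mem_termsOf.1 (h.frontier_sub y hy)
    exact mem_termsOf.2 ⟨_, List.mem_map_of_mem hb, List.mem_flatMap.2 ⟨y, hyb, hvy⟩⟩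
  obtain ⟨a, ha, hva⟩ := mem_termsOf.1 hv
  obtain ⟨b, hb, rfl⟩ := List.mem_map.1 ha
  obtain ⟨x, hx, hvx⟩ := List.mem_flatMap.1 hva
  unfold headBlock at hvx
  split_ifs at hvx with hX
  · exact key x hX hvx
  · obtain ⟨y, hy, hvy⟩ := List.mem_flatMap.1 hvx
    exact key y hy hvy

theorem name_inj {m n n' : ℕ} {cs cs' : List ℕ} :
    name m n cs = name m n' cs' ↔ n = n' ∧ cs = cs' := by
  simp only [name, Nat.add_left_cancel_iff, Encodable.encode_inj, Prod.mk.injEq]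

theorem le_name (m n : ℕ) (cs : List ℕ) : m ≤ name m n cs := Nat.le_add_right _ _

/-! ### Soundness of the typed program -/

/-- Cut `v` into pieces of the widths of `cs`, and evaluate each piece. -/
def evalPieces (Tab : List Shape) (f : ℕ → List ℕ → ℕ) (cs : List ℕ) (v : List ℕ) : List ℕ :=
  (cs.zip ((cs.map (width Tab)).splitLengths v)).map fun p => f p.1 p.2

theorem splitLengths_flatMap {α β : Type} (X : List α) (u : α → List β) :
    (X.map fun x => (u x).length).splitLengths (X.flatMap u) = X.map u := by
  induction X with
  | nil => rfl
  | cons x X ih => simp [List.splitLengths_cons, ih]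

theorem evalPieces_flatMap {Tab : List Shape} (f : ℕ → List ℕ → ℕ) (X : List ℕ) (θ : ℕ → ℕ)
    (u : ℕ → List ℕ) (h : ∀ x ∈ X, (u x).length = width Tab (θ x)) :
    evalPieces Tab f (X.map θ) (X.flatMap u) = X.map fun x => f (θ x) (u x) := by
  have h1 : (X.map θ).map (width Tab) = X.map fun x => (u x).length := by
    rw [List.map_map]
    exact List.map_congr_left fun x hx => (h x hx).symm
  rw [evalPieces, h1, splitLengths_flatMap, List.zip_map', List.map_map]
  rfl

/-- The value of the term of shape `c` with leaves `v`, where `sk r ys` gives the values of the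
existential variables of `r` for the frontier values `ys`. -/
def val (Tab : List Shape) (sk : Rule → List ℕ → ℕ → ℕ) (c : ℕ) (v : List ℕ) : ℕ :=
  if c = 0 then v.headD 0 else
    sk (shape Tab c).2.2.1
      (evalPieces Tab (fun a w => if (shape Tab a).1 < (shape Tab c).1 then val Tab sk a w else 0)
        (shape Tab c).2.2.2.2 v)
      (shape Tab c).2.2.2.1
termination_by (shape Tab c).1

theorem IsInst.val_eq {T : List Rule} {m : ℕ} {Tab : List Shape} {A : List Pred}
    {i : Rule × List ℕ} (h : IsInst T m Tab A i) (sk : Rule → List ℕ → ℕ → ℕ) {z : ℕ}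
    (hz : z ∈ termsOf i.1.2.1) (hzX : z ∉ i.1.2.2) (u : ℕ → List ℕ)
    (hu : ∀ x ∈ i.1.2.2, (u x).length = width Tab (ap i.2 x)) :
    val Tab sk (ap i.2 z) (i.1.2.2.flatMap u) =
      sk i.1 (i.1.2.2.map fun x => val Tab sk (ap i.2 x) (u x)) z := by
  obtain ⟨-, h0, hs, hr, -⟩ := h.head z hz hzX
  rw [val, if_neg h0]
  simp only [hs]
  rw [evalPieces_flatMap _ _ _ _ hu]
  congr 1
  exact List.map_congr_left fun x hx => if_pos (hr x hx)

/-- Skolem functions of an instance: their values depend on the frontier values only. -/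
theorem exists_skolem (K : Instance) : ∃ sk : Rule → List ℕ → ℕ → ℕ,
    ∀ r : Rule, Holds K r.1 r.2.1 →
      (∀ x ∈ termsOf r.1, x ∈ termsOf r.2.1 → x ∈ r.2.2) → ∀ φ : ℕ → ℕ,
      (∀ b ∈ r.1, mapAtom φ b ∈ K) →
      (∀ x ∈ termsOf r.1, x ∈ termsOf r.2.1 → sk r (r.2.2.map φ) x = φ x) ∧
        ∀ h ∈ r.2.1, mapAtom (sk r (r.2.2.map φ)) h ∈ K := by
  have key : ∀ (r : Rule) (ys : List ℕ), ∃ g : ℕ → ℕ, Holds K r.1 r.2.1 →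
      (∀ x ∈ termsOf r.1, x ∈ termsOf r.2.1 → x ∈ r.2.2) → ∀ φ : ℕ → ℕ, r.2.2.map φ = ys →
      (∀ b ∈ r.1, mapAtom φ b ∈ K) →
      (∀ x ∈ termsOf r.1, x ∈ termsOf r.2.1 → g x = φ x) ∧ ∀ h ∈ r.2.1, mapAtom g h ∈ K := by
    intro r ys
    by_cases hex : Holds K r.1 r.2.1 ∧ ∃ φ : ℕ → ℕ, r.2.2.map φ = ys ∧
        ∀ b ∈ r.1, mapAtom φ b ∈ K
    · obtain ⟨hK, φ₀, h1, h2⟩ := hex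
      obtain ⟨g, hg1, hg2⟩ := hK φ₀ h2
      refine ⟨g, fun _ hX φ hφ _ => ⟨fun x hx hx' => ?_, hg2⟩⟩
      rw [hg1 x hx hx']
      exact List.map_inj_left.1 (h1.trans hφ.symm) x (hX x hx hx')
    · exact ⟨id, fun hK _ φ h1 h2 => absurd ⟨hK, φ, h1, h2⟩ hex⟩
  choose sk hsk using key
  exact ⟨sk, fun r hK hX φ hφ => hsk r _ hK hX φ rfl hφ⟩

/-- The instance of typed facts: the auxiliary facts are those that hold in `K`. -/
def typedInstance (m : ℕ) (Tab : List Shape) (A : List Pred) (sk : Rule → List ℕ → ℕ → ℕ)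
    (K M : Instance) : Instance :=
  {a | a ∈ M ∧ pred a ∉ A ∨
    ∃ n cs, a.1 = name m n cs ∧ (n, evalPieces Tab (val Tab sk) cs a.2) ∈ K}

theorem typed_mem {m : ℕ} {Tab : List Shape} {A : List Pred} {sk : Rule → List ℕ → ℕ → ℕ}
    {K M : Instance} {n : ℕ} {X : List ℕ} {θ : ℕ → ℕ} {u : ℕ → List ℕ}
    (hu : ∀ x ∈ X, (u x).length = width Tab (θ x))
    (h : (n, X.map fun x => val Tab sk (θ x) (u x)) ∈ K) :
    (name m n (X.map θ), X.flatMap u) ∈ typedInstance m Tab A sk K M :=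
  Or.inr ⟨n, X.map θ, rfl, by rwa [evalPieces_flatMap _ _ _ _ hu]⟩

theorem of_typed_mem {m : ℕ} {Tab : List Shape} {A : List Pred} {sk : Rule → List ℕ → ℕ → ℕ}
    {K M : Instance} {n : ℕ} {X : List ℕ} {θ : ℕ → ℕ} {u : ℕ → List ℕ}
    (hu : ∀ x ∈ X, (u x).length = width Tab (θ x))
    (hA : pred (name m n (X.map θ), X.flatMap u) ∈ A)
    (h : (name m n (X.map θ), X.flatMap u) ∈ typedInstance m Tab A sk K M) :
    (n, X.map fun x => val Tab sk (θ x) (u x)) ∈ K := by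
  rcases h with ⟨-, h⟩ | ⟨n', cs, h1, h2⟩
  · exact absurd hA h
  · obtain ⟨rfl, rfl⟩ := name_inj.1 h1
    rwa [evalPieces_flatMap _ _ _ _ hu] at h2

/-- The typed rules hold in the instance of typed facts. -/
theorem IsInst.holds_typedRule {T : List Rule} {m : ℕ} {Tab : List Shape} {A : List Pred}
    {i : Rule × List ℕ} (h : IsInst T m Tab A i) {K M : Instance}
    {sk : Rule → List ℕ → ℕ → ℕ}
    (hsk : ∀ r : Rule, Holds K r.1 r.2.1 →
      (∀ x ∈ termsOf r.1, x ∈ termsOf r.2.1 → x ∈ r.2.2) → ∀ φ : ℕ → ℕ,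
      (∀ b ∈ r.1, mapAtom φ b ∈ K) →
      (∀ x ∈ termsOf r.1, x ∈ termsOf r.2.1 → sk r (r.2.2.map φ) x = φ x) ∧
        ∀ h ∈ r.2.1, mapAtom (sk r (r.2.2.map φ)) h ∈ K)
    (hK : Holds K i.1.1 i.1.2.1) :
    Holds (typedInstance m Tab A sk K M) (typedRule m Tab i).1 (typedRule m Tab i).2 := by
  intro σ hσ
  have hlen : ∀ x, ((block Tab i.2 x).map σ).length = width Tab (ap i.2 x) := fun x => by
    rw [List.length_map, length_block]
  have hfr : ∀ x ∈ termsOf i.1.1, x ∈ termsOf i.1.2.1 → x ∈ i.1.2.2 := fun x hx hx' => by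
    by_contra hX
    exact (h.head x hx' hX).1 hx
  have hbody : ∀ b ∈ i.1.1,
      mapAtom (fun x => val Tab sk (ap i.2 x) ((block Tab i.2 x).map σ)) b ∈ K := by
    intro b hb
    have h1 := hσ _ (List.mem_map_of_mem hb)
    have h2 := h.preds_body _ (List.mem_map_of_mem hb)
    rw [← pred_mapAtom σ] at h2
    simp only [mapAtom, List.map_flatMap] at h1 h2
    exact of_typed_mem (fun x _ => hlen x) h2 h1
  obtain ⟨h1, h2⟩ := hsk i.1 hK hfr _ hbody
  refine ⟨σ, fun _ _ _ => rfl, fun a ha => ?_⟩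
  obtain ⟨b, hb, rfl⟩ := List.mem_map.1 ha
  simp only [mapAtom, List.map_flatMap]
  have hb' : ∀ x ∈ b.2, x ∈ termsOf i.1.2.1 := fun x hx => mem_termsOf.2 ⟨b, hb, hx⟩
  refine typed_mem (fun x hx => ?_) ?_
  · rw [List.length_map, h.length_headBlock (hb' x hx)]
  · have h3 : ∀ x ∈ b.2, val Tab sk (ap i.2 x) ((headBlock Tab i.2 i.1.2.2 x).map σ) =
        sk i.1 (i.1.2.2.map fun x => val Tab sk (ap i.2 x) ((block Tab i.2 x).map σ)) x := ?_
    · rw [List.map_congr_left h3]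
      exact h2 b hb
    intro x hx
    by_cases hX : x ∈ i.1.2.2
    · rw [h1 x (h.frontier_sub x hX) (hb' x hx), headBlock, if_pos hX]
    · rw [headBlock, if_neg hX, List.map_flatMap, h.val_eq sk (hb' x hx) hX _ fun y _ => hlen y]

theorem flatMap_singleton_eq_map {α β : Type} (l : List α) (f : α → β) :
    l.flatMap (fun x => [f x]) = l.map f := by
  induction l <;> simp_all

/-- The copy rules hold in the instance of typed facts. -/
theorem holds_copyRule {m : ℕ} {Tab : List Shape} {A : List Pred} {K M : Instance}
    {sk : Rule → List ℕ → ℕ → ℕ} {p : Pred} (hp : p.1 < m) (hw : width Tab 0 = 1)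
    (hKM : ∀ a ∈ M, (a.1 + 2, a.2) ∈ K) :
    Holds (typedInstance m Tab A sk K M) (copyRule m p).1 (copyRule m p).2 := by
  intro σ hσ
  refine ⟨σ, fun _ _ _ => rfl, fun a ha => ?_⟩
  obtain rfl := List.mem_singleton.1 ha
  have hM : (p.1, (List.range p.2).map σ) ∈ M := by
    rcases hσ (p.1, List.range p.2) List.mem_cons_self with ⟨h, -⟩ | ⟨n, cs, h, -⟩
    · exact h
    · have := le_name m n cs
      simp only [mapAtom] at h
      omega
  have h1 := typed_mem (m := m) (Tab := Tab) (A := A) (sk := sk) (K := K) (M := M)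
    (n := p.1 + 2) (X := List.range p.2) (θ := fun _ => 0) (u := fun x => [σ x])
    (fun x _ => hw.symm) (by simpa [val] using hKM _ hM)
  rwa [flatMap_singleton_eq_map] at h1

/-! ### Completeness of the typed program -/

/-- The internal instance read off from the auxiliary facts of `M`. Its elements are codes of pairs
of a shape and a list of leaves, and it is restricted to facts with shapes in `C`. -/
def untypedInstance (m : ℕ) (Tab : List Shape) (C : List (Atom ℕ)) (M : Instance) : Instance :=
  {a | ∃ l : List (ℕ × List ℕ), a.2 = l.map Encodable.encode ∧ (a.1, l.map Prod.fst) ∈ C ∧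
    (name m a.1 (l.map Prod.fst), l.flatMap Prod.snd) ∈ M ∧ ∀ p ∈ l, p.2.length = width Tab p.1}

theorem mem_untypedInstance {m : ℕ} {Tab : List Shape} {C : List (Atom ℕ)} {M : Instance}
    {b : Atom ℕ} {θ : ℕ → ℕ} {u : ℕ → List ℕ} :
    mapAtom (fun x => Encodable.encode (θ x, u x)) b ∈ untypedInstance m Tab C M ↔
      mapAtom θ b ∈ C ∧ (name m b.1 (b.2.map θ), b.2.flatMap u) ∈ M ∧
        ∀ x ∈ b.2, (u x).length = width Tab (θ x) := by
  constructor
  · rintro ⟨l, h1, h2, h3, h4⟩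
    have hl : l = b.2.map fun x => (θ x, u x) := by
      refine (List.map_injective_iff.2 (Encodable.encode_injective (α := ℕ × List ℕ))) ?_
      rw [← h1, List.map_map]
      rfl
    subst hl
    simp only [mapAtom, List.map_map, List.flatMap_map, List.forall_mem_map] at h2 h3 h4
    exact ⟨h2, h3, h4⟩
  · rintro ⟨h2, h3, h4⟩
    refine ⟨b.2.map fun x => (θ x, u x), by simp [mapAtom], ?_, ?_, ?_⟩
    · simpa [mapAtom, Function.comp_def] using h2
    · simpa [mapAtom, Function.comp_def, List.flatMap_map] using h3
    · simpa using h4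

theorem mem_of_listsOk {N V : ℕ} {L : List (List ℕ)} (h : listsOk N V L = true) {l : List ℕ}
    (hl : l.length = V) (hN : ∀ x ∈ l, x < N) : l ∈ L := by
  simp only [listsOk, Bool.and_eq_true, List.all_eq_true, decide_eq_true_eq,
    Bool.or_eq_true, List.mem_range] at h
  have key : ∀ l : List ℕ, l.length ≤ V → (∀ x ∈ l, x < N) → l ∈ L := by
    intro l
    induction l using List.reverseRecOn with
    | nil => exact fun _ _ => h.1
    | append_singleton l d ih =>
      intro h1 h2
      simp only [List.length_append, List.length_singleton] at h1
      have h3 := ih (by omega) fun x hx => h2 x (List.mem_append_left _ hx)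
      exact (h.2 l h3).resolve_left (by omega) d (h2 d (by simp))
  exact key l hl.le hN

/-- Closure of `C` under the rules, in the form that the check verifies. -/
structure IsClosed (T : List Rule) (V : ℕ) (C : List (Atom ℕ)) (L : List (List ℕ))
    (inst : List (Rule × List ℕ)) : Prop where
  bound : ∀ r ∈ T, ∀ x ∈ termsOf r.1, x < V
  closed : ∀ r ∈ T, ∀ l ∈ L, l.length = V → (∀ b ∈ r.1, mapAtom (ap l) b ∈ C) →
    ∃ i ∈ inst, i.1 = r ∧ (∀ x ∈ termsOf r.1, ap i.2 x = ap l x) ∧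
      ∀ h ∈ r.2.1, mapAtom (ap i.2) h ∈ C

theorem closedOk_iff {T : List Rule} {V : ℕ} {C : List (Atom ℕ)} {L : List (List ℕ)}
    {inst : List (Rule × List ℕ)} :
    closedOk T V C L inst = true ↔ IsClosed T V C L inst := by
  simp only [closedOk, Bool.and_eq_true, List.all_eq_true, List.any_eq_true, decide_eq_true_eq,
    Bool.or_eq_true, Bool.not_eq_true', Bool.and_eq_false_iff, decide_eq_false_iff_not]
  constructor
  · rintro ⟨h1, h2⟩
    refine ⟨h1, fun r hr l hl hlen hb => ?_⟩
    rcases h2 r hr l hl with (h | h) | ⟨i, hi, ⟨h3, h4⟩, h5⟩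
    · exact absurd hlen h
    · rw [← Bool.not_eq_true, List.all_eq_true] at h
      exact absurd (fun b hb' => decide_eq_true (hb b hb')) h
    · exact ⟨i, hi, h3, h4, h5⟩
  · rintro ⟨h1, h2⟩
    refine ⟨h1, fun r hr l hl => ?_⟩
    by_cases hlen : l.length = V
    · by_cases hb : ∀ b ∈ r.1, mapAtom (ap l) b ∈ C
      · obtain ⟨i, hi, h3, h4, h5⟩ := h2 r hr l hl hlen hb
        exact Or.inr ⟨i, hi, ⟨h3, h4⟩, h5⟩
      · refine Or.inl (Or.inr ?_)
        rw [← Bool.not_eq_true, List.all_eq_true]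
        exact fun h => hb fun b hb' => of_decide_eq_true (h b hb')
    · exact Or.inl (Or.inl hlen)

theorem ap_map_range {V x : ℕ} (f : ℕ → ℕ) (hx : x < V) : ap ((List.range V).map f) x = f x := by
  simp [ap, hx]

/-- The untyped instance of a model of the typed program satisfies the rules. -/
theorem holds_untypedInstance {T : List Rule} {m V : ℕ} {Tab : List Shape} {C : List (Atom ℕ)}
    {L : List (List ℕ)} {inst : List (Rule × List ℕ)} {A : List Pred} {M : Instance}
    (hinst : ∀ i ∈ inst, IsInst T m Tab A i) (hcl : IsClosed T V C L inst)
    (hL : listsOk Tab.length V L = true) (hC : ∀ a ∈ C, ∀ c ∈ a.2, c < Tab.length)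
    (hw : width Tab 0 = 1)
    (hM : ∀ i ∈ inst, Holds M (typedRule m Tab i).1 (typedRule m Tab i).2) :
    ∀ r ∈ T, Holds (untypedInstance m Tab C M) r.1 r.2.1 := by
  classical
  intro r hr ϑ hϑ
  have h0 : 0 < Tab.length := by
    rcases Tab with _ | ⟨t, Tab⟩
    · simp [width, shape] at hw
    · simp
  have hdec : ∀ x, ∃ p : ℕ × List ℕ, (x ∈ termsOf r.1 → ϑ x = Encodable.encode p) ∧
      (x ∉ termsOf r.1 → p.1 = 0) := by
    intro x
    by_cases hx : x ∈ termsOf r.1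
    · obtain ⟨b, hb, hxb⟩ := mem_termsOf.1 hx
      obtain ⟨l, hl, -⟩ := hϑ b hb
      have : ϑ x ∈ l.map Encodable.encode := hl ▸ List.mem_map_of_mem hxb
      obtain ⟨p, -, hp⟩ := List.mem_map.1 this
      exact ⟨p, fun _ => hp.symm, fun h => absurd hx h⟩
    · exact ⟨(0, []), fun h => absurd h hx, fun _ => rfl⟩
  choose p hp1 hp2 using hdec
  have hbody : ∀ b ∈ r.1, mapAtom (fun x => (p x).1) b ∈ C ∧
      (name m b.1 (b.2.map fun x => (p x).1), b.2.flatMap fun x => (p x).2) ∈ M ∧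
      ∀ x ∈ b.2, (p x).2.length = width Tab (p x).1 := by
    intro b hb
    refine mem_untypedInstance.1 ?_
    rw [mapAtom_congr (g := ϑ) fun x hx => (hp1 x (mem_termsOf.2 ⟨b, hb, hx⟩)).symm]
    exact hϑ b hb
  have hap : ∀ x ∈ termsOf r.1, ap ((List.range V).map fun x => (p x).1) x = (p x).1 :=
    fun x hx => ap_map_range _ (hcl.bound r hr x hx)
  have hlt : ∀ x, (p x).1 < Tab.length := by
    intro x
    by_cases hx : x ∈ termsOf r.1
    · obtain ⟨b, hb, hxb⟩ := mem_termsOf.1 hx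
      exact hC _ (hbody b hb).1 _ (List.mem_map_of_mem hxb)
    · rw [hp2 x hx]; exact h0
  obtain ⟨i, hi, rfl, hi1, hi2⟩ := hcl.closed r hr ((List.range V).map fun x => (p x).1)
    (mem_of_listsOk hL (by simp) (by simpa using fun x _ => hlt x)) (by simp) fun b hb => by
      rw [mapAtom_congr fun x hx => hap x (mem_termsOf.2 ⟨b, hb, hx⟩)]
      exact (hbody b hb).1
  have hθ : ∀ x ∈ termsOf i.1.1, ap i.2 x = (p x).1 := fun x hx => (hi1 x hx).trans (hap x hx)
  have hI := hinst i hi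
  -- `σ` maps the `j`-th variable of the block of `x` to the `j`-th leaf of the value of `x`.
  let σ : ℕ → ℕ := fun v => (p v.unpair.1).2.getD v.unpair.2 0
  have hσ : ∀ x ∈ termsOf i.1.1, (block Tab i.2 x).map σ = (p x).2 := by
    intro x hx
    obtain ⟨b, hb, hxb⟩ := mem_termsOf.1 hx
    have hlen := (hbody b hb).2.2 x hxb
    rw [← hθ x hx] at hlen
    refine List.ext_getElem (by simp [length_block, hlen]) fun j hj hj' => ?_
    simp [block, σ, List.getElem?_eq_getElem hj']
  obtain ⟨σ', h1, h2⟩ := hM i hi σ fun a ha => by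
    obtain ⟨b, hb, rfl⟩ := List.mem_map.1 ha
    have hb' : ∀ x ∈ b.2, x ∈ termsOf i.1.1 := fun x hx => mem_termsOf.2 ⟨b, hb, hx⟩
    have h3 := (hbody b hb).2.1
    simp only [mapAtom, List.map_flatMap]
    rwa [List.map_congr_left fun x hx => hθ x (hb' x hx),
      List.flatMap_congr fun x hx => hσ x (hb' x hx)]
  have hX : ∀ x ∈ i.1.2.2, Encodable.encode (ap i.2 x, (headBlock Tab i.2 i.1.2.2 x).map σ) =
      ϑ x := by
    intro x hx
    have hx' := hI.frontier_sub x hx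
    rw [headBlock, if_pos hx, hσ x hx', hθ x hx', hp1 x hx']
  refine ⟨fun x => Encodable.encode (ap i.2 x, (headBlock Tab i.2 i.1.2.2 x).map σ),
    fun x hx hx' => ?_, fun a ha => ?_⟩
  · refine hX x ?_
    by_contra hn
    exact (hI.head x hx' hn).1 hx
  · have ha' : ∀ x ∈ a.2, x ∈ termsOf i.1.2.1 := fun x hx => mem_termsOf.2 ⟨a, ha, hx⟩
    refine mem_untypedInstance.2 ⟨hi2 a ha, ?_, fun x hx => ?_⟩
    · have h3 := h2 _ (List.mem_map_of_mem ha)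
      rw [mapAtom_congr (g := σ) fun v hv => by
        have hv' : v ∈ termsOf (typedRule m Tab i).2 :=
          mem_termsOf.2 ⟨_, List.mem_map_of_mem ha, hv⟩
        exact h1 v (hI.datalog hv') hv'] at h3
      simpa only [mapAtom, List.map_flatMap] using h3
    · rw [List.length_map, hI.length_headBlock (ha' x hx)]

/-! ### Soundness of the check -/

/-- The conditions on the predicates `ps`, the name bound `m`, and the auxiliary predicates `A`. -/
structure PredsSpec (P : List (List (Atom ℕ) × List (Atom ℕ))) (ps : List Pred) (m : ℕ)
    (C : List (Atom ℕ)) (A : List Pred) : Prop where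
  covers : CoversPreds P ps
  lt : ∀ p ∈ ps, p.1 < m
  critical : ∀ p ∈ ps, (p.1 + 2, (List.range p.2).map fun _ => 0) ∈ C
  copy_mem : ∀ p ∈ ps, (name m (p.1 + 2) ((List.range p.2).map fun _ => 0), p.2) ∈ A
  le : ∀ p ∈ A, m ≤ p.1
  goal : (name m 1 [], 0) ∈ A

theorem predsOk_iff {P : List (List (Atom ℕ) × List (Atom ℕ))} {ps : List Pred} {m : ℕ}
    {C : List (Atom ℕ)} {A : List Pred} :
    predsOk P ps m C A = true ↔ PredsSpec P ps m C A := by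
  simp only [predsOk, Bool.and_eq_true, List.all_eq_true, decide_eq_true_eq,
    Bool.or_eq_true]
  constructor
  · rintro ⟨⟨⟨h1, h2⟩, h3⟩, h4⟩
    exact ⟨h1, fun p hp => (h2 p hp).1.1, fun p hp => (h2 p hp).1.2, fun p hp => (h2 p hp).2,
      h3, h4⟩
  · rintro ⟨h1, h2, h3, h4, h5, h6⟩
    exact ⟨⟨⟨h1, fun p hp => ⟨⟨h2 p hp, h3 p hp⟩, h4 p hp⟩⟩, h5⟩, h6⟩

/-- The conditions that the check verifies. -/
structure ChkSpec (P : List (List (Atom ℕ) × List (Atom ℕ))) (ps : List Pred) (m : ℕ)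
    (W : List Split) (V : ℕ) (Tab : List Shape) (C : List (Atom ℕ)) (L : List (List ℕ))
    (inst : List (Rule × List ℕ)) (A : List Pred) : Prop where
  split : ∀ p ∈ P, ∃ w ∈ W, IsSplit p w
  of_split : ∀ w ∈ W, ∃ p ∈ P, IsSplit p w
  insts : ∀ i ∈ inst, IsInst (rules ps W) m Tab A i
  shapes : ∀ a ∈ C, ∀ c ∈ a.2, c < Tab.length
  lists : listsOk Tab.length V L = true
  closed : IsClosed (rules ps W) V C L inst
  preds : PredsSpec P ps m C A
  width_zero : width Tab 0 = 1

theorem chkAux_iff {P : List (List (Atom ℕ) × List (Atom ℕ))} {ps : List Pred} {m : ℕ}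
    {W : List Split} {V : ℕ} {Tab : List Shape} {C : List (Atom ℕ)} {L : List (List ℕ)}
    {inst : List (Rule × List ℕ)} {A : List Pred} :
    chkAux P ps m W V Tab C L inst A = true ↔ ChkSpec P ps m W V Tab C L inst A := by
  simp only [chkAux, Bool.and_eq_true, List.all_eq_true, List.any_eq_true, decide_eq_true_eq,
    splitOk_iff, instOk_iff, closedOk_iff, predsOk_iff]
  constructor
  · rintro ⟨⟨⟨⟨⟨⟨⟨h1, h2⟩, h3⟩, h4⟩, h5⟩, h6⟩, h7⟩, h8⟩
    exact ⟨h1, h2, h3, h4, h5, h6, h7, h8⟩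
  · rintro ⟨h1, h2, h3, h4, h5, h6, h7, h8⟩
    exact ⟨⟨⟨⟨⟨⟨⟨h1, h2⟩, h3⟩, h4⟩, h5⟩, h6⟩, h7⟩, h8⟩

theorem two_le_of_mem_pre {s : List DepCode} {q : List (List (Atom ℕ))} :
    ∀ p ∈ pre s q, ∀ a ∈ p.1, 2 ≤ a.1 := by
  have htag : ∀ as : List (Atom ℕ), ∀ a ∈ tag as, 2 ≤ a.1 := fun as => forall_tag.2 fun _ _ =>
    Nat.le_add_left _ _
  intro p hp
  rcases List.mem_append.1 hp with hp | hp
  · obtain ⟨c | c, -, rfl⟩ := List.mem_map.1 hp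
    · exact htag _
    · exact htag _
  · obtain ⟨Q, -, rfl⟩ := List.mem_map.1 hp
    exact htag _

theorem mem_ps_of_predsOfDeps {s : List DepCode} {q : List (List (Atom ℕ))} {ps : List Pred}
    (hps : CoversPreds (pre s q) ps) {p : Pred} (hp : p ∈ predsOfDeps (depsOf s)) : p ∈ ps := by
  simp only [predsOfDeps, Set.mem_iUnion] at hp
  obtain ⟨_, ⟨c, hc, rfl⟩, hp⟩ := hp
  have hc' := preDep_mem_pre (q := q) hc
  have key : ∀ as : List (Atom ℕ), (∀ a ∈ tag as, a ∈ (preDep c).1 ++ (preDep c).2) →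
      p ∈ predsOf (as.toFinset : Set (Atom ℕ)) → p ∈ ps := by
    rintro as has ⟨a, ha, rfl⟩
    exact hps.of_mem hc' (has _ (List.mem_map_of_mem (by simpa using ha)))
  rcases c with c | c
  · rcases hp with hp | hp
    · exact key c.1 (fun a ha => List.mem_append_left _ ha) hp
    · exact key c.2 (fun a ha => List.mem_append_right _ ha) hp
  · exact key c.1 (fun a ha => List.mem_append_left _ ha) hp

theorem mem_ps_of_query {s : List DepCode} {q : List (List (Atom ℕ))} {ps : List Pred}
    (hps : CoversPreds (pre s q) ps) {p : Pred} {Q : Instance} (hQ : Q ∈ instancesOf q)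
    (hp : p ∈ predsOf Q) : p ∈ ps := by
  obtain ⟨l, hl, rfl⟩ := hQ
  obtain ⟨a, ha, rfl⟩ := hp
  exact hps.of_mem (preQuery_mem_pre (s := s) hl)
    (List.mem_append_left _ (List.mem_map_of_mem (f := fun a : Atom ℕ => (a.1 + 2, a.2)) ha))

/-- The Datalog program described by a certificate. -/
def program (m : ℕ) (Tab : List Shape) (ps : List Pred) (inst : List (Rule × List ℕ)) :
    List TgdCode :=
  inst.map (fun i => typedRule m Tab i) ++ ps.map (fun p => copyRule m p)

theorem forall_sat_program {m : ℕ} {Tab : List Shape} {ps : List Pred}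
    {inst : List (Rule × List ℕ)} {M : Instance} :
    (∀ d ∈ Dependency.tgd '' {r | ∃ c ∈ program m Tab ps inst, TgdCode.decode c = r}, Sat M d) ↔
      (∀ i ∈ inst, Holds M (typedRule m Tab i).1 (typedRule m Tab i).2) ∧
        ∀ p ∈ ps, Holds M (copyRule m p).1 (copyRule m p).2 := by
  constructor
  · intro h
    refine ⟨fun i hi => sat_tgd_iff.1 (h _ ⟨_, ⟨_, ?_, rfl⟩, rfl⟩),
      fun p hp => sat_tgd_iff.1 (h _ ⟨_, ⟨_, ?_, rfl⟩, rfl⟩)⟩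
    · exact List.mem_append_left _ (List.mem_map_of_mem (f := fun i => typedRule m Tab i) hi)
    · exact List.mem_append_right _ (List.mem_map_of_mem (f := fun p => copyRule m p) hp)
  · rintro ⟨h1, h2⟩ _ ⟨_, ⟨c, hc, rfl⟩, rfl⟩
    refine sat_tgd_iff.2 ?_
    rcases List.mem_append.1 hc with hc | hc
    · obtain ⟨i, hi, rfl⟩ := List.mem_map.1 hc
      exact h1 i hi
    · obtain ⟨p, hp, rfl⟩ := List.mem_map.1 hc
      exact h2 p hp

section

variable {s : List DepCode} {q : List (List (Atom ℕ))} {ps : List Pred} {m : ℕ}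
  {W : List Split} {V : ℕ} {Tab : List Shape} {C : List (Atom ℕ)} {L : List (List ℕ)}
  {inst : List (Rule × List ℕ)} {A : List Pred}

/-- The goal is derived only if the query is certain. -/
theorem ChkSpec.certain_of_program (h : ChkSpec (pre s q) ps m W V Tab C L inst A) {D : Instance}
    (hD : ∀ p ∈ A, p ∉ predsOf D)
    (hc : Certain {D} (Dependency.tgd '' {r | ∃ c ∈ program m Tab ps inst, TgdCode.decode c = r})
      {{((name m 1 [], []) : Atom Var)}}) :
    Certain {D} (depsOf s) (instancesOf q) := by
  rintro M ⟨D, rfl, η, hη⟩ hM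
  have hK := holds_rules (ps := ps) h.of_split (K := internalize M (instancesOf q))
    (fun x y => ⟨eq_of_mem_internalize, fun h => Or.inr (Or.inl ⟨x, by rw [h]⟩)⟩)
    (holds_pre_internalize hM)
  obtain ⟨sk, hsk⟩ := exists_skolem (internalize M (instancesOf q))
  have hD' : rename η D ⊆ typedInstance m Tab A sk (internalize M (instancesOf q)) M := by
    refine rename_subset_iff.2 fun a ha => Or.inl ⟨rename_subset_iff.1 hη a ha, fun hA => ?_⟩
    rw [pred_mapAtom] at hA
    exact hD _ hA ⟨a, ha, rfl⟩
  obtain ⟨_, rfl, θ, hθ⟩ := hc _ ⟨_, rfl, η, hD'⟩ (forall_sat_program.2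
    ⟨fun i hi => (h.insts i hi).holds_typedRule hsk (hK _ (h.insts i hi).mem),
      fun p hp => holds_copyRule (h.preds.lt p hp) h.width_zero
        fun a ha => mem_internalize_rel.2 ha⟩)
  have hg := rename_subset_iff.1 hθ (name m 1 [], []) rfl
  have := of_typed_mem (X := []) (θ := id) (u := fun _ => []) (by simp) h.preds.goal hg
  exact goal_mem_internalize this

/-- The data is contained in the untyped instance. -/
theorem mem_untypedInstance_of_copyRule {M : Instance} {p : Pred} (hw : width Tab 0 = 1)
    (hC : (p.1 + 2, (List.range p.2).map fun _ => 0) ∈ C)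
    (hM : Holds M (copyRule m p).1 (copyRule m p).2) {a : Atom ℕ} (ha : a ∈ M)
    (hp : pred a = p) :
    mapAtom (fun x => Encodable.encode (0, [x])) (a.1 + 2, a.2) ∈ untypedInstance m Tab C M := by
  subst hp
  have hmap : (List.range a.2.length).map (fun _ => 0) = a.2.map fun _ => 0 := by
    rw [List.map_const', List.map_const', List.length_range]
  have hget : (List.range a.2.length).map (fun x => a.2.getD x 0) = a.2 := by
    refine List.ext_getElem (by simp) fun i hi hi' => ?_
    simp [List.getElem?_eq_getElem hi']
  obtain ⟨σ, h1, h2⟩ := hM (fun x => a.2.getD x 0) fun b hb => by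
    obtain rfl := List.mem_singleton.1 hb
    change (a.1, (List.range a.2.length).map fun x => a.2.getD x 0) ∈ M
    rwa [hget]
  have h3 := h2 _ List.mem_cons_self
  have hσ : (List.range a.2.length).map σ = a.2 := by
    conv_rhs => rw [← hget]
    refine List.map_congr_left fun x hx => h1 x ?_ ?_
    · simpa [copyRule, termsOf, pred] using hx
    · simpa [copyRule, termsOf, pred] using hx
  change (name m (a.1 + 2) ((List.range a.2.length).map fun _ => 0),
    (List.range a.2.length).map σ) ∈ M at h3
  rw [hσ, hmap] at h3
  refine mem_untypedInstance.2 ⟨?_, ?_, fun _ _ => hw.symm⟩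
  · simpa [mapAtom, hmap, pred] using hC
  · simpa [flatMap_singleton_eq_map] using h3

/-- If the query is certain, then the goal is derived. -/
theorem ChkSpec.program_of_certain (h : ChkSpec (pre s q) ps m W V Tab C L inst A)
    (hwf : ∀ d ∈ depsOf s, d.WellFormed) {D : Instance}
    (hc : Certain {D} (depsOf s) (instancesOf q)) :
    Certain {D} (Dependency.tgd '' {r | ∃ c ∈ program m Tab ps inst, TgdCode.decode c = r})
      {{((name m 1 [], []) : Atom Var)}} := by
  rintro M ⟨_, rfl, η, hη⟩ hM
  obtain ⟨hM1, hM2⟩ := forall_sat_program.1 hM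
  have hH := holds_untypedInstance h.insts h.closed h.lists h.shapes h.width_zero hM1
  obtain ⟨rep, hE, hP⟩ := exists_quotient h.split h.preds.covers two_le_of_mem_pre hH
  have hgoal := goal_of_externalize h.preds.covers hP
    (hc (externalize ps (rename rep (untypedInstance m Tab C M)))
      ⟨_, rfl, fun x => rep (Encodable.encode ((0 : ℕ), [η x])), ?_⟩
      (sat_externalize hwf h.preds.covers hE hP))
  · obtain ⟨⟨n, ts⟩, ⟨l, h1, h2, h3, h4⟩, h5⟩ := hgoal
    simp only [mapAtom, Prod.mk.injEq, List.map_eq_nil_iff] at h5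
    obtain ⟨rfl, rfl⟩ := h5
    obtain rfl := List.map_eq_nil_iff.1 h1.symm
    exact ⟨_, rfl, id, rename_subset_iff.2 fun b hb => by
      obtain rfl := Set.mem_singleton_iff.1 hb
      exact h3⟩
  · refine rename_subset_iff.2 fun a ha => ?_
    by_cases hp : pred a ∈ ps
    · have ha' := rename_subset_iff.1 hη a ha
      have := mem_untypedInstance_of_copyRule h.width_zero (h.preds.critical _ hp)
        (hM2 _ hp) ha' (pred_mapAtom η a)
      refine Or.inl ⟨_, this, ?_⟩
      simp [mapAtom]
    · exact Or.inr (by rwa [pred_mapAtom])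

theorem ChkSpec.isDatalogRewriting (h : ChkSpec (pre s q) ps m W V Tab C L inst A)
    (hwf : ∀ d ∈ depsOf s, d.WellFormed) :
    IsDatalogRewriting (depsOf s) (instancesOf q) {p | p ∈ A}
      {r | ∃ c ∈ program m Tab ps inst, TgdCode.decode c = r}
      {((name m 1 [], []) : Atom Var)} where
  fresh_deps p hp hp' := (h.preds.lt p (mem_ps_of_predsOfDeps h.preds.covers hp')).not_ge
    (h.preds.le p hp)
  fresh_query p hp Q hQ hp' := (h.preds.lt p (mem_ps_of_query h.preds.covers hQ hp')).not_ge
    (h.preds.le p hp)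
  finite := (List.finite_toSet ((program m Tab ps inst).map TgdCode.decode)).subset (by
    rintro _ ⟨c, hc, rfl⟩
    exact List.mem_map_of_mem hc)
  datalog := by
    rintro _ ⟨c, hc, rfl⟩ x hx
    refine mem_vars_toFinset.2 ?_
    replace hx := mem_vars_toFinset.1 hx
    rcases List.mem_append.1 hc with hc | hc
    · obtain ⟨i, hi, rfl⟩ := List.mem_map.1 hc
      exact (h.insts i hi).datalog hx
    · obtain ⟨p, hp, rfl⟩ := List.mem_map.1 hc
      simpa [copyRule, termsOf] using hx
  goal := ⟨name m 1 [], h.preds.goal, rfl⟩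
  equiv D hD := ⟨h.program_of_certain hwf, h.certain_of_program hD⟩

end

/-- A certificate that passes the check describes a Datalog rewriting. -/
theorem isRewritingFor_out {s : List DepCode} {q : List (List (Atom ℕ))} {k : Cert}
    (h : chk (s, q) k = true) (hwf : ∀ d ∈ depsOf s, d.WellFormed) :
    (out k).IsRewritingFor (depsOf s) (instancesOf q) :=
  (chkAux_iff.1 h).isDatalogRewriting hwf

/-! ### Existence of splittings -/

theorem exists_forall_lt (l : List ℕ) : ∃ N, ∀ x ∈ l, x < N :=
  ⟨l.sum + 1, fun _ hx => Nat.lt_succ_of_le (List.single_le_sum (fun _ _ => Nat.zero_le _) _ hx)⟩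

/-- A splitting given by a function `σ` instead of a list of values. -/
theorem isSplit_of_fn {p : List (Atom ℕ) × List (Atom ℕ)} {R : List (Atom ℕ)}
    {eqs : List (ℕ × ℕ)} {H : List (Atom ℕ)} {X : List ℕ} {σ : ℕ → ℕ}
    (mapsTo : ∀ r ∈ R, mapAtom σ r ∈ p.1) (surj : ∀ b ∈ p.1, ∃ r ∈ R, mapAtom σ r = b)
    (linear : (termsOf R).Nodup) (linked : ∀ y ∈ termsOf R, σ y = y ∨ (σ y, y) ∈ eqs)
    (heqs : ∀ e ∈ eqs, e.1 ∈ termsOf R ∧ e.2 ∈ termsOf R ∧ σ e.1 = e.1 ∧ σ e.2 = e.1)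
    (head_fixed : ∀ v ∈ termsOf p.2, v ∈ termsOf R → σ v = v)
    (head_iff : ∀ h, h ∈ H ↔ h ∈ p.2) (frontier_sub : ∀ x ∈ X, x ∈ termsOf R)
    (sub_frontier : ∀ v ∈ termsOf H, v ∈ termsOf R → v ∈ X) :
    ∃ sg, IsSplit p (R, eqs, H, X, sg) := by
  obtain ⟨N, hN⟩ := exists_forall_lt (termsOf R)
  have hap : ∀ x ∈ termsOf R, ap ((List.range N).map σ) x = σ x := fun x hx =>
    ap_map_range _ (hN x hx)
  have hmap : ∀ r ∈ R, mapAtom (ap ((List.range N).map σ)) r = mapAtom σ r := fun r hr =>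
    mapAtom_congr fun x hx => hap x (mem_termsOf.2 ⟨r, hr, hx⟩)
  refine ⟨(List.range N).map σ, fun r hr => ?_, fun b hb => ?_, linear, fun y hy => ?_,
    fun e he => ?_, fun v hv hv' => ?_, head_iff, frontier_sub, sub_frontier⟩
  · exact (hmap r hr).symm ▸ mapsTo r hr
  · obtain ⟨r, hr, h⟩ := surj b hb
    exact ⟨r, hr, (hmap r hr).trans h⟩
  · simp only [hap y hy]
    exact linked y hy
  · obtain ⟨h1, h2, h3, h4⟩ := heqs e he
    exact ⟨h1, h2, (hap _ h1).trans h3, (hap _ h2).trans h4⟩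
  · exact (hap v hv').trans (head_fixed v hv hv')

/-- The occurrences in a list can be made distinct, the first occurrence (from the right) of each
variable keeping its name. -/
theorem exists_linearization (m : ℕ) (O : List ℕ) (hO : ∀ x ∈ O, x < m) :
    ∃ (O' : List ℕ) (σ : ℕ → ℕ), O'.map σ = O ∧ O'.Nodup ∧ (∀ y ∈ O', y < m → σ y = y) ∧
      ∀ y ∈ O', σ y ∈ O' ∧ σ (σ y) = σ y := by
  induction O with
  | nil => exact ⟨[], id, by simp⟩
  | cons x O ih =>
    obtain ⟨O', σ, h1, h2, h3, h4⟩ := ih fun y hy => hO y (List.mem_cons_of_mem _ hy)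
    have hupd : ∀ z, z ∉ O' → ∀ y ∈ O', Function.update σ z x y = σ y := fun z hz y hy =>
      Function.update_of_ne (ne_of_mem_of_not_mem hy hz) _ _
    have hmap : ∀ z, z ∉ O' → O'.map (Function.update σ z x) = O := fun z hz => by
      rw [List.map_congr_left (hupd z hz), h1]
    by_cases hx : x ∈ O'
    · obtain ⟨N, hN⟩ := exists_forall_lt (m :: O')
      have hz : N ∉ O' := fun h => lt_irrefl _ (hN N (List.mem_cons_of_mem _ h))
      have hxx : Function.update σ N x x = x := by
        rw [hupd N hz x hx, h3 x hx (hO x List.mem_cons_self)]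
      refine ⟨N :: O', Function.update σ N x, ?_, List.nodup_cons.2 ⟨hz, h2⟩, ?_, ?_⟩
      · rw [List.map_cons, hmap N hz, Function.update_self]
      · intro y hy hym
        rcases List.mem_cons.1 hy with rfl | hy
        · exact absurd (hN m List.mem_cons_self) hym.not_gt
        · rw [hupd N hz y hy, h3 y hy hym]
      · intro y hy
        rcases List.mem_cons.1 hy with rfl | hy
        · rw [Function.update_self]
          exact ⟨List.mem_cons_of_mem _ hx, hxx⟩
        · rw [hupd N hz y hy, hupd N hz _ (h4 y hy).1]
          exact ⟨List.mem_cons_of_mem _ (h4 y hy).1, (h4 y hy).2⟩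
    · refine ⟨x :: O', Function.update σ x x, ?_, List.nodup_cons.2 ⟨hx, h2⟩, ?_, ?_⟩
      · rw [List.map_cons, hmap x hx, Function.update_self]
      · intro y hy hym
        rcases List.mem_cons.1 hy with rfl | hy
        · rw [Function.update_self]
        · rw [hupd x hx y hy, h3 y hy hym]
      · intro y hy
        rcases List.mem_cons.1 hy with rfl | hy
        · simp
        · rw [hupd x hx y hy, hupd x hx _ (h4 y hy).1]
          exact ⟨List.mem_cons_of_mem _ (h4 y hy).1, (h4 y hy).2⟩

theorem exists_atoms_of_termsOf (B : List (Atom ℕ)) (σ : ℕ → ℕ) (O : List ℕ)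
    (h : O.map σ = termsOf B) :
    ∃ R : List (Atom ℕ), termsOf R = O ∧ R.map (mapAtom σ) = B := by
  induction B generalizing O with
  | nil => exact ⟨[], by simpa [termsOf, eq_comm] using h, rfl⟩
  | cons b B ih =>
    have h' : O.map σ = b.2 ++ termsOf B := by simpa [termsOf] using h
    obtain ⟨l₁, l₂, rfl, h1, h2⟩ := List.map_eq_append_iff.1 h'
    obtain ⟨R, h3, h4⟩ := ih l₂ h2
    exact ⟨(b.1, l₁) :: R, by simpa [termsOf] using h3, by simp [mapAtom, h1, ← h4]⟩

/-- A rule without variables in its head has a splitting. -/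
theorem exists_isSplit (p : List (Atom ℕ) × List (Atom ℕ)) (hp : termsOf p.2 = []) :
    ∃ w, IsSplit p w ∧ w.2.2.1 = p.2 ∧ w.2.2.2.1 = [] := by
  obtain ⟨m, hm⟩ := exists_forall_lt (termsOf p.1)
  obtain ⟨O, σ, h1, h2, -, h4⟩ := exists_linearization m (termsOf p.1) hm
  obtain ⟨R, rfl, h5⟩ := exists_atoms_of_termsOf p.1 σ O h1
  have hmem : ∀ r ∈ R, mapAtom σ r ∈ p.1 := fun r hr => h5 ▸ List.mem_map_of_mem hr
  obtain ⟨sg, h⟩ := isSplit_of_fn (p := p) (R := R)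
    (eqs := (termsOf R).map fun y => (σ y, y)) (H := p.2) (X := []) (σ := σ) hmem
    (fun b hb => List.mem_map.1 (h5 ▸ hb)) h2
    (fun y hy => Or.inr (List.mem_map_of_mem hy))
    (fun e he => by
      obtain ⟨y, hy, rfl⟩ := List.mem_map.1 he
      exact ⟨(h4 y hy).1, hy, (h4 y hy).2, rfl⟩)
    (fun v hv => by simp [hp] at hv) (fun _ => Iff.rfl) (fun x hx => by simp at hx)
    (fun v hv => by simp [hp] at hv)
  exact ⟨_, h, rfl, rfl⟩

/-! ### Invariants of the splitting process -/

/-- The invariants of the splitting process that leads from `B₀` to `B`; `σ` maps every variable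
to the variable of `B₀` of which it is a copy. -/
structure SplitInv (e : ℕ) (V : Finset Var) (B₀ B : Finset (Atom Var)) (σ : Var → Var) :
    Prop where
  mapsTo : ∀ a ∈ B, pred a ≠ (e, 2) → mapAtom σ a ∈ B₀
  surj : ∀ b ∈ B₀, ∃ a ∈ B, pred a ≠ (e, 2) ∧ mapAtom σ a = b
  eqs : ∀ a ∈ B, pred a = (e, 2) → ∃ x y, a = (e, [x, y]) ∧ σ x = x ∧ σ y = x ∧
    (∃ o, OccursAt e B x o) ∧ ∃ o, OccursAt e B y o
  linked : ∀ y o, OccursAt e B y o → σ y = y ∨ (e, [σ y, y]) ∈ B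
  unique : ∀ y, σ y ≠ y → ∀ o o', OccursAt e B y o → OccursAt e B y o' → o = o'
  fixed : ∀ v ∈ V, σ v = v

theorem OccursAt.mem_vars {e : ℕ} {B : Finset (Atom Var)} {x : Var} {o : Atom Var × ℕ}
    (h : OccursAt e B x o) : x ∈ vars B :=
  DatalogRew.mem_vars.2 ⟨o.1, h.1, List.mem_of_getElem? h.2.2⟩

theorem SplitInv.refl {e : ℕ} {V : Finset Var} {B : Finset (Atom Var)}
    (hB : ∀ a ∈ B, pred a ≠ (e, 2)) : SplitInv e V B B id where
  mapsTo a ha _ := by simpa [mapAtom] using ha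
  surj b hb := ⟨b, hb, hB b hb, by simp [mapAtom]⟩
  eqs a ha h := absurd h (hB a ha)
  linked _ _ _ := Or.inl rfl
  unique _ h := absurd rfl h
  fixed _ _ := rfl

theorem SplitInv.step {e : ℕ} {V : Finset Var} {B₀ B B' : Finset (Atom Var)} {σ : Var → Var}
    (h : SplitInv e V B₀ B σ) (hs : SplitStep e V B B') : ∃ σ', SplitInv e V B₀ B' σ' := by
  obtain ⟨x, x', a, i, hocc, ⟨o₁, ho₁, hocc₁⟩, hB, hV, rfl⟩ := hs
  obtain ⟨haB, hapred, hai⟩ := id hocc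
  dsimp only at haB hapred hai
  have hσx : σ x = x := by
    by_contra hne
    exact ho₁ (h.unique x hne _ _ hocc₁ hocc)
  have hxx' : x ≠ x' := fun hx => hB (hx ▸ hocc.mem_vars)
  set a' : Atom Var := (a.1, a.2.set i x') with ha'
  have hpred' : pred a' = pred a := by simp [pred, ha']
  have hnotmem : ∀ b ∈ B, x' ∉ b.2 := fun b hb hx => hB (mem_vars.2 ⟨b, hb, hx⟩)
  have hilt : i < a.2.length := (List.getElem?_eq_some_iff.1 hai).1
  have hxa' : x' ∈ a'.2 := List.mem_set hilt x'
  have hne' : ∀ b ∈ B, b ≠ a' := fun b hb hba => hnotmem b hb (hba ▸ hxa')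
  set σ' : Var → Var := Function.update σ x' x with hσ'
  have hσne : ∀ y, y ≠ x' → σ' y = σ y := fun y hy => Function.update_of_ne hy _ _
  have hσself : σ' x' = x := Function.update_self _ _ _
  have hmapold : ∀ b ∈ B, mapAtom σ' b = mapAtom σ b := fun b hb =>
    mapAtom_congr fun y hy => hσne y fun hyx => hnotmem b hb (hyx ▸ hy)
  have hmapnew : mapAtom σ' a' = mapAtom σ a := by
    rw [← hmapold a haB]
    simp only [mapAtom, ha', List.map_set, hσself, Prod.mk.injEq, true_and]
    refine List.ext_getElem? fun j => ?_
    by_cases hj : i = j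
    · subst hj
      rw [List.getElem?_set_self (by simpa using hilt), List.getElem?_map, hai, Option.map_some,
        hσne x hxx', hσx]
    · rw [List.getElem?_set_ne hj]
  have hmem : ∀ b, b ∈ insert (e, [x, x']) (insert a' (B.erase a)) ↔
      b = (e, [x, x']) ∨ b = a' ∨ b ≠ a ∧ b ∈ B := fun b => by
    simp only [Finset.mem_insert, Finset.mem_erase]
  set B' := insert (e, [x, x']) (insert a' (B.erase a)) with hB'
  have hpredE : pred ((e, [x, x']) : Atom Var) = (e, 2) := rfl
  -- Occurrences of an old variable in the new body come from occurrences in the old body.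
  have hpull : ∀ y o, y ≠ x' → OccursAt e B' y o → OccursAt e B y
      (if o.1 = a' then (a, o.2) else o) := by
    rintro y ⟨b, j⟩ hy ⟨h1, h2, h3⟩
    dsimp only at h1 h2 h3 ⊢
    rcases (hmem b).1 h1 with rfl | rfl | ⟨h4, h5⟩
    · exact absurd hpredE h2
    · rw [if_pos rfl]
      refine ⟨haB, hapred, ?_⟩
      have hij : i ≠ j := fun hij => by
        subst hij
        rw [ha', List.getElem?_set_self hilt] at h3
        exact hy (Option.some.inj h3).symm
      rw [ha', List.getElem?_set_ne hij] at h3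
      exact h3
    · rw [if_neg (hne' b h5)]
      exact ⟨h5, h2, h3⟩
  have hnew : ∀ o, OccursAt e B' x' o → o = (a', i) := by
    rintro ⟨b, j⟩ ⟨h1, h2, h3⟩
    dsimp only at h1 h2 h3
    rcases (hmem b).1 h1 with rfl | rfl | ⟨h4, h5⟩
    · exact absurd hpredE h2
    · by_contra hij
      have hij : i ≠ j := fun hij' => hij (by rw [hij'])
      rw [ha', List.getElem?_set_ne hij] at h3
      exact hnotmem a haB (List.mem_of_getElem? h3)
    · exact absurd (List.mem_of_getElem? h3) (hnotmem b h5)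
  have hpush : ∀ y o, o ≠ (a, i) → OccursAt e B y o → ∃ o', OccursAt e B' y o' := by
    rintro y ⟨b, j⟩ hne ⟨h1, h2, h3⟩
    dsimp only at h1 h2 h3
    by_cases hba : b = a
    · subst hba
      have hij : i ≠ j := fun hij => hne (by rw [hij])
      refine ⟨(a', j), (hmem a').2 (Or.inr (Or.inl rfl)), hpred' ▸ hapred, ?_⟩
      rw [ha', List.getElem?_set_ne hij]
      exact h3
    · exact ⟨(b, j), (hmem b).2 (Or.inr (Or.inr ⟨hba, h1⟩)), h2, h3⟩
  have hxnew : ∃ o, OccursAt e B' x o := hpush x o₁ ho₁ hocc₁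
  have hkeep : ∀ y, (∃ o, OccursAt e B y o) → ∃ o, OccursAt e B' y o := by
    rintro y ⟨o, ho⟩
    by_cases hoa : o = (a, i)
    · subst hoa
      obtain rfl : x = y := Option.some.inj (hai.symm.trans ho.2.2)
      exact hxnew
    · exact hpush y o hoa ho
  have hx'new : OccursAt e B' x' (a', i) :=
    ⟨(hmem a').2 (Or.inr (Or.inl rfl)), hpred' ▸ hapred, List.getElem?_set_self hilt⟩
  have hEkeep : ∀ b ∈ B, pred b = (e, 2) → b ∈ B' := fun b hb hbe =>
    (hmem b).2 (Or.inr (Or.inr ⟨fun hba => hapred (hba ▸ hbe), hb⟩))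
  refine ⟨σ', fun b hb hbp => ?_, fun b hb => ?_, fun b hb hbp => ?_, fun y o ho => ?_,
    fun y hy o o' ho ho' => ?_, fun v hv => ?_⟩
  · rcases (hmem b).1 hb with rfl | rfl | ⟨h4, h5⟩
    · exact absurd hpredE hbp
    · rw [hmapnew]
      exact h.mapsTo a haB hapred
    · rw [hmapold b h5]
      exact h.mapsTo b h5 hbp
  · obtain ⟨b', h1, h2, rfl⟩ := h.surj b hb
    by_cases hba : b' = a
    · subst hba
      exact ⟨a', (hmem a').2 (Or.inr (Or.inl rfl)), hpred' ▸ hapred, hmapnew⟩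
    · exact ⟨b', (hmem b').2 (Or.inr (Or.inr ⟨hba, h1⟩)), h2, hmapold b' h1⟩
  · rcases (hmem b).1 hb with rfl | rfl | ⟨h4, h5⟩
    · exact ⟨x, x', rfl, by rw [hσne x hxx', hσx], hσself, hxnew, _, hx'new⟩
    · exact absurd (hpred' ▸ hbp) hapred
    · obtain ⟨y, z, h6, h7, h8, h9, h10⟩ := h.eqs b h5 hbp
      have hy : y ≠ x' := fun hyx => hB (hyx ▸ h9.choose_spec.mem_vars)
      have hz : z ≠ x' := fun hzx => hB (hzx ▸ h10.choose_spec.mem_vars)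
      exact ⟨y, z, h6, by rw [hσne y hy, h7], by rw [hσne z hz, h8], hkeep y h9, hkeep z h10⟩
  · by_cases hy : y = x'
    · subst hy
      rw [hσself]
      exact Or.inr ((hmem _).2 (Or.inl rfl))
    · rw [hσne y hy]
      exact (h.linked y _ (hpull y o hy ho)).imp_right fun h1 => hEkeep _ h1 rfl
  · by_cases hyx : y = x'
    · subst hyx
      rw [hnew o ho, hnew o' ho']
    · rw [hσne y hyx] at hy
      have h1 := h.unique y hy _ _ (hpull y o hyx ho) (hpull y o' hyx ho')
      have h2 : ∀ o, OccursAt e B' y o → o.1 ≠ a' → o.1 ≠ a := by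
        rintro o ⟨h1, h2, -⟩ h3
        rcases (hmem o.1).1 h1 with h4 | h4 | h4
        · rw [h4] at h2
          exact absurd hpredE h2
        · exact absurd h4 h3
        · exact h4.1
      split_ifs at h1 with h3 h4 h4
      · exact Prod.ext (h3.trans h4.symm) (Prod.ext_iff.1 h1).2
      · exact absurd (Prod.ext_iff.1 h1).1.symm (h2 o' ho' h4)
      · exact absurd (Prod.ext_iff.1 h1).1 (h2 o ho h3)
      · exact h1
  · rw [hσne v fun hvx => hV (hvx ▸ hv)]
    exact h.fixed v hv

theorem SplitInv.of_reflTransGen {e : ℕ} {V : Finset Var} {B₀ B : Finset (Atom Var)}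
    (hB₀ : ∀ a ∈ B₀, pred a ≠ (e, 2)) (h : Relation.ReflTransGen (SplitStep e V) B₀ B) :
    ∃ σ, SplitInv e V B₀ B σ := by
  induction h with
  | refl => exact ⟨id, SplitInv.refl hB₀⟩
  | tail _ hs ih =>
    obtain ⟨σ, hσ⟩ := ih
    exact hσ.step hs

theorem SplitInv.of_splitsTo {e : ℕ} {V : Finset Var} {B₀ B : Finset (Atom Var)}
    (hB₀ : ∀ a ∈ B₀, pred a ≠ (e, 2)) (h : SplitsTo e V B₀ B) :
    (∃ σ, SplitInv e V B₀ B σ) ∧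
      ∀ x o o', OccursAt e B x o → OccursAt e B x o' → o = o' := by
  refine ⟨SplitInv.of_reflTransGen hB₀ h.1, ?_⟩
  intro x o o' ho ho'
  by_contra hne
  obtain ⟨x', hx'⟩ := Infinite.exists_notMem_finset (vars B ∪ V)
  rw [Finset.mem_union, not_or] at hx'
  exact h.2 ⟨_, x, x', o'.1, o'.2, ho', ⟨o, hne, ho⟩, hx'.1, hx'.2, rfl⟩

/-! ### The internal form of a substitution-free simulation -/

/-- The internal form of an atom of a simulation with equality predicate `(e, 2)`. -/
def tagE {τ : Type} (e : ℕ) (a : Atom τ) : Atom τ :=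
  if pred a = (e, 2) then (0, a.2) else (a.1 + 2, a.2)

/-- The internal form of a tgd of a simulation with equality predicate `(e, 2)`. -/
noncomputable def ruleOf (e : ℕ) (r : Tgd) : Rule :=
  ((r.body.filter fun a => pred a ≠ (e, 2)).toList.map (tagE e) ++
      (r.body.filter fun a => pred a = (e, 2)).toList.map (tagE e),
    r.head.toList.map (tagE e), r.frontier.toList)

theorem tagE_snd {τ : Type} (e : ℕ) (a : Atom τ) : (tagE e a).2 = a.2 := by
  unfold tagE; split_ifs <;> rfl

theorem mem_ruleOf_body {e : ℕ} {r : Tgd} {a : Atom ℕ} :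
    a ∈ (ruleOf e r).1 ↔ ∃ b ∈ r.body, tagE e b = a := by
  simp only [ruleOf, List.mem_append, List.mem_map, Finset.mem_toList, Finset.mem_filter]
  constructor
  · rintro (⟨b, ⟨h1, -⟩, h2⟩ | ⟨b, ⟨h1, -⟩, h2⟩) <;> exact ⟨b, h1, h2⟩
  · rintro ⟨b, h1, h2⟩
    by_cases h3 : pred b = (e, 2)
    · exact Or.inr ⟨b, ⟨h1, h3⟩, h2⟩
    · exact Or.inl ⟨b, ⟨h1, h3⟩, h2⟩

theorem mem_ruleOf_head {e : ℕ} {r : Tgd} {a : Atom ℕ} :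
    a ∈ (ruleOf e r).2.1 ↔ ∃ b ∈ r.head, tagE e b = a := by
  simp only [ruleOf, List.mem_map, Finset.mem_toList]

theorem mem_termsOf_ruleOf_body {e : ℕ} {r : Tgd} {x : ℕ} :
    x ∈ termsOf (ruleOf e r).1 ↔ x ∈ vars r.body := by
  simp only [mem_termsOf, mem_ruleOf_body, mem_vars]
  constructor
  · rintro ⟨_, ⟨b, hb, rfl⟩, hx⟩
    exact ⟨b, hb, tagE_snd e b ▸ hx⟩
  · rintro ⟨b, hb, hx⟩
    exact ⟨_, ⟨b, hb, rfl⟩, (tagE_snd e b).symm ▸ hx⟩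

theorem mem_termsOf_ruleOf_head {e : ℕ} {r : Tgd} {x : ℕ} :
    x ∈ termsOf (ruleOf e r).2.1 ↔ x ∈ vars r.head := by
  simp only [mem_termsOf, mem_ruleOf_head, mem_vars]
  constructor
  · rintro ⟨_, ⟨b, hb, rfl⟩, hx⟩
    exact ⟨b, hb, tagE_snd e b ▸ hx⟩
  · rintro ⟨b, hb, hx⟩
    exact ⟨_, ⟨b, hb, rfl⟩, (tagE_snd e b).symm ▸ hx⟩

/-- The result of the splitting process is a splitting in the internal sense. -/
theorem exists_isSplit_of_splitsTo {e : ℕ} {V : Finset Var} {B₀ : Finset (Atom Var)} {r : Tgd}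
    (hB₀ : ∀ a ∈ B₀, pred a ≠ (e, 2)) (h : SplitsTo e V B₀ r.body)
    {p : List (Atom ℕ) × List (Atom ℕ)} (hp1 : ∀ a, a ∈ p.1 ↔ ∃ b ∈ B₀, (b.1 + 2, b.2) = a)
    (hp2 : ∀ a, a ∈ (ruleOf e r).2.1 ↔ a ∈ p.2) (hV : ∀ v ∈ termsOf p.2, v ∈ V) :
    ∃ w, IsSplit p w ∧ toRule w = ruleOf e r := by
  obtain ⟨⟨σ, hσ⟩, huniq⟩ := SplitInv.of_splitsTo hB₀ h
  have hmem : ∀ a, a ∈ (r.body.filter fun a => pred a ≠ (e, 2)).toList.map (tagE e) ↔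
      ∃ b ∈ r.body, pred b ≠ (e, 2) ∧ (b.1 + 2, b.2) = a := by
    intro a
    simp only [List.mem_map, Finset.mem_toList, Finset.mem_filter, and_assoc]
    refine exists_congr fun b => and_congr_right fun _ => and_congr_right fun hb => ?_
    rw [tagE, if_neg hb]
  have hterms : ∀ x, x ∈ termsOf ((r.body.filter fun a => pred a ≠ (e, 2)).toList.map (tagE e)) ↔
      ∃ o, OccursAt e r.body x o := by
    intro x
    simp only [mem_termsOf, hmem]
    constructor
    · rintro ⟨_, ⟨b, hb, hbp, rfl⟩, hx⟩
      obtain ⟨i, hi⟩ := List.mem_iff_getElem?.1 hx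
      exact ⟨(b, i), hb, hbp, hi⟩
    · rintro ⟨⟨b, i⟩, hb, hbp, hi⟩
      exact ⟨_, ⟨b, hb, hbp, rfl⟩, List.mem_of_getElem? hi⟩
  have hvars : ∀ x ∈ vars r.body, ∃ o, OccursAt e r.body x o := by
    intro x hx
    obtain ⟨b, hb, hxb⟩ := mem_vars.1 hx
    by_cases hbp : pred b = (e, 2)
    · obtain ⟨y, z, rfl, -, -, hy, hz⟩ := hσ.eqs b hb hbp
      have : x = y ∨ x = z := by simpa using hxb
      rcases this with rfl | rfl
      · exact hy
      · exact hz
    · obtain ⟨i, hi⟩ := List.mem_iff_getElem?.1 hxb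
      exact ⟨(b, i), hb, hbp, hi⟩
  obtain ⟨sg, hw⟩ := isSplit_of_fn (p := p)
    (R := (r.body.filter fun a => pred a ≠ (e, 2)).toList.map (tagE e))
    (eqs := (r.body.filter fun a => pred a = (e, 2)).toList.map
      fun a => (a.2.getD 0 0, a.2.getD 1 0))
    (H := (ruleOf e r).2.1) (X := (ruleOf e r).2.2) (σ := σ)
    (fun a ha => by
      obtain ⟨b, hb, hbp, rfl⟩ := (hmem a).1 ha
      exact (hp1 _).2 ⟨_, hσ.mapsTo b hb hbp, rfl⟩)
    (fun a ha => by
      obtain ⟨b, hb, rfl⟩ := (hp1 a).1 ha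
      obtain ⟨c, hc, hcp, rfl⟩ := hσ.surj b hb
      exact ⟨_, (hmem _).2 ⟨c, hc, hcp, rfl⟩, rfl⟩)
    (by
      have h1 : termsOf ((r.body.filter fun a => pred a ≠ (e, 2)).toList.map (tagE e)) =
          termsOf (r.body.filter fun a => pred a ≠ (e, 2)).toList := by
        simp [termsOf, List.flatMap_map, tagE_snd]
      rw [h1, termsOf, List.nodup_flatMap]
      have hocc : ∀ a ∈ (r.body.filter fun a => pred a ≠ (e, 2)).toList, ∀ (i x : ℕ),
          a.2[i]? = some x → OccursAt e r.body x (a, i) := fun a ha i x hi => by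
        rw [Finset.mem_toList, Finset.mem_filter] at ha
        exact ⟨ha.1, ha.2, hi⟩
      constructor
      · intro a ha
        refine List.pairwise_iff_getElem.2 fun i j hi hj hij heq => ?_
        have h2 := huniq _ _ _ (hocc a ha i _ (List.getElem?_eq_getElem hi))
          (hocc a ha j _ (heq ▸ List.getElem?_eq_getElem hj))
        exact hij.ne (Prod.ext_iff.1 h2).2
      · refine List.Nodup.pairwise_of_forall_ne (Finset.nodup_toList _) fun a ha b hb hab => ?_
        intro x hxa hxb
        obtain ⟨i, hi⟩ := List.mem_iff_getElem?.1 hxa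
        obtain ⟨j, hj⟩ := List.mem_iff_getElem?.1 hxb
        exact hab (Prod.ext_iff.1 (huniq _ _ _ (hocc a ha i x hi) (hocc b hb j x hj))).1)
    (fun y hy => by
      obtain ⟨o, ho⟩ := (hterms y).1 hy
      refine (hσ.linked y o ho).imp_right fun h1 => List.mem_map.2
        ⟨(e, [σ y, y]), ?_, rfl⟩
      rw [Finset.mem_toList, Finset.mem_filter]
      exact ⟨h1, rfl⟩)
    (fun d hd => by
      obtain ⟨a, ha, rfl⟩ := List.mem_map.1 hd
      rw [Finset.mem_toList, Finset.mem_filter] at ha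
      obtain ⟨x, y, rfl, h1, h2, h3, h4⟩ := hσ.eqs a ha.1 ha.2
      exact ⟨(hterms _).2 h3, (hterms _).2 h4, h1, h2⟩)
    (fun v hv _ => hσ.fixed v (hV v hv)) hp2
    (fun x hx => by
      have hx' : x ∈ r.frontier := Finset.mem_toList.1 hx
      exact (hterms x).2 (hvars x (Finset.mem_inter.1 hx').1))
    (fun v hv hv' => by
      obtain ⟨o, ho⟩ := (hterms v).1 hv'
      exact Finset.mem_toList.2 (Finset.mem_inter.2
        ⟨ho.mem_vars, mem_termsOf_ruleOf_head.1 hv⟩))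
  refine ⟨_, hw, ?_⟩
  simp only [toRule, ruleOf, List.map_map, Prod.mk.injEq, and_true, List.append_cancel_left_eq]
  refine List.map_congr_left fun a ha => ?_
  rw [Finset.mem_toList, Finset.mem_filter] at ha
  obtain ⟨x, y, rfl, -⟩ := hσ.eqs a ha.1 ha.2
  simp [tagE, pred]

/-- A simulation of a dependency is a splitting of its internal form. -/
theorem exists_isSplit_of_simulates {e : ℕ} {c : DepCode} {r : Tgd}
    (he : ((e, 2) : Pred) ∉ (DepCode.decode c).preds) (h : Simulates e (DepCode.decode c) r) :
    ∃ w, IsSplit (preDep c) w ∧ toRule w = ruleOf e r := by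
  rcases c with c | c
  · obtain ⟨h1, h2⟩ := h
    have hb : ∀ a ∈ c.1.toFinset, pred a ≠ (e, 2) := fun a ha h3 =>
      he (Or.inl ⟨a, ha, h3⟩)
    have hh : ∀ a ∈ c.2.toFinset, pred a ≠ (e, 2) := fun a ha h3 =>
      he (Or.inr ⟨a, ha, h3⟩)
    refine exists_isSplit_of_splitsTo hb h1 (fun a => ?_) (fun a => ?_) fun v hv => ?_
    · simp [preDep, mem_tag]
    · rw [mem_ruleOf_head, h2]
      simp only [preDep, Sum.elim_inl, mem_tag, TgdCode.decode, List.mem_toFinset]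
      refine exists_congr fun b => and_congr_right fun hb => ?_
      rw [tagE, if_neg (hh b (by simpa using hb))]
    · simp only [preDep, Sum.elim_inl, termsOf_tag] at hv
      exact mem_vars_toFinset.2 hv
  · obtain ⟨h1, h2⟩ := h
    have hb : ∀ a ∈ c.1.toFinset, pred a ≠ (e, 2) := fun a ha h3 =>
      he ⟨a, ha, h3⟩
    refine exists_isSplit_of_splitsTo hb h1 (fun a => ?_) (fun a => ?_) fun v hv => ?_
    · simp [preDep, mem_tag]
    · rw [mem_ruleOf_head, h2]
      simp [preDep, tagE, pred, eq_comm]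
    · simpa [preDep, termsOf] using hv

/-! ### The Herbrand model of the critical instance -/

/-- The value of a head variable of `r` under the valuation `θ` of the body variables. -/
def Tgd.skolemVal (r : Tgd) (θ : Var → SkTerm) (v : Var) : SkTerm := (r.skolemVar v).subst θ

theorem Tgd.skolemVal_of_mem {r : Tgd} {θ : Var → SkTerm} {v : Var} (h : v ∈ vars r.body) :
    r.skolemVal θ v = θ v := by
  simp [skolemVal, skolemVar, h, SkTerm.subst]

theorem Tgd.skolemVal_of_notMem {r : Tgd} {θ : Var → SkTerm} {v : Var} (h : v ∉ vars r.body) :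
    r.skolemVal θ v = .fn r v fun x => θ x.1 := by
  simp [skolemVal, skolemVar, h, SkTerm.subst]

theorem herbrand_step {T : Set Tgd} {I : Instance} {r : Tgd} (hr : r ∈ T) {θ : Var → SkTerm}
    (hb : ∀ b ∈ r.body, Herbrand (skolemProgram T) I (mapAtom θ b)) {h : Atom Var}
    (hh : h ∈ r.head) : Herbrand (skolemProgram T) I (mapAtom (r.skolemVal θ) h) := by
  have := Herbrand.step (P := skolemProgram T) (I := I) r.skolemize ⟨r, hr, rfl⟩ θ hb
    (mapAtom r.skolemVar h) ⟨h, hh, rfl⟩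
  rwa [mapAtom_mapAtom] at this

/-- The instance with all atoms over a single element for the predicates `ps` and the equality
predicate. -/
def critical (e : ℕ) (ps : List Pred) : Instance :=
  insert (e, [0, 0]) {a | ∃ p ∈ ps, (p.1, (List.range p.2).map fun _ => 0) = a}

theorem critical_finite (e : ℕ) (ps : List Pred) : (critical e ps).Finite := by
  refine Set.Finite.insert _ ((List.finite_toSet
    (ps.map fun p => ((p.1, (List.range p.2).map fun _ => 0) : Atom Var))).subset ?_)
  rintro _ ⟨p, hp, rfl⟩
  exact List.mem_map_of_mem (f := fun p : Pred => (p.1, (List.range p.2).map fun _ => 0)) hp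

section

variable {e : ℕ} {S : Set Dependency} {T : Set Tgd} {ps : List Pred}

theorem IsSim.symmRule_mem (h : IsSim e S T) : symmRule e ∈ T := by
  obtain ⟨-, g, -, rfl⟩ := h
  exact Or.inl (Or.inl (Or.inl rfl))

theorem IsSim.transRule_mem (h : IsSim e S T) : transRule e ∈ T := by
  obtain ⟨-, g, -, rfl⟩ := h
  exact Or.inl (Or.inl (Or.inr rfl))

theorem IsSim.reflRule_mem (h : IsSim e S T) {p : Pred} (hp : p ∈ predsOfDeps S) :
    reflRule e p ∈ T := by
  obtain ⟨-, g, -, rfl⟩ := h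
  exact Or.inl (Or.inr ⟨p, hp, rfl⟩)

theorem IsSim.pred_head (h : IsSim e S T) {r : Tgd} (hr : r ∈ T) {a : Atom Var}
    (ha : a ∈ r.head) : pred a ∈ predsOfDeps S ∨ pred a = (e, 2) := by
  obtain ⟨-, g, hg, rfl⟩ := h
  rcases hr with ((rfl | rfl) | ⟨p, -, rfl⟩) | ⟨d, hd, rfl⟩
  · obtain rfl := Finset.mem_singleton.1 ha
    exact Or.inr rfl
  · obtain rfl := Finset.mem_singleton.1 ha
    exact Or.inr rfl
  · obtain ⟨i, -, rfl⟩ := Finset.mem_image.1 ha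
    exact Or.inr rfl
  · have hs := hg d hd
    rcases d with d | d
    · rw [hs.2] at ha
      exact Or.inl (Set.mem_biUnion hd (Or.inr ⟨a, ha, rfl⟩))
    · rw [hs.2] at ha
      obtain rfl := Finset.mem_singleton.1 ha
      exact Or.inr rfl

theorem IsSim.herbrand_symm (h : IsSim e S T) {I : Instance} {t u : SkTerm}
    (htu : Herbrand (skolemProgram T) I (e, [t, u])) :
    Herbrand (skolemProgram T) I (e, [u, t]) := by
  have h1 := herbrand_step h.symmRule_mem (θ := fun x => if x = 0 then t else u) (I := I)
    (by simpa [symmRule, mapAtom] using htu) (h := (e, [1, 0])) (by simp [symmRule])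
  simpa [mapAtom, Tgd.skolemVal, Tgd.skolemVar, symmRule, vars, SkTerm.subst] using h1

theorem IsSim.herbrand_trans (h : IsSim e S T) {I : Instance} {t u v : SkTerm}
    (htu : Herbrand (skolemProgram T) I (e, [t, u]))
    (huv : Herbrand (skolemProgram T) I (e, [u, v])) :
    Herbrand (skolemProgram T) I (e, [t, v]) := by
  have h1 := herbrand_step h.transRule_mem
    (θ := fun x => if x = 0 then t else if x = 1 then u else v) (I := I)
    (by simpa [transRule, mapAtom] using ⟨htu, huv⟩) (h := (e, [0, 2])) (by simp [transRule])
  simpa [mapAtom, Tgd.skolemVal, Tgd.skolemVar, transRule, vars, SkTerm.subst] using h1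

theorem IsSim.herbrand_refl_of_pred (h : IsSim e S T) {I : Instance} {a : Atom SkTerm}
    (ha : Herbrand (skolemProgram T) I a) (hp : pred a ∈ predsOfDeps S) {t : SkTerm}
    (ht : t ∈ a.2) : Herbrand (skolemProgram T) I (e, [t, t]) := by
  obtain ⟨i, hi, rfl⟩ := List.mem_iff_getElem.1 ht
  have hmap : mapAtom (fun x => a.2.getD x (.var 0)) (a.1, List.range a.2.length) = a := by
    refine Prod.ext rfl (List.ext_getElem (by simp [mapAtom]) fun j hj hj' => ?_)
    simp [mapAtom, List.getElem?_eq_getElem hj']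
  have h1 := herbrand_step (h.reflRule_mem hp) (θ := fun x => a.2.getD x (.var 0)) (I := I)
    (fun b hb => by
      obtain rfl := Finset.mem_singleton.1 hb
      change Herbrand _ _ (mapAtom _ (a.1, List.range a.2.length))
      rwa [hmap]) (h := (e, [i, i])) (by simpa [reflRule, pred] using hi)
  have hv : i ∈ vars (reflRule e (pred a)).body := by
    simpa [reflRule, vars, pred] using hi
  have h2 : (reflRule e (pred a)).skolemVal (fun x => a.2.getD x (.var 0)) i = a.2[i] := by
    rw [Tgd.skolemVal_of_mem hv, List.getD_eq_getElem _ _ hi]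
  simp only [mapAtom, List.map_cons, List.map_nil, h2] at h1
  exact h1

/-- Equality is reflexive on all terms of the Herbrand model of the critical instance. -/
theorem IsSim.herbrand_refl (h : IsSim e S T) {a : Atom SkTerm}
    (ha : Herbrand (skolemProgram T) (critical e ps) a) {t : SkTerm} (ht : t ∈ a.2) :
    Herbrand (skolemProgram T) (critical e ps) (e, [t, t]) := by
  have h0 : Herbrand (skolemProgram T) (critical e ps) (e, [.var 0, .var 0]) :=
    Herbrand.base (e, [0, 0]) (Or.inl rfl)
  have hE : ∀ b : Atom SkTerm, Herbrand (skolemProgram T) (critical e ps) b → pred b = (e, 2) →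
      t ∈ b.2 → Herbrand (skolemProgram T) (critical e ps) (e, [t, t]) := by
    rintro ⟨n, ts⟩ hb hp ht
    obtain ⟨rfl, h2⟩ := Prod.ext_iff.1 hp
    obtain ⟨u, v, rfl⟩ := List.length_eq_two.1 h2
    have h3 : t = u ∨ t = v := by simpa using ht
    rcases h3 with rfl | rfl
    · exact h.herbrand_trans hb (h.herbrand_symm hb)
    · exact h.herbrand_trans (h.herbrand_symm hb) hb
  have ha' := ha
  cases ha with
  | base b hb =>
    rcases hb with rfl | ⟨p, -, rfl⟩
    · exact hE _ ha' rfl ht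
    · have : t = .var 0 := by
        simp only [mapAtom, List.map_map, List.mem_map] at ht
        obtain ⟨_, -, rfl⟩ := ht
        rfl
      rw [this]
      exact h0
  | step ρ hρ θ hbody b hh =>
    obtain ⟨r, hr, rfl⟩ := hρ
    obtain ⟨c, hc, rfl⟩ := hh
    rcases h.pred_head hr hc with h1 | h1
    · exact h.herbrand_refl_of_pred ha' (by rwa [pred_mapAtom, pred_mapAtom]) ht
    · exact hE _ ha' (by rwa [pred_mapAtom, pred_mapAtom]) ht

end

/-! ### Shapes of Skolem terms -/

/-- The height of a Skolem term. -/
noncomputable def SkTerm.height : SkTerm → ℕ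
  | .var _ => 0
  | .fn _ _ args => (Finset.univ.sup fun x => (args x).height) + 1

/-- The number of leaves of a Skolem term. -/
noncomputable def SkTerm.leaves : SkTerm → ℕ
  | .var _ => 1
  | .fn _ _ args => ∑ x, (args x).leaves

/-- The entry of a term in the table of shapes, where `idx` numbers the terms. -/
noncomputable def shapeOf (e : ℕ) (idx : SkTerm → ℕ) : SkTerm → Shape
  | .var v => ((SkTerm.var v).height, (SkTerm.var v).leaves, ([], [], []), 0, [])
  | .fn r z args => ((SkTerm.fn r z args).height, (SkTerm.fn r z args).leaves, ruleOf e r, z,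
      r.frontier.toList.map fun x => if h : x ∈ r.frontier then idx (args ⟨x, h⟩) else 0)

theorem shapeOf_height (e : ℕ) (idx : SkTerm → ℕ) (t : SkTerm) :
    (shapeOf e idx t).1 = t.height := by
  cases t <;> rfl

theorem shapeOf_leaves (e : ℕ) (idx : SkTerm → ℕ) (t : SkTerm) :
    (shapeOf e idx t).2.1 = t.leaves := by
  cases t <;> rfl

theorem exists_list_of_lists (N V : ℕ) :
    ∃ L : List (List ℕ), ∀ l, l ∈ L ↔ l.length ≤ V ∧ ∀ x ∈ l, x < N := by
  induction V with
  | zero =>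
    refine ⟨[[]], fun l => ⟨fun h => ?_, fun h => ?_⟩⟩
    · obtain rfl := List.mem_singleton.1 h
      simp
    · simpa using h.1
  | succ V ih =>
    obtain ⟨L, hL⟩ := ih
    refine ⟨[] :: L.flatMap fun l => (List.range N).map fun d => d :: l, fun l => ?_⟩
    cases l with
    | nil => simp
    | cons d l =>
      simp only [List.mem_cons, reduceCtorEq, List.mem_flatMap, List.mem_map, List.mem_range,
        List.cons.injEq, false_or, List.length_cons, Nat.add_le_add_iff_right, forall_eq_or_imp,
        hL]
      constructor
      · rintro ⟨l', ⟨h1, h2⟩, d', h3, rfl, rfl⟩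
        exact ⟨h1, h3, h2⟩
      · rintro ⟨h1, h3, h2⟩
        exact ⟨l, ⟨h1, h2⟩, d, h3, rfl, rfl⟩

theorem exists_listsOk (N V : ℕ) : ∃ L, listsOk N V L = true := by
  obtain ⟨L, hL⟩ := exists_list_of_lists N V
  refine ⟨L, ?_⟩
  simp only [listsOk, Bool.and_eq_true, List.all_eq_true, decide_eq_true_eq,
    Bool.or_eq_true, List.mem_range]
  refine ⟨(hL _).2 (by simp), fun l hl => or_iff_not_imp_left.2 fun hV d hd => (hL _).2 ⟨?_, ?_⟩⟩
  · rw [List.length_append, List.length_singleton]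
    omega
  · intro x hx
    rcases List.mem_append.1 hx with hx | hx
    · exact ((hL l).1 hl).2 x hx
    · rwa [List.mem_singleton.1 hx]

theorem tagE_mapAtom {τ τ' : Type} (e : ℕ) (f : τ → τ') (a : Atom τ) :
    tagE e (mapAtom f a) = mapAtom f (tagE e a) := by
  unfold tagE
  rw [pred_mapAtom]
  split_ifs <;> rfl

/-- The internal name of an atom, together with its arity, determines its name. -/
theorem fst_eq_of_tagE {τ τ' : Type} {e : ℕ} {a : Atom τ} {b : Atom τ'}
    (h1 : (tagE e a).1 = (tagE e b).1) : a.1 = b.1 := by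
  unfold tagE at h1
  split_ifs at h1 with h3 h4 h4
  · exact (Prod.ext_iff.1 h3).1.trans (Prod.ext_iff.1 h4).1.symm
  · exact Nat.add_right_cancel h1

section

variable {e : ℕ} {S : Set Dependency} {T : Set Tgd} {ps : List Pred}

/-- An enumeration `terms` of the terms of the Herbrand model of the critical instance, beginning
with its single element, and the internal form `C` of the model over the indices of terms,
extended by the critical facts and the goal. -/
structure IsTermModel (e : ℕ) (T : Set Tgd) (ps : List Pred) (terms : List SkTerm)
    (idx : SkTerm → ℕ) (C : List (Atom ℕ)) : Prop where
  pos : 0 < terms.length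
  idx_var : idx (.var 0) = 0
  idx_lt : ∀ a, Herbrand (skolemProgram T) (critical e ps) a → ∀ t ∈ a.2, idx t < terms.length
  getD_idx : ∀ t, idx t < terms.length → terms.getD (idx t) (.var 0) = t
  idx_getD : ∀ c < terms.length, idx (terms.getD c (.var 0)) = c
  mem_iff : ∀ b, b ∈ C ↔
    (∃ a, Herbrand (skolemProgram T) (critical e ps) a ∧ mapAtom idx (tagE e a) = b) ∨
    (∃ p ∈ ps, (p.1 + 2, (List.range p.2).map fun _ => 0) = b) ∨ b = (1, [])

theorem exists_isTermModel (e : ℕ) (ps : List Pred) (hT : TgdsTerminate T) :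
    ∃ terms idx C, IsTermModel e T ps terms idx C := by
  classical
  have hfin := hT _ (critical_finite e ps)
  let F : Finset SkTerm := hfin.toFinset.biUnion fun a => a.2.toFinset
  let terms : List SkTerm := .var 0 :: (F.erase (.var 0)).toList
  have hnd : terms.Nodup := List.nodup_cons.2 ⟨by simp, Finset.nodup_toList _⟩
  let CS : Set (Atom ℕ) :=
    {b | (∃ a, Herbrand (skolemProgram T) (critical e ps) a ∧
        mapAtom (fun t => terms.idxOf t) (tagE e a) = b) ∨
      (∃ p ∈ ps, (p.1 + 2, (List.range p.2).map fun _ => 0) = b) ∨ b = (1, [])}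
  have hCS : CS.Finite := by
    refine Set.Finite.union ?_ (Set.Finite.union ?_ (Set.finite_singleton _))
    · exact hfin.image fun a => mapAtom (fun t => terms.idxOf t) (tagE e a)
    · exact (List.finite_toSet ps).image fun p =>
        (p.1 + 2, (List.range p.2).map fun _ => 0)
  refine ⟨terms, fun t => terms.idxOf t, hCS.toFinset.toList, by simp [terms], by simp [terms],
    fun a ha t ht => ?_, fun t ht => ?_, fun c hc => ?_, fun b => ?_⟩
  · refine List.idxOf_lt_length_iff.2 ?_
    by_cases h0 : t = .var 0
    · simp [terms, h0]
    · refine List.mem_cons_of_mem _ (Finset.mem_toList.2 (Finset.mem_erase.2 ⟨h0, ?_⟩))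
      exact Finset.mem_biUnion.2 ⟨a, hfin.mem_toFinset.2 ha, List.mem_toFinset.2 ht⟩
  · rw [List.getD_eq_getElem _ _ ht, List.getElem_idxOf]
  · rw [List.getD_eq_getElem _ _ hc, hnd.idxOf_getElem]
  · rw [Finset.mem_toList, Set.Finite.mem_toFinset]
    rfl

variable {terms : List SkTerm} {idx : SkTerm → ℕ} {C : List (Atom ℕ)}

theorem IsTermModel.lt (h : IsTermModel e T ps terms idx C) : ∀ a ∈ C, ∀ c ∈ a.2,
    c < terms.length := by
  intro b hb c hc
  rcases (h.mem_iff b).1 hb with ⟨a, ha, rfl⟩ | ⟨p, -, rfl⟩ | rfl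
  · obtain ⟨t, ht, rfl⟩ := List.mem_map.1 hc
    exact h.idx_lt a ha t (tagE_snd e a ▸ ht)
  · obtain ⟨_, -, rfl⟩ := List.mem_map.1 hc
    exact h.pos
  · simp at hc

theorem IsTermModel.shape_idx (h : IsTermModel e T ps terms idx C) {t : SkTerm}
    (ht : idx t < terms.length) :
    shape (terms.map (shapeOf e idx)) (idx t) = shapeOf e idx t := by
  have h1 := h.getD_idx t ht
  rw [List.getD_eq_getElem _ _ ht] at h1
  rw [shape, List.getD_eq_getElem _ _ (by simpa using ht), List.getElem_map, h1]

/-- A match of a rule body in `C` is a match in the Herbrand model. -/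
theorem IsTermModel.herbrand_of_mem (h : IsTermModel e T ps terms idx C) {b : Atom Var}
    {f : Var → ℕ} (hb : mapAtom f (tagE e b) ∈ C) :
    Herbrand (skolemProgram T) (critical e ps)
      (mapAtom (fun x => terms.getD (f x) (.var 0)) b) := by
  rcases (h.mem_iff _).1 hb with ⟨a, ha, hab⟩ | ⟨p, hp, hpb⟩ | hb
  · obtain ⟨h1, h2⟩ := Prod.ext_iff.1 hab
    simp only [mapAtom, tagE_snd] at h1 h2
    have h3 : mapAtom (fun x => terms.getD (f x) (.var 0)) b = a := by
      refine Prod.ext (fst_eq_of_tagE h1).symm ?_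
      have h4 := congrArg (List.map fun c => terms.getD c (.var 0)) h2
      rw [List.map_map, List.map_map] at h4
      refine h4.symm.trans ((List.map_congr_left fun t ht => ?_).trans (List.map_id _))
      exact h.getD_idx t (h.idx_lt a ha t ht)
    rwa [h3]
  · obtain ⟨h1, h2⟩ := Prod.ext_iff.1 hpb
    simp only [mapAtom, tagE_snd] at h1 h2
    have h3 : p.1 = b.1 := by
      unfold tagE at h1
      split_ifs at h1
      exact Nat.add_right_cancel h1
    have h5 := Herbrand.base (P := skolemProgram T) (I := critical e ps) _
      (Or.inr ⟨p, hp, rfl⟩)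
    have h6 : mapAtom (fun x => terms.getD (f x) (.var 0)) b =
        mapAtom SkTerm.var (p.1, (List.range p.2).map fun _ => 0) := by
      refine Prod.ext h3.symm ?_
      have h4 := congrArg (List.map fun c => terms.getD c (.var 0)) h2
      rw [List.map_map, List.map_map] at h4
      refine h4.symm.trans ?_
      simp only [mapAtom, List.map_map]
      refine List.map_congr_left fun _ _ => ?_
      have := h.getD_idx (.var 0) (by rw [h.idx_var]; exact h.pos)
      rwa [h.idx_var] at this
    rwa [h6]
  · have h1 := (Prod.ext_iff.1 hb).1
    simp only [mapAtom, tagE] at h1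
    split_ifs at h1
    simp at h1

theorem IsTermModel.mem_of_herbrand (h : IsTermModel e T ps terms idx C) {b : Atom Var}
    {f : Var → ℕ} {θ : Var → SkTerm} (hf : ∀ x ∈ b.2, f x = idx (θ x))
    (hb : Herbrand (skolemProgram T) (critical e ps) (mapAtom θ b)) :
    mapAtom f (tagE e b) ∈ C := by
  refine (h.mem_iff _).2 (Or.inl ⟨_, hb, ?_⟩)
  rw [tagE_mapAtom, mapAtom_mapAtom]
  exact mapAtom_congr fun x hx => (hf x (tagE_snd e b ▸ hx)).symm

/-- The equality facts of `C` are those of the Herbrand model. -/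
theorem IsTermModel.eq_mem_iff (h : IsTermModel e T ps terms idx C) {c d : ℕ} :
    (0, [c, d]) ∈ C ↔ ∃ t u, Herbrand (skolemProgram T) (critical e ps) (e, [t, u]) ∧
      idx t = c ∧ idx u = d := by
  constructor
  · intro hcd
    have hlt := h.lt _ hcd
    have h1 := h.herbrand_of_mem (b := (e, [0, 1])) (f := fun x => if x = 0 then c else d)
      (by simpa [tagE, pred, mapAtom] using hcd)
    refine ⟨_, _, h1, ?_, ?_⟩
    · simpa using h.idx_getD c (hlt c (by simp))
    · simpa using h.idx_getD d (hlt d (by simp))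
  · rintro ⟨t, u, h1, rfl, rfl⟩
    exact (h.mem_iff _).2 (Or.inl ⟨_, h1, by simp [tagE, pred, mapAtom]⟩)

theorem IsTermModel.eq_symm (h : IsTermModel e T ps terms idx C) (hs : IsSim e S T) {c d : ℕ}
    (hcd : (0, [c, d]) ∈ C) : (0, [d, c]) ∈ C := by
  obtain ⟨t, u, h1, h2, h3⟩ := h.eq_mem_iff.1 hcd
  exact h.eq_mem_iff.2 ⟨u, t, hs.herbrand_symm h1, h3, h2⟩

theorem IsTermModel.eq_trans (h : IsTermModel e T ps terms idx C) (hs : IsSim e S T)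
    {b c d : ℕ} (hbc : (0, [b, c]) ∈ C) (hcd : (0, [c, d]) ∈ C) : (0, [b, d]) ∈ C := by
  obtain ⟨t, u, h1, h2, h3⟩ := h.eq_mem_iff.1 hbc
  obtain ⟨u', v, h4, h5, h6⟩ := h.eq_mem_iff.1 hcd
  have huu : u = u' := by
    rw [← h.getD_idx u (h.idx_lt _ h1 u (by simp)),
      ← h.getD_idx u' (h.idx_lt _ h4 u' (by simp)), h3, h5]
  subst huu
  exact h.eq_mem_iff.2 ⟨t, v, hs.herbrand_trans h1 h4, h2, h6⟩

theorem IsTermModel.eq_refl (h : IsTermModel e T ps terms idx C) (hs : IsSim e S T)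
    {a : Atom ℕ} (ha : a ∈ C) {c : ℕ} (hc : c ∈ a.2) : (0, [c, c]) ∈ C := by
  rcases (h.mem_iff a).1 ha with ⟨b, hb, rfl⟩ | ⟨p, -, rfl⟩ | rfl
  · obtain ⟨t, ht, rfl⟩ := List.mem_map.1 hc
    exact h.eq_mem_iff.2 ⟨t, t, hs.herbrand_refl hb (tagE_snd e b ▸ ht), rfl, rfl⟩
  · obtain ⟨_, -, rfl⟩ := List.mem_map.1 hc
    exact h.eq_mem_iff.2 ⟨.var 0, .var 0, Herbrand.base (e, [0, 0]) (Or.inl rfl),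
      h.idx_var, h.idx_var⟩
  · simp at hc

/-- A match of a rule in `C` extends to an instance with head in `C`. -/
def Extends (Ts : List Rule) (m V : ℕ) (Tab : List Shape) (C : List (Atom ℕ)) (r : Rule) : Prop :=
  ∀ l : List ℕ, l.length = V → (∀ b ∈ r.1, mapAtom (ap l) b ∈ C) →
    ∃ θ : List ℕ, (∀ A, (∀ a ∈ (typedRule m Tab (r, θ)).1, pred a ∈ A) →
        (∀ a ∈ (typedRule m Tab (r, θ)).2, pred a ∈ A) → IsInst Ts m Tab A (r, θ)) ∧
      (∀ x ∈ termsOf r.1, ap θ x = ap l x) ∧ ∀ h ∈ r.2.1, mapAtom (ap θ) h ∈ C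

theorem extends_of_datalog {Ts : List Rule} {m V : ℕ} {Tab : List Shape} {C : List (Atom ℕ)}
    {r : Rule} (hr : r ∈ Ts) (h1 : ∀ x ∈ r.2.2, x ∈ termsOf r.1)
    (h2 : ∀ x ∈ termsOf r.2.1, x ∈ r.2.2)
    (h3 : ∀ l : List ℕ, (∀ b ∈ r.1, mapAtom (ap l) b ∈ C) → ∀ h ∈ r.2.1, mapAtom (ap l) h ∈ C) :
    Extends Ts m V Tab C r := fun l _ hl =>
  ⟨l, fun _ hA1 hA2 => ⟨hr, h1, fun z hz hz' => absurd (h2 z hz) hz', hA1, hA2⟩,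
    fun _ _ => rfl, h3 l hl⟩

theorem length_flatMap_block (Tab : List Shape) (θ X : List ℕ) :
    (X.flatMap fun y => block Tab θ y).length = (X.map fun y => width Tab (ap θ y)).sum := by
  rw [List.length_flatMap]
  simp only [length_block]

/-- The rules of the simulation extend in `C`: existential variables take Skolem terms. -/
theorem IsTermModel.extends_ruleOf (h : IsTermModel e T ps terms idx C) {Ts : List Rule}
    {m V : ℕ} {r : Tgd} (hrT : r ∈ T) (hr : ruleOf e r ∈ Ts)
    (hV : ∀ x, x ∈ vars r.body ∨ x ∈ vars r.head → x < V) :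
    Extends Ts m V (terms.map (shapeOf e idx)) C (ruleOf e r) := by
  intro l hlen hl
  set θ : Var → SkTerm := fun x => terms.getD (ap l x) (.var 0) with hθ
  have hbody : ∀ b ∈ r.body, Herbrand (skolemProgram T) (critical e ps) (mapAtom θ b) :=
    fun b hb => h.herbrand_of_mem (hl _ (mem_ruleOf_body.2 ⟨b, hb, rfl⟩))
  have hhead : ∀ b ∈ r.head,
      Herbrand (skolemProgram T) (critical e ps) (mapAtom (r.skolemVal θ) b) :=
    fun b hb => herbrand_step hrT hbody hb
  set θ' : List ℕ := (List.range V).map fun x => idx (r.skolemVal θ x) with hθ'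
  have hap : ∀ x, x ∈ vars r.body ∨ x ∈ vars r.head → ap θ' x = idx (r.skolemVal θ x) :=
    fun x hx => ap_map_range _ (hV x hx)
  have hbv : ∀ x ∈ vars r.body, ap θ' x = idx (θ x) := fun x hx => by
    rw [hap x (Or.inl hx), Tgd.skolemVal_of_mem hx]
  have hlt : ∀ x ∈ vars r.body, idx (θ x) < terms.length := by
    intro x hx
    obtain ⟨b, hb, hxb⟩ := mem_vars.1 hx
    exact h.idx_lt _ (hbody b hb) _ (List.mem_map_of_mem hxb)
  have hfr : ∀ x ∈ r.frontier, x ∈ vars r.body := fun x hx => (Finset.mem_inter.1 hx).1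
  refine ⟨θ', fun A hA1 hA2 => ⟨hr, fun x hx => ?_, fun z hz hzX => ?_, hA1, hA2⟩,
    fun x hx => ?_, fun a ha => ?_⟩
  · exact mem_termsOf_ruleOf_body.2 (hfr x (Finset.mem_toList.1 hx))
  · have hzh : z ∈ vars r.head := mem_termsOf_ruleOf_head.1 hz
    have hzb : z ∉ vars r.body := fun hzb =>
      hzX (Finset.mem_toList.2 (Finset.mem_inter.2 ⟨hzb, hzh⟩))
    have hapz : ap θ' z = idx (.fn r z fun x => θ x.1) := by
      rw [hap z (Or.inr hzh), Tgd.skolemVal_of_notMem hzb]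
    have hltz : idx (.fn r z fun x => θ x.1) < terms.length := by
      obtain ⟨b, hb, hzb'⟩ := mem_vars.1 hzh
      refine h.idx_lt _ (hhead b hb) _ ?_
      rw [← Tgd.skolemVal_of_notMem hzb]
      exact List.mem_map_of_mem hzb'
    have hshz : shape (terms.map (shapeOf e idx)) (ap θ' z) =
        shapeOf e idx (.fn r z fun x => θ x.1) := by
      rw [hapz, h.shape_idx hltz]
    have hshx : ∀ x ∈ r.frontier, shape (terms.map (shapeOf e idx)) (ap θ' x) =
        shapeOf e idx (θ x) := fun x hx => by
      rw [hbv x (hfr x hx), h.shape_idx (hlt x (hfr x hx))]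
    refine ⟨fun hz' => hzb (mem_termsOf_ruleOf_body.1 hz'), fun h0 => ?_, ?_, fun x hx => ?_, ?_⟩
    · have h1 := h.getD_idx _ hltz
      have h2 := h.getD_idx (.var 0) (by rw [h.idx_var]; exact h.pos)
      dsimp only at h0
      rw [← hapz, h0] at h1
      rw [h.idx_var, h1] at h2
      exact SkTerm.noConfusion h2
    · dsimp only
      rw [hshz]
      simp only [shapeOf, Prod.mk.injEq, true_and]
      refine List.map_congr_left fun x hx => ?_
      have hx' := Finset.mem_toList.1 hx
      rw [dif_pos hx', hbv x (hfr x hx')]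
    · have hx' : x ∈ r.frontier := Finset.mem_toList.1 hx
      dsimp only
      rw [hshz, hshx x hx', shapeOf_height, shapeOf_height, SkTerm.height]
      exact Nat.lt_succ_of_le
        (Finset.le_sup (f := fun y : {x // x ∈ r.frontier} => (θ y.1).height)
          (Finset.mem_univ ⟨x, hx'⟩))
    · rw [length_flatMap_block]
      dsimp only
      rw [width, hshz, shapeOf_leaves, SkTerm.leaves]
      have h1 : ∀ x ∈ (ruleOf e r).2.2, width (terms.map (shapeOf e idx)) (ap θ' x) =
          (θ x).leaves := fun x hx => by
        rw [width, hshx x (Finset.mem_toList.1 hx), shapeOf_leaves]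
      rw [List.map_congr_left h1, ruleOf, Finset.sum_map_toList]
      exact Finset.sum_coe_sort r.frontier fun x => (θ x).leaves
  · have hx' := mem_termsOf_ruleOf_body.1 hx
    obtain ⟨b, hb, hxb⟩ := mem_termsOf.1 hx
    have h1 := h.lt _ (hl b hb) (ap l x) (List.mem_map_of_mem hxb)
    rw [hbv x hx', h.idx_getD _ h1]
  · obtain ⟨b, hb, rfl⟩ := mem_ruleOf_head.1 ha
    exact h.mem_of_herbrand (fun x hx => hap x (Or.inr (mem_vars.2 ⟨b, hb, hx⟩))) (hhead b hb)

end

/-! ### Existence of a certificate -/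

theorem exists_splits {s : List DepCode} {q : List (List (Atom ℕ))} {e : ℕ}
    {g : Dependency → Tgd} (he : ((e, 2) : Pred) ∉ predsOfDeps (depsOf s))
    (hg : ∀ d ∈ depsOf s, Simulates e d (g d)) :
    ∀ p ∈ pre s q, ∃ w, IsSplit p w ∧ ((∃ d ∈ depsOf s, toRule w = ruleOf e (g d)) ∨
      w.2.2.1 = [(1, [])] ∧ w.2.2.2.1 = []) := by
  intro p hp
  rcases List.mem_append.1 hp with hp | hp
  · obtain ⟨c, hc, rfl⟩ := List.mem_map.1 hp
    have hd : DepCode.decode c ∈ depsOf s := ⟨c, hc, rfl⟩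
    obtain ⟨w, h1, h2⟩ := exists_isSplit_of_simulates
      (fun h => he (Set.mem_biUnion hd h)) (hg _ hd)
    exact ⟨w, h1, Or.inl ⟨_, hd, h2⟩⟩
  · obtain ⟨Q, -, rfl⟩ := List.mem_map.1 hp
    obtain ⟨w, h1, h2, h3⟩ := exists_isSplit (tag Q, [(1, [])]) (by simp [termsOf])
    exact ⟨w, h1, Or.inr ⟨h2, h3⟩⟩

/-- The rule set of a terminating simulation extends in the term model. -/
theorem IsTermModel.extends_rules {e : ℕ} {S : Set Dependency} {T : Set Tgd} {ps : List Pred}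
    {terms : List SkTerm} {idx : SkTerm → ℕ} {C : List (Atom ℕ)}
    (h : IsTermModel e T ps terms idx C) (hs : IsSim e S T) {W : List Split} {m V : ℕ}
    (hW : ∀ w ∈ W, (∃ r ∈ T, toRule w = ruleOf e r) ∨ w.2.2.1 = [(1, [])] ∧ w.2.2.2.1 = [])
    (hV : ∀ r ∈ rules ps W, ∀ x ∈ termsOf r.1 ++ termsOf r.2.1, x < V) :
    ∀ r ∈ rules ps W, Extends (rules ps W) m V (terms.map (shapeOf e idx)) C r := by
  intro r hr
  have hr' := hr
  simp only [rules, List.mem_cons, List.mem_append, List.mem_map] at hr'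
  rcases hr' with rfl | rfl | ⟨p, hp, rfl⟩ | ⟨w, hw, rfl⟩
  · refine extends_of_datalog hr (by simp [symmR, termsOf]) (by simp [symmR, termsOf])
      fun l hl => ?_
    simp only [symmR, List.mem_singleton, forall_eq, mapAtom, List.map_cons, List.map_nil] at hl ⊢
    exact h.eq_symm hs hl
  · refine extends_of_datalog hr (by simp [transR, termsOf]) (by simp [transR, termsOf])
      fun l hl => ?_
    simp only [transR, List.mem_cons, List.not_mem_nil, or_false, forall_eq_or_imp, forall_eq,
      mapAtom, List.map_cons, List.map_nil] at hl ⊢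
    exact h.eq_trans hs hl.1 hl.2
  · refine extends_of_datalog hr (by simp [reflR, termsOf]) (by simp [reflR, termsOf])
      fun l hl a ha => ?_
    simp only [reflR, List.mem_map] at ha
    obtain ⟨i, hi, rfl⟩ := ha
    exact h.eq_refl hs (hl (p.1 + 2, List.range p.2) (by simp [reflR])) (List.mem_map_of_mem hi)
  · rcases hW w hw with ⟨r, hrT, hwr⟩ | ⟨h1, h2⟩
    · rw [hwr] at hr ⊢
      refine h.extends_ruleOf hrT hr fun x hx => hV _ hr x (List.mem_append.2 ?_)
      rwa [mem_termsOf_ruleOf_body, mem_termsOf_ruleOf_head]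
    · refine extends_of_datalog hr (by simp [toRule, h2]) (by simp [toRule, h1, termsOf])
        fun l _ a ha => ?_
      simp only [toRule, h1, List.mem_singleton] at ha
      subst ha
      exact (h.mem_iff _).2 (Or.inr (Or.inr rfl))

/-- A list of instances that covers all matches over `L`. -/
theorem exists_instances {Ts : List Rule} {m V : ℕ} {Tab : List Shape} {C : List (Atom ℕ)}
    (L : List (List ℕ)) (hb : ∀ r ∈ Ts, ∀ x ∈ termsOf r.1, x < V)
    (h : ∀ r ∈ Ts, Extends Ts m V Tab C r) :
    ∃ inst : List (Rule × List ℕ), IsClosed Ts V C L inst ∧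
      ∀ i ∈ inst, ∀ A, (∀ a ∈ (typedRule m Tab i).1, pred a ∈ A) →
        (∀ a ∈ (typedRule m Tab i).2, pred a ∈ A) → IsInst Ts m Tab A i := by
  classical
  choose F hF using fun (x : {x : Rule × List ℕ // x.1 ∈ Ts ∧ x.2.length = V ∧
    ∀ b ∈ x.1.1, mapAtom (ap x.2) b ∈ C}) => h x.1.1 x.2.1 x.1.2 x.2.2.1 x.2.2.2
  refine ⟨(Ts.product L).filterMap fun x =>
    if hx : x.1 ∈ Ts ∧ x.2.length = V ∧ ∀ b ∈ x.1.1, mapAtom (ap x.2) b ∈ C then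
      some (x.1, F ⟨x, hx⟩) else none, ⟨hb, fun r hr l hl hlen hm => ?_⟩, fun i hi => ?_⟩
  · obtain ⟨-, h2, h3⟩ := hF ⟨(r, l), hr, hlen, hm⟩
    refine ⟨(r, F ⟨(r, l), hr, hlen, hm⟩), List.mem_filterMap.2 ⟨(r, l), ?_, ?_⟩, rfl, h2, h3⟩
    · exact List.mem_product.2 ⟨hr, hl⟩
    · exact dif_pos ⟨hr, hlen, hm⟩
  · obtain ⟨x, -, hx⟩ := List.mem_filterMap.1 hi
    split_ifs at hx with hx'
    obtain rfl := Option.some.inj hx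
    exact (hF ⟨x, hx'⟩).1

/-- Under oblivious termination, some certificate passes the check. -/
theorem exists_chk {s : List DepCode} (q : List (List (Atom ℕ)))
    (h : EnsuresObliviousTermination (depsOf s)) : ∃ k, chk (s, q) k = true := by
  obtain ⟨e, T, hs, hT⟩ := h
  obtain ⟨he, g, hg, hTg⟩ := id hs
  choose! w hw1 hw2 using exists_splits (q := q) he hg
  -- For atoms with internal name `0` or `1` the truncated difference gives relations that are not
  -- needed, but do no harm.
  let ps : List Pred := (pre s q).flatMap fun p => (p.1 ++ p.2).map fun a => (a.1 - 2, a.2.length)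
  let W : List Split := (pre s q).map w
  obtain ⟨V, hV⟩ := exists_forall_lt
    ((rules ps W).flatMap fun r => termsOf r.1 ++ termsOf r.2.1)
  obtain ⟨m, hm⟩ := exists_forall_lt (ps.map Prod.fst)
  obtain ⟨terms, idx, C, hC⟩ := exists_isTermModel (T := T) e ps hT
  have hV' : ∀ r ∈ rules ps W, ∀ x ∈ termsOf r.1 ++ termsOf r.2.1, x < V :=
    fun r hr x hx => hV x (List.mem_flatMap.2 ⟨r, hr, hx⟩)
  have hext := hC.extends_rules hs (W := W) (m := m) (V := V) (fun v hv => by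
    obtain ⟨p, hp, rfl⟩ := List.mem_map.1 hv
    refine (hw2 p hp).imp_left ?_
    rintro ⟨d, hd, h1⟩
    exact ⟨g d, hTg ▸ Or.inr ⟨d, hd, rfl⟩, h1⟩) hV'
  obtain ⟨L, hL⟩ := exists_listsOk terms.length V
  obtain ⟨inst, hcl, hinst⟩ := exists_instances L
    (fun r hr x hx => hV' r hr x (List.mem_append_left _ hx)) hext
  let Tab : List Shape := terms.map (shapeOf e idx)
  let A : List Pred := (name m 1 [], 0) ::
    ((ps.map fun p => (name m (p.1 + 2) ((List.range p.2).map fun _ => 0), p.2)) ++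
      inst.flatMap fun i => ((typedRule m Tab i).1 ++ (typedRule m Tab i).2).map pred)
  have hA : ∀ i ∈ inst, ∀ a ∈ (typedRule m Tab i).1 ++ (typedRule m Tab i).2, pred a ∈ A :=
    fun i hi a ha => List.mem_cons_of_mem _ (List.mem_append_right _
      (List.mem_flatMap.2 ⟨i, hi, List.mem_map_of_mem ha⟩))
  refine ⟨(ps, m, W, V, Tab, C, L, inst, A), chkAux_iff.2 ?_⟩
  refine ⟨fun p hp => ⟨w p, List.mem_map_of_mem hp, hw1 p hp⟩, fun v hv => ?_, fun i hi => ?_,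
    ?_, ?_, hcl, ⟨fun p hp a ha => Or.inr ?_, fun p hp => ?_, fun p hp => ?_, fun p hp => ?_,
      fun p hp => ?_, List.mem_cons_self⟩, ?_⟩
  · obtain ⟨p, hp, rfl⟩ := List.mem_map.1 hv
    exact ⟨p, hp, hw1 p hp⟩
  · exact hinst i hi A (fun a ha => hA i hi a (List.mem_append_left _ ha))
      fun a ha => hA i hi a (List.mem_append_right _ ha)
  · simpa [Tab] using hC.lt
  · simpa [Tab] using hL
  · exact List.mem_flatMap.2 ⟨p, hp, List.mem_map.2 ⟨a, ha, rfl⟩⟩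
  · exact hm _ (List.mem_map_of_mem hp)
  · exact (hC.mem_iff _).2 (Or.inr (Or.inl ⟨p, hp, rfl⟩))
  · exact List.mem_cons_of_mem _ (List.mem_append_left _ (List.mem_map.2 ⟨p, hp, rfl⟩))
  · rcases List.mem_cons.1 hp with rfl | hp
    · exact le_name _ _ _
    · rcases List.mem_append.1 hp with hp | hp
      · obtain ⟨_, -, rfl⟩ := List.mem_map.1 hp
        exact le_name _ _ _
      · obtain ⟨i, -, hp⟩ := List.mem_flatMap.1 hp
        obtain ⟨a, ha, rfl⟩ := List.mem_map.1 hp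
        rcases List.mem_append.1 ha with ha | ha
        · obtain ⟨_, -, rfl⟩ := List.mem_map.1 ha
          exact le_name _ _ _
        · obtain ⟨_, -, rfl⟩ := List.mem_map.1 ha
          exact le_name _ _ _
  · have h0 : idx (.var 0) < terms.length := by rw [hC.idx_var]; exact hC.pos
    have h1 := hC.shape_idx h0
    rw [hC.idx_var] at h1
    rw [width, h1]
    rfl

end DatalogRew

theorem corollary4 :
    ∃ f : List DatalogRew.DepCode × List (List (DatalogRew.Atom DatalogRew.Var)) →.
        DatalogRew.RewritingCode,
      Partrec f ∧
      ∀ (s : List DatalogRew.DepCode) (q : List (List (DatalogRew.Atom DatalogRew.Var))),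
        (∀ d ∈ DatalogRew.depsOf s, d.WellFormed) →
        DatalogRew.EnsuresObliviousTermination (DatalogRew.depsOf s) →
        ∃ o ∈ f (s, q),
          DatalogRew.RewritingCode.IsRewritingFor o
            (DatalogRew.depsOf s) (DatalogRew.instancesOf q) := by
  refine ⟨DatalogRew.search DatalogRew.chk DatalogRew.out,
    DatalogRew.partrec_search DatalogRew.primrec_chk DatalogRew.primrec_out,
    fun s q hwf hterm => ?_⟩
  obtain ⟨k, hk⟩ := DatalogRew.exists_chk q hterm
  obtain ⟨o, ho⟩ := DatalogRew.exists_mem_search (o := DatalogRew.out) hk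
  obtain ⟨k', hk', rfl⟩ := DatalogRew.mem_search ho
  exact ⟨_, ho, DatalogRew.isRewritingFor_out hk' hwf⟩
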